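/- Let $\mathbf k$ be an arbitrary field, $1\le a\le b$ integers, $n=a+b$, $F=\mathbf k((t))$, $A=\mathbf k[[t]]$, $V=F^n$ with standard basis $e_1,\dots,e_n$ and $e_{i+nm}:=t^me_i$ for $m\in\mathbb Z$. Put $E_j=\mathrm{Span}_A\langle e_j,\dots,e_{j+n-1}\rangle$ and $E'_j=\mathrm{Span}_{\mathbf k}\langle e_i\rangle_{i<j}$. Let $\mathrm{Fl}(a,b;V)$ be the (ind-)variety of pairs of $A$-lattices $\Lambda_1\supset\Lambda_2\supset t\Lambda_1$ in $V$ with $\dim\Lambda_1/\Lambda_2=a$, $\dim\Lambda_2/t\Lambda_1=b$. Let $B\subset GL_n(A)$ be the subgroup of matrices that are lower triangular modulo $t$. Let $\widetilde W$ be the group of bijections $\pi$ of $\mathbb Z$ with $\pi(i+n)=\pi(i)+n$, acting by $\pi(e_i)=e_{\pi(i)}$. For $\pi\in\widetilde W$ let $X_\pi$ be the Zariski closure in $\mathrm{Fl}(a,b;V)$ of the cell $B\cdot(\pi E_1\supset\pi E_{a+1})$, and let the opposite cell be $$X'_\pi=\{\Lambda_\bullet\in X_\pi:\ \Lambda_1\cap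 E'_{1+d}=0,\ \Lambda_2\cap E'_{a+1+d}=0\},\qquad nd=\sum_{i=1}^n(\pi(i)-i).$$ Let $\mathcal L=\{(X,Y)\in M_{b\times a}(\mathbf k)\times M_{a\times b}(\mathbf k): XY=0,\ YX=0\}$ be the variety of circular complexes, with the action $(g,h)\cdot(X,Y)=(hXg^{-1},gYh^{-1})$ of $GL_a\times GL_b$, and for $0\le c\le a$ let $\mathcal L_c$ be the Zariski closure of $\{(X,Y)\in\mathcal L:\operatorname{rank}X=c,\ \operatorname{rank}Y=a-c\}$. Define $$\Psi(X,Y)=M\cdot(E_1\supset E_{a+1}),\qquad M=\begin{pmatrix} tI_a& tY\\ X& tI_b\end{pmatrix}.$$ (Varieties are reduced; closures and isomorphisms are those of varieties over $\mathbf k$, not of sets of $\mathbf k$-rational points.) Then: 1. $\mathcal L_0,\dots,\mathcal L_a$ are pairwise distinct and are exactly the irreducible components of $\mathcal L$; each is stable under $GL_a\times GL_b$. The map $\Psi$ on $\mathcal L$ is equivariant, where $(g,h)$ acts on $\mathrm{Fl}(a,b;V)$ through the constant block-diagonal matrix $\mathrm{diag}(g,h)$. 2. For each $c$ there is an element $\pi_c\in\widetilde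 W$ with $$\pi_c=[\,a{+}1,\dots,a{+}c\mid a{+}2b{+}c{+}1,\dots,2a{+}2b\mid a{+}b{+}1,\dots,2a{+}b{-}c\mid 2a{+}b{+}c{+}1,\dots,a{+}2b{+}c\mid 3a{+}2b{-}c{+}1,\dots,3a{+}2b\,]$$ (the values at $1,\dots,n$, in blocks of sizes $c,\ a-c,\ a-c,\ b-a,\ c$), and $\Psi$ restricts to an isomorphism $\mathcal L_c\to X'_{\pi_c}$; moreover $\Psi$ is an isomorphism of $\mathcal L$ onto $\bigcup_{c=0}^aX'_{\pi_c}$. Write $E_{(2)}=E_{a+1}$, $E_{(3)}=E_{a+b+1}$, $E_{(4)}=E_{2a+b+1}$, $E_{(5)}=E_{2a+2b+1}$, and define $E'_{(j)}$ likewise. Then $\Psi(\mathcal L_c)$ is the set of $\Lambda_\bullet\in\mathrm{Fl}(a,b;V)$ with $E_{(2)}\supset\Lambda_1\supset E_{(4)}$ (quotients of dimensions $b$, $a$), $E_{(3)}\supset\Lambda_2\supset E_{(5)}$ (quotients of dimensions $a$, $b$), $\Lambda_1\cap E'_{(3)}=\Lambda_2\cap E'_{(4)}=0$, $\dim(\Lambda_1/\Lambda_1\cap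 E_{(3)})\le c$ and $\dim(\Lambda_2/\Lambda_2\cap E_{(4)})\le a-c$. 3. Let $\mathbf k^{a+2b}=E_{(2)}/E_{(5)}$ with basis $\bar e_i=e_i \bmod E_{(5)}$ $(a<i\le 2a+2b)$, let $\bar t(\bar e_i)=\bar e_{i+n}$ (zero if $i+n>2a+2b$), let $\bar E_{(j)}$ be the image of $E_{(j)}$, and let $\bar E'_{(3)}$, $\bar E'_{(4)}$ be the spans of the $\bar e_i$ with $i\le a+b$, respectively $i\le 2a+b$. Let $\mathrm{Fl}(b,a,b;\mathbf k^{a+2b})$ be the variety of flags $\mathbf k^{a+2b}\supset U_1\supset U_2\supset0$ with successive quotients of dimensions $b,a,b$. Then the set of $U_\bullet$ with $$U_1\supset\bar E_{(4)},\quad U_2\subset\bar E_{(3)},\quad \dim(U_1\cap\bar E_{(3)})\ge a+b-c,\quad \dim(U_2\cap\bar E_{(4)})\ge b-a+c,\quad U_1\cap\bar E'_{(3)}=U_2\cap\bar E'_{(4)}=0$$ is the opposite cell of a Schubert variety of $\mathrm{Fl}(b,a,b;\mathbf k^{a+2b})$ (the closure of the orbit of a coordinate flag under the lower triangular matrices,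 intersected with the open set given by the last two conditions), and $\Lambda_\bullet\mapsto(\Lambda_1/E_{(5)},\Lambda_2/E_{(5)})$ is an isomorphism of $X'_{\pi_c}=\Psi(\mathcal L_c)$ onto the subvariety of this opposite cell cut out by the incidence condition $U_2\supset\bar t(U_1)$. -/

import Mathlib

open scoped PowerSeries LaurentSeries

universe u

noncomputable section

namespace CircComplex

/-! ### Varieties over `k` through their points

A variety over `k` is handled through its functor of points. An ambient space assigns to every
commutative `k`-algebra `R` a set of `R`-points (the `x : Obj R` with `IsPoint R x`) and to every
homomorphism `R → S` of `k`-algebras the base change of points. It is only ever used for the two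
concrete spaces `affFlag` (partial affine flags) and `ordFlag` (ordinary partial flags). -/

/-- An ambient space given by its points with values in commutative `k`-algebras. -/
structure PointFunctor (k : Type u) [Field k] where
  /-- the type in which the `R`-valued points live -/
  Obj : ∀ (R : Type u) [CommRing R] [Algebra k R], Type u
  /-- the condition that cuts out the `R`-valued points -/
  IsPoint : ∀ (R : Type u) [CommRing R] [Algebra k R], Obj R → Prop
  /-- base change -/
  pull : ∀ {R S : Type u} [CommRing R] [Algebra k R] [CommRing S] [Algebra k S],
    (R →ₐ[k] S) → Obj R → Obj S

/-- A locus in an ambient space: for every field extension `K` of `k`, a set of `K`-points. -/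
abbrev Locus {k : Type u} [Field k] (F : PointFunctor k) :=
  ∀ (K : Type u) [Field K] [Algebra k K], Set (F.Obj K)

/-- A locus is Zariski closed (over `k`) if its pull-back along every morphism `Spec R → F`, i.e.
along every `R`-point `x` of `F`, is the closed subset `V(I)` of `Spec R`, for some ideal `I`. -/
def Locus.IsClosed {k : Type u} [Field k] {F : PointFunctor k} (Z : Locus F) : Prop :=
  ∀ (R : Type u) [CommRing R] [Algebra k R] (x : F.Obj R), F.IsPoint R x →
    ∃ I : Ideal R, ∀ (K : Type u) [Field K] [Algebra k K] (φ : R →ₐ[k] K),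
      F.pull φ x ∈ Z K ↔ ∀ f ∈ I, φ f = 0

/-- The Zariski closure of a locus: the smallest closed locus that contains it. -/
def Locus.closure {k : Type u} [Field k] {F : PointFunctor k} (D : Locus F) : Locus F :=
  fun K _ _ => {x | F.IsPoint K x ∧ ∀ Z : Locus F, Z.IsClosed →
    (∀ (L : Type u) [Field L] [Algebra k L], D L ⊆ Z L) → x ∈ Z K}

/-- The `R`-points of a (locally closed) locus `D`, for a *reduced* `k`-algebra `R`: the `R`-points
of the ambient space all of whose field-valued specializations lie in `D`. These are the morphisms
from `Spec R` to `D` with its reduced structure. -/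
def Locus.points {k : Type u} [Field k] {F : PointFunctor k} (D : Locus F)
    (R : Type u) [CommRing R] [Algebra k R] : Set (F.Obj R) :=
  {x | F.IsPoint R x ∧ ∀ (K : Type u) [Field K] [Algebra k K] (φ : R →ₐ[k] K), F.pull φ x ∈ D K}

/-! ### Circular complexes -/

/-- Pairs `(X, Y)` of a `b × a` matrix and an `a × b` matrix. -/
abbrev MatPair (R : Type u) (a b : ℕ) := Matrix (Fin b) (Fin a) R × Matrix (Fin a) (Fin b) R

/-- The index set of the coordinates of a pair `(X, Y)`. -/
abbrev CoordIdx (a b : ℕ) := (Fin b × Fin a) ⊕ (Fin a × Fin b)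

/-- The coordinates (matrix entries) of a pair `(X, Y)`. -/
def coords {R : Type u} {a b : ℕ} (p : MatPair R a b) : CoordIdx a b → R :=
  Sum.elim (fun ij => p.1 ij.1 ij.2) (fun ij => p.2 ij.1 ij.2)

/-- Base change of a pair of matrices. -/
def mapPair {R S : Type u} {a b : ℕ} (φ : R → S) (p : MatPair R a b) : MatPair S a b :=
  (p.1.map φ, p.2.map φ)

/-- The variety `𝓛` of circular complexes: `XY = 0` and `YX = 0`. -/
def circ (R : Type u) [CommRing R] (a b : ℕ) : Set (MatPair R a b) :=
  {p | p.1 * p.2 = 0 ∧ p.2 * p.1 = 0}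

/-- The action `(g, h) · (X, Y) = (h X g⁻¹, g Y h⁻¹)` of `GL_a × GL_b`. -/
def pairAct {R : Type u} [CommRing R] {a b : ℕ} (g : GL (Fin a) R) (h : GL (Fin b) R)
    (p : MatPair R a b) : MatPair R a b :=
  (h.1 * p.1 * (g⁻¹).1, g.1 * p.2 * (h⁻¹).1)

/-- The stratum `𝓛°_c` over a field: circular complexes with `rank X = c`, `rank Y = a - c`
(for `c ≤ a`). -/
def openStratum (K : Type u) [Field K] (a b c : ℕ) : Set (MatPair K a b) :=
  {p | p ∈ circ K a b ∧ p.1.rank = c ∧ p.2.rank = a - c}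

/-- The ideal of the polynomials over `k` that vanish on the variety `𝓛°_c`, that is, on its points
over all field extensions of `k`. -/
def stratumIdeal (k : Type u) [Field k] (a b c : ℕ) : Ideal (MvPolynomial (CoordIdx a b) k) where
  carrier := {f | ∀ (K : Type u) [Field K] [Algebra k K], ∀ p ∈ openStratum K a b c,
    MvPolynomial.aeval (coords p) f = 0}
  add_mem' hf hg K _ _ p hp := by rw [map_add, hf K p hp, hg K p hp, add_zero]
  zero_mem' K _ _ p _ := map_zero _
  smul_mem' r f hf K _ _ p hp := by rw [smul_eq_mul, map_mul, hf K p hp, mul_zero]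

/-- The `R`-points of the Zariski closure `𝓛_c` of `𝓛°_c`. -/
def component (k : Type u) [Field k] (a b c : ℕ) (R : Type u) [CommRing R] [Algebra k R] :
    Set (MatPair R a b) :=
  {p | ∀ f ∈ stratumIdeal k a b c, MvPolynomial.aeval (coords p) f = 0}

/-- The ideal generated by the entries of `XY` and `YX`, which defines `𝓛`. -/
def circIdeal (k : Type u) [Field k] (a b : ℕ) : Ideal (MvPolynomial (CoordIdx a b) k) :=
  Ideal.span
    ({f | ∃ i j : Fin b, f = ∑ l : Fin a,
        MvPolynomial.X (Sum.inl (i, l)) * MvPolynomial.X (Sum.inr (l, j))} ∪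
     {f | ∃ i j : Fin a, f = ∑ l : Fin b,
        MvPolynomial.X (Sum.inr (i, l)) * MvPolynomial.X (Sum.inl (l, j))})

/-! ### Lattices and the partial affine flag variety -/

/-- `V = R((t))^n`. -/
abbrev LoopSpace (R : Type u) [CommRing R] (n : ℕ) := Fin n → R⸨X⸩

/-- Constants, power series and Laurent series act compatibly. -/
instance instTower (R : Type u) [CommRing R] : IsScalarTower R R⟦X⟧ R⸨X⸩ :=
  ⟨fun r f v => by
    rw [PowerSeries.smul_eq_C_mul, Algebra.smul_def, Algebra.smul_def,
      LaurentSeries.coe_algebraMap, map_mul, HahnSeries.ofPowerSeries_C, mul_assoc,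
      HahnSeries.C_mul_eq_smul]⟩

/-- The vectors `e_j` for `j ∈ ℤ`: `e_1, …, e_n` is the standard basis of `V` and
`e_{i + n m} = t^m e_i`. -/
def e (R : Type u) [CommRing R] (n : ℕ) (j : ℤ) : LoopSpace R n :=
  fun i => if (n : ℤ) ∣ j - ((i : ℤ) + 1) then HahnSeries.single ((j - ((i : ℤ) + 1)) / n) 1 else 0

/-- The standard lattice `E_j`, the `R[[t]]`-span of `e_j, …, e_{j+n-1}`. -/
def E (R : Type u) [CommRing R] (n : ℕ) (j : ℤ) : Submodule R⟦X⟧ (LoopSpace R n) :=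
  Submodule.span R⟦X⟧ (e R n '' Set.Ico j (j + n))

/-- The complement `E'_j`, the `R`-span of the `e_i` with `i < j`. -/
def E' (R : Type u) [CommRing R] (n : ℕ) (j : ℤ) : Submodule R (LoopSpace R n) :=
  Submodule.span R (e R n '' Set.Iio j)

/-- The quotient `Λ / (Λ ∩ M)`, considered as an `R`-module. -/
abbrev LQuot {R : Type u} [CommRing R] {n : ℕ} (Λ M : Submodule R⟦X⟧ (LoopSpace R n)) :=
  Λ ⧸ M.submoduleOf Λ

/-- The submodule `t Λ`. -/
def tMul {R : Type u} [CommRing R] {n : ℕ} (Λ : Submodule R⟦X⟧ (LoopSpace R n)) :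
    Submodule R⟦X⟧ (LoopSpace R n) :=
  Λ.map (LinearMap.lsmul R⟦X⟧ (LoopSpace R n) PowerSeries.X)

/-- A family of lattices over `Spec R`: an `R[[t]]`-submodule `Λ` of `R((t))^n` with
`t^N E_1 ⊆ Λ ⊆ t^{-N} E_1` for some `N`, and `t^{-N} E_1 / Λ` projective over `R`. If `R` is a
field, then these are the lattices in the usual sense. -/
def IsLattice (R : Type u) [CommRing R] (n : ℕ) (Λ : Submodule R⟦X⟧ (LoopSpace R n)) : Prop :=
  ∃ N : ℕ, E R n (1 + n * N) ≤ Λ ∧ Λ ≤ E R n (1 - n * N) ∧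
    Module.Projective R (LQuot (E R n (1 - n * N)) Λ)

/-- Pairs of submodules `(Λ₁, Λ₂)` of `V`. -/
abbrev LPair (R : Type u) [CommRing R] (n : ℕ) :=
  Submodule R⟦X⟧ (LoopSpace R n) × Submodule R⟦X⟧ (LoopSpace R n)

/-- `(Λ₁, Λ₂)` is an `R`-point of `Fl(a, b; V)`: lattices `Λ₁ ⊇ Λ₂ ⊇ t Λ₁` such that the quotients
`Λ₁ / Λ₂` and `Λ₂ / t Λ₁` have constant ranks `a` and `b`. -/
def IsAffFlag (R : Type u) [CommRing R] (a b : ℕ) (Λ : LPair R (a + b)) : Prop :=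
  IsLattice R (a + b) Λ.1 ∧ IsLattice R (a + b) Λ.2 ∧ Λ.2 ≤ Λ.1 ∧ tMul Λ.1 ≤ Λ.2 ∧
  (∀ p : PrimeSpectrum R, Module.rankAtStalk (R := R) (LQuot Λ.1 Λ.2) p = a) ∧
  (∀ p : PrimeSpectrum R, Module.rankAtStalk (R := R) (LQuot Λ.2 (tMul Λ.1)) p = b)

/-- Base change of a lattice: the `S[[t]]`-span of its image under `R((t))^n → S((t))^n`. -/
def pullLattice {R S : Type u} [CommRing R] [CommRing S] {n : ℕ} (φ : R →+* S)
    (Λ : Submodule R⟦X⟧ (LoopSpace R n)) : Submodule S⟦X⟧ (LoopSpace S n) :=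
  Submodule.span S⟦X⟧ ((fun (v : LoopSpace R n) (i : Fin n) => (v i).map φ) '' (Λ : Set _))

/-- The partial affine flag variety `Fl(a, b; V)` over `k`. -/
def affFlag (k : Type u) [Field k] (a b : ℕ) : PointFunctor k where
  Obj R _ _ := LPair R (a + b)
  IsPoint R _ _ Λ := IsAffFlag R a b Λ
  pull φ Λ := (pullLattice φ.toRingHom Λ.1, pullLattice φ.toRingHom Λ.2)

/-- The image `g Λ` of a lattice under a matrix `g` over `R((t))`. -/
def translate {R : Type u} [CommRing R] {n : ℕ} (g : Matrix (Fin n) (Fin n) R⸨X⸩)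
    (Λ : Submodule R⟦X⟧ (LoopSpace R n)) : Submodule R⟦X⟧ (LoopSpace R n) :=
  Λ.map ((Matrix.mulVecLin g).restrictScalars R⟦X⟧)

/-- The translate of a flag by a matrix over `R((t))`. -/
def translateFlag {R : Type u} [CommRing R] {n : ℕ} (g : Matrix (Fin n) (Fin n) R⸨X⸩)
    (Λ : LPair R n) : LPair R n :=
  (translate g Λ.1, translate g Λ.2)

/-- The standard flag `(E_1 ⊇ E_{a+1})` of `Fl(a, b; V)`. -/
def stdFlag (R : Type u) [CommRing R] (a b : ℕ) : LPair R (a + b) :=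
  (E R (a + b) 1, E R (a + b) (a + 1))

/-! ### Affine Schubert varieties and their opposite cells -/

/-- The (extended) affine Weyl group: the bijections of `ℤ` that commute with `τ : i ↦ i + n`. -/
def affineWeyl (n : ℕ) : Subgroup (Equiv.Perm ℤ) :=
  Subgroup.centralizer {Equiv.addRight (n : ℤ)}

/-- The index `k` of the component of the affine flag variety in which `π E_•` lies:
`∑_{i=1}^n (π(i) - i) = n k`, where `k` is the order of the determinant of the affine permutation
matrix of `π`. -/
def degree {n : ℕ} (π : affineWeyl n) : ℤ := (∑ i ∈ Finset.Icc (1 : ℤ) n, (π.1 i - i)) / n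

/-- `π E_j`, the `R[[t]]`-span of `e_{π(j)}, …, e_{π(j+n-1)}`. -/
def permE (R : Type u) [CommRing R] {n : ℕ} (π : affineWeyl n) (j : ℤ) :
    Submodule R⟦X⟧ (LoopSpace R n) :=
  Submodule.span R⟦X⟧ ((fun i => e R n (π.1 i)) '' Set.Ico j (j + n))

/-- The Iwahori subgroup `B`: the elements of `GL_n(K[[t]])` that are lower triangular modulo
`t`. -/
def iwahori (K : Type u) [Field K] (n : ℕ) : Set (GL (Fin n) K⟦X⟧) :=
  {g | ∀ i j : Fin n, i < j → PowerSeries.constantCoeff (g.1 i j) = 0}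

/-- The Schubert cell `X°_π = B · π E_(•)` in `Fl(a, b; V)`. -/
def affCell (k : Type u) [Field k] (a b : ℕ) (π : affineWeyl (a + b)) : Locus (affFlag k a b) :=
  fun K _ _ => {Λ : LPair K (a + b) | ∃ g ∈ iwahori K (a + b),
    Λ = translateFlag (g.1.map (algebraMap K⟦X⟧ K⸨X⸩)) (permE K π 1, permE K π (a + 1))}

/-- The affine Schubert variety `X_π`, the closure of the Schubert cell. -/
def affSchubert (k : Type u) [Field k] (a b : ℕ) (π : affineWeyl (a + b)) :
    Locus (affFlag k a b) :=
  (affCell k a b π).closure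

/-- The opposite cell `X'_π` of `X_π`: the flags in `X_π` with `Λ₁ ∩ E'_{1+k} = 0` and
`Λ₂ ∩ E'_{a+1+k} = 0`, where `k` is the degree of `π`. -/
def affOpp (k : Type u) [Field k] (a b : ℕ) (π : affineWeyl (a + b)) : Locus (affFlag k a b) :=
  fun K _ _ => {Λ : LPair K (a + b) | Λ ∈ affSchubert k a b π K ∧
    Λ.1.restrictScalars K ⊓ E' K (a + b) (1 + degree π) = ⊥ ∧
    Λ.2.restrictScalars K ⊓ E' K (a + b) (a + 1 + degree π) = ⊥}

/-- The block formula for `π_c` in one-line notation on `1, …, a + b`, on five consecutive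
intervals of sizes `c`, `a - c`, `a - c`, `b - a`, `c`. -/
def IsBlockPerm (a b c : ℕ) (π : affineWeyl (a + b)) : Prop :=
  ∀ i : ℤ,
    (1 ≤ i → i ≤ c → π.1 i = a + i) ∧
    (c + 1 ≤ i → i ≤ a → π.1 i = a + 2 * b + c + (i - c)) ∧
    (a + 1 ≤ i → i ≤ 2 * a - c → π.1 i = a + b + (i - a)) ∧
    (2 * a - c + 1 ≤ i → i ≤ a + b - c → π.1 i = 2 * a + b + c + (i - (2 * a - c))) ∧
    (a + b - c + 1 ≤ i → i ≤ a + b → π.1 i = 3 * a + 2 * b - c + (i - (a + b - c)))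

/-! ### The map `Ψ` -/

/-- A block matrix for the decomposition `n = a + b`. -/
def blockMat {S : Type u} {a b : ℕ} (A : Matrix (Fin a) (Fin a) S) (B : Matrix (Fin a) (Fin b) S)
    (C : Matrix (Fin b) (Fin a) S) (D : Matrix (Fin b) (Fin b) S) :
    Matrix (Fin (a + b)) (Fin (a + b)) S :=
  Matrix.reindex finSumFinEquiv finSumFinEquiv (Matrix.fromBlocks A B C D)

/-- The element `t` of `R((t))`. -/
def t (R : Type u) [CommRing R] : R⸨X⸩ := HahnSeries.single 1 1

/-- The matrix `[[t I_a, t Y], [X, t I_b]]`. -/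
def lusztigMatrix {R : Type u} [CommRing R] {a b : ℕ} (p : MatPair R a b) :
    Matrix (Fin (a + b)) (Fin (a + b)) R⸨X⸩ :=
  blockMat (t R • 1) (t R • p.2.map HahnSeries.C) (p.1.map HahnSeries.C) (t R • 1)

/-- `Ψ(X, Y)`: the translate of the standard flag by the matrix `[[t I_a, t Y], [X, t I_b]]`. -/
def Psi {R : Type u} [CommRing R] {a b : ℕ} (p : MatPair R a b) : LPair R (a + b) :=
  translateFlag (lusztigMatrix p) (stdFlag R a b)

/-- The embedding of `GL_a(R) × GL_b(R)` in `GL_n(R((t)))` as constant block-diagonal matrices. -/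
def diagMat {R : Type u} [CommRing R] {a b : ℕ} (g : GL (Fin a) R) (h : GL (Fin b) R) :
    Matrix (Fin (a + b)) (Fin (a + b)) R⸨X⸩ :=
  blockMat (g.1.map HahnSeries.C) 0 0 (h.1.map HahnSeries.C)

/-- The set of lattice flags `(Λ₁ ⊇ Λ₂)` in `Fl(a, b; V)` such that
`E_(2) ⊇ Λ₁ ⊇ E_(4)` with quotients of dimensions `b`, `a`,
`E_(3) ⊇ Λ₂ ⊇ E_(5)` with quotients of dimensions `a`, `b`,
`Λ₁ ∩ E'_(3) = 0 = Λ₂ ∩ E'_(4)`,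
`dim Λ₁ / (Λ₁ ∩ E_(3)) ≤ c` and `dim Λ₂ / (Λ₂ ∩ E_(4)) ≤ a - c`, where
`E_(2) = E_{a+1}`, `E_(3) = E_{a+b+1}`, `E_(4) = E_{2a+b+1}`, `E_(5) = E_{2a+2b+1}`. -/
def latticeLocus (K : Type u) [Field K] (a b c : ℕ) : Set (LPair K (a + b)) :=
  {Λ | IsAffFlag K a b Λ ∧
    Λ.1 ≤ E K (a + b) (a + 1) ∧ E K (a + b) (2 * a + b + 1) ≤ Λ.1 ∧
    Λ.2 ≤ E K (a + b) (a + b + 1) ∧ E K (a + b) (2 * a + 2 * b + 1) ≤ Λ.2 ∧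
    Module.finrank K (LQuot (E K (a + b) (a + 1)) Λ.1) = b ∧
    Module.finrank K (LQuot Λ.1 (E K (a + b) (2 * a + b + 1))) = a ∧
    Module.finrank K (LQuot (E K (a + b) (a + b + 1)) Λ.2) = a ∧
    Module.finrank K (LQuot Λ.2 (E K (a + b) (2 * a + 2 * b + 1))) = b ∧
    Λ.1.restrictScalars K ⊓ E' K (a + b) (a + b + 1) = ⊥ ∧
    Λ.2.restrictScalars K ⊓ E' K (a + b) (2 * a + b + 1) = ⊥ ∧
    Module.finrank K (LQuot Λ.1 (E K (a + b) (a + b + 1))) ≤ c ∧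
    Module.finrank K (LQuot Λ.2 (E K (a + b) (2 * a + b + 1))) ≤ a - c}

/-! ### The ordinary partial flag variety `Fl(b, a, b; k^{a+2b})` -/

/-- The space `R^{a+2b} = E_(2) / E_(5)`. The coordinate of index `j : Fin (a + 2 * b)` belongs to
the basis vector `ē_{a+1+j}`. -/
abbrev FinSpace (R : Type u) (a b : ℕ) := Fin (a + 2 * b) → R

/-- Pairs of submodules `(U₁, U₂)` of `R^{a+2b}`. -/
abbrev UPair (R : Type u) [CommRing R] (a b : ℕ) :=
  Submodule R (FinSpace R a b) × Submodule R (FinSpace R a b)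

/-- `(U₁, U₂)` is an `R`-point of `Fl(b, a, b; k^{a+2b})`: `R^{a+2b} ⊇ U₁ ⊇ U₂`, where
`R^{a+2b} / U₁` and `R^{a+2b} / U₂` are locally free of ranks `b` and `b + a`. -/
def IsOrdFlag (R : Type u) [CommRing R] (a b : ℕ) (U : UPair R a b) : Prop :=
  U.2 ≤ U.1 ∧
  (∃ W : Module.Grassmannian R (FinSpace R a b) b, W.toSubmodule = U.1) ∧
  (∃ W : Module.Grassmannian R (FinSpace R a b) (b + a), W.toSubmodule = U.2)

/-- Base change of a submodule of `R^{a+2b}`. -/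
def pullSub {R S : Type u} [CommRing R] [CommRing S] {a b : ℕ} (φ : R →+* S)
    (U : Submodule R (FinSpace R a b)) : Submodule S (FinSpace S a b) :=
  Submodule.span S ((fun (v : FinSpace R a b) i => φ (v i)) '' (U : Set _))

/-- The partial flag variety `Fl(b, a, b; k^{a+2b})` over `k`. -/
def ordFlag (k : Type u) [Field k] (a b : ℕ) : PointFunctor k where
  Obj R _ _ := UPair R a b
  IsPoint R _ _ U := IsOrdFlag R a b U
  pull φ U := (pullSub φ.toRingHom U.1, pullSub φ.toRingHom U.2)

/-- `Ē_j = E_j / E_(5)` for `a + 1 ≤ j`: the span of the `ē_i` with `i ≥ j`. -/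
def Ebar (R : Type u) [CommRing R] (a b j : ℕ) : Submodule R (FinSpace R a b) :=
  Submodule.span R {v | ∃ i : Fin (a + 2 * b), j ≤ a + 1 + i ∧ v = Pi.single i 1}

/-- The complement `Ē'_j`: the span of the `ē_i` with `i < j`. -/
def Ebar' (R : Type u) [CommRing R] (a b j : ℕ) : Submodule R (FinSpace R a b) :=
  Submodule.span R {v | ∃ i : Fin (a + 2 * b), a + 1 + i < j ∧ v = Pi.single i 1}

/-- The translate of `Ē_j` by a permutation `w` of the basis vectors. -/
def permEbar (R : Type u) [CommRing R] (a b : ℕ) (w : Equiv.Perm (Fin (a + 2 * b))) (j : ℕ) :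
    Submodule R (FinSpace R a b) :=
  Submodule.span R {v | ∃ i : Fin (a + 2 * b), j ≤ a + 1 + i ∧ v = Pi.single (w i) 1}

/-- The Borel subgroup of the lower triangular matrices, which stabilizes all the `Ē_j`. -/
def borel (K : Type u) [Field K] (m : ℕ) : Set (GL (Fin m) K) :=
  {g | ∀ i j : Fin m, i < j → g.1 i j = 0}

/-- The Schubert cell of `w` in `Fl(b, a, b; k^{a+2b})`: the Borel orbit of the translate by `w` of
the standard flag `(Ē_(3) ⊇ Ē_(4))`. -/
def ordCell (k : Type u) [Field k] (a b : ℕ) (w : Equiv.Perm (Fin (a + 2 * b))) :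
    Locus (ordFlag k a b) :=
  fun K _ _ => {U : UPair K a b | ∃ g ∈ borel K (a + 2 * b),
    U = ((permEbar K a b w (a + b + 1)).map (Matrix.mulVecLin g.1),
      (permEbar K a b w (2 * a + b + 1)).map (Matrix.mulVecLin g.1))}

/-- The Schubert variety of `w` in `Fl(b, a, b; k^{a+2b})`. -/
def ordSchubert (k : Type u) [Field k] (a b : ℕ) (w : Equiv.Perm (Fin (a + 2 * b))) :
    Locus (ordFlag k a b) :=
  (ordCell k a b w).closure

/-- The opposite cell of the Schubert variety of `w`: the flags in it with `U₁ ∩ Ē'_(3) = 0` and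
`U₂ ∩ Ē'_(4) = 0`. -/
def ordOpp (k : Type u) [Field k] (a b : ℕ) (w : Equiv.Perm (Fin (a + 2 * b))) :
    Locus (ordFlag k a b) :=
  fun K _ _ => {U : UPair K a b | U ∈ ordSchubert k a b w K ∧
    U.1 ⊓ Ebar' K a b (a + b + 1) = ⊥ ∧ U.2 ⊓ Ebar' K a b (2 * a + b + 1) = ⊥}

/-- The nilpotent operator `t̄ : ē_i ↦ ē_{i+n}` (and `0` if `i + n > 2a + 2b`). -/
def tBar (R : Type u) [CommRing R] (a b : ℕ) : FinSpace R a b →ₗ[R] FinSpace R a b :=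
  Matrix.mulVecLin (Matrix.of fun i j : Fin (a + 2 * b) =>
    if (i : ℕ) = (j : ℕ) + (a + b) then (1 : R) else 0)

/-- The flags `U_•` in `Fl(b, a, b; k^{a+2b})` that satisfy the conditions
`U₁ ⊇ Ē_(4)`, `U₂ ⊆ Ē_(3)`, `dim (U₁ ∩ Ē_(3)) ≥ a + b - c`, `dim (U₂ ∩ Ē_(4)) ≥ b - a + c`,
`U₁ ∩ Ē'_(3) = 0 = U₂ ∩ Ē'_(4)`. -/
def ordConditions (K : Type u) [Field K] (a b c : ℕ) : Set (UPair K a b) :=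
  {U | IsOrdFlag K a b U ∧
    Ebar K a b (2 * a + b + 1) ≤ U.1 ∧ U.2 ≤ Ebar K a b (a + b + 1) ∧
    a + b ≤ Module.finrank K ↥(U.1 ⊓ Ebar K a b (a + b + 1)) + c ∧
    b + c ≤ Module.finrank K ↥(U.2 ⊓ Ebar K a b (2 * a + b + 1)) + a ∧
    U.1 ⊓ Ebar' K a b (a + b + 1) = ⊥ ∧ U.2 ⊓ Ebar' K a b (2 * a + b + 1) = ⊥}

/-- The intersection of the opposite cell of the Schubert variety of `w` with the incidence locus
`U₂ ⊇ t̄(U₁)`. -/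
def ordIncidence (k : Type u) [Field k] (a b : ℕ) (w : Equiv.Perm (Fin (a + 2 * b))) :
    Locus (ordFlag k a b) :=
  fun K _ _ => {U : UPair K a b | U ∈ ordOpp k a b w K ∧ U.1.map (tBar K a b) ≤ U.2}

/-- The coordinate of `v ∈ V` at the basis vector `e_m`. -/
def coordAt {R : Type u} [CommRing R] {n : ℕ} (m : ℤ) (v : LoopSpace R n) : R :=
  ∑ i : Fin n, if (n : ℤ) ∣ m - ((i : ℤ) + 1) then (v i).coeff ((m - ((i : ℤ) + 1)) / n) else 0

/-- The linear map `V → R^{a+2b}` that takes the coordinates at `e_{a+1}, …, e_{2a+2b}`; on `E_(2)`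
it is the projection onto `E_(2) / E_(5)`. -/
def trunc (R : Type u) [CommRing R] (a b : ℕ) : LoopSpace R (a + b) →ₗ[R] FinSpace R a b where
  toFun v j := coordAt ((a : ℤ) + 1 + (j : ℕ)) v
  map_add' v w := by
    funext j
    simp only [coordAt, Pi.add_apply, HahnSeries.coeff_add, ← Finset.sum_add_distrib]
    exact Finset.sum_congr rfl fun i _ => by split_ifs <;> simp
  map_smul' r v := by
    funext j
    simp only [coordAt, Pi.smul_apply, HahnSeries.coeff_smul, RingHom.id_apply, smul_eq_mul,
      Finset.mul_sum]
    exact Finset.sum_congr rfl fun i _ => by split_ifs <;> simp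

/-- The map `(Λ₁, Λ₂) ↦ (Λ₁ / E_(5), Λ₂ / E_(5))`. -/
def truncFlag {R : Type u} [CommRing R] {a b : ℕ} (Λ : LPair R (a + b)) : UPair R a b :=
  ((Λ.1.restrictScalars R).map (trunc R a b), (Λ.2.restrictScalars R).map (trunc R a b))

end CircComplex

end

open CircComplex

/-! For a circular complex the matrix `M` is invertible over `R((t))`, and applying it to `E_1 ⊃
E_{a+1}` produces two graphs. The lattice `Λ₁` consists of the vectors whose coordinates before
`e_{a+1}` vanish and whose next `b` coordinates are `X` times the following `a` ones; `Λ₂` starts at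
`e_{a+b+1}`, and its first `a` coordinates are `Y` times the following `b` ones (`Psi_fst`,
`Psi_snd`). Conversely, a lattice of the right codimension that contains the end of the filtration
and is transversal to the complement `E'` is a graph (`CoordSystem.exists_eq_graph_of_cod`). For two
such graphs, `Λ₂ ⊆ Λ₁` says `XY = 0` and `tΛ₁ ⊆ Λ₂` says `YX = 0` (`eq_Psi_of_graph`). The position
of `Λ₁` relative to `E_(3)` and of `Λ₂` relative to `E_(4)` is measured by `rank X` and `rank Y`, so
everything reduces to rank loci of complexes.

Components. A complex with `rank X ≤ c` and `rank Y ≤ a - c` can be brought to diagonal matrices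
with disjoint supports. Written with adjugates, this normal form is a family over a polynomial ring
`D` with free parameters, and every such complex is a specialization of it. The generic member has
nonzero corner minors, hence lies in the open stratum. So the closure `𝓛_c` is exactly the rank
locus and its ideal is prime (`mem_component_iff`, `stratumIdeal_isPrime`). Since `XY = 0` forces
`rank X + rank Y ≤ a`, these loci cover `𝓛` (`minimalPrimes_circIdeal`).

Schubert varieties. Counting the indices that `π_c` misses shows that the cell satisfies six
incidence inequalities; they are closed conditions, and on the opposite cell they become the rank
bounds (`affOpp_subset`). Conversely, if the corner minors of a complex are nonzero, echelon vectors
of the two graphs are the columns of an Iwahori matrix that carries the coordinate flag of `π_c` to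
`Ψ(p)` (`Psi_mem_affCell`). A closed locus that contains the cell pulls back along the family `Ψ(P)`
over `D` to some `V(I)` containing the generic point. Hence `I = 0`, and all specializations lie in
the locus (`image_component_eq_affOpp`).

From fields to varieties. Isomorphisms are bijections on points over reduced rings. A submodule of
`R^l` with `R` reduced is a graph as soon as all its base changes to fields are
(`exists_eq_graph_of_forall_field`), so the equalities of sets over fields become bijections on
points (`bijOn_Psi_points`).

Ordinary flags. Modulo `E_(5)` the same two graphs form a flag in `R^{a+2b}`. There `U₂ ⊆ U₁` gives
only `XY = 0`, and `t̄(U₁) ⊆ U₂` is the missing equation `YX = 0`. The ordinary opposite cell is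
therefore the locus of `XY = 0` with the same rank bounds. It is treated by the same argument, with
a second generic family (`ordOpp_eq_ordConditions`, `bijOn_graphFlag`). -/

namespace CircComplex

/-! ### Bases adapted to kernels and subspaces -/

section LinearAlgebra

open Module

variable {K V W : Type*} [Field K] [AddCommGroup V] [Module K V] [AddCommGroup W] [Module K W]
  [FiniteDimensional K V] {ι : Type*} [Fintype ι]

/-- A basis of the kernel of `f` together with vectors whose images are independent form a basis,
if their number is right. -/
theorem exists_basis_of_ker (f : V →ₗ[K] W) (S : ι → Prop) [DecidablePred S]
    (p : {i // S i} → V) (hp : LinearIndependent K (f ∘ p))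
    (q : Basis {i // ¬ S i} K (LinearMap.ker f)) (hcard : Fintype.card ι = finrank K V) :
    ∃ β : Basis ι K V, (∀ i (h : S i), β i = p ⟨i, h⟩) ∧ ∀ i (h : ¬ S i), β i = q ⟨i, h⟩ := by
  classical
  have hli : LinearIndependent K (Sum.elim p (fun i => (q i : V))) := by
    refine LinearIndependent.sum_type (hp.of_comp f) ?_ ?_
    · exact q.linearIndependent.map' (LinearMap.ker f).subtype (Submodule.ker_subtype _)
    · refine (Submodule.range_ker_disjoint hp).mono_right ?_
      rw [Submodule.span_le]
      rintro _ ⟨i, rfl⟩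
      exact (q i).2
  have hli' := hli.comp _ (Equiv.sumCompl S).symm.injective
  refine ⟨basisOfLinearIndependentOfCardEqFinrank' _ hli' hcard, fun i h => ?_, fun i h => ?_⟩
  · simp [h]
  · simp [h]

theorem exists_lift_range_basis (f : V →ₗ[K] W) {κ : Type*} [Fintype κ]
    (hκ : Fintype.card κ = finrank K (LinearMap.range f)) :
    ∃ p : κ → V, LinearIndependent K (f ∘ p) := by
  have e : Basis κ K (LinearMap.range f) :=
    (finBasis K (LinearMap.range f)).reindex (Fintype.equivOfCardEq (by simp [hκ]))
  choose p hp using fun i => (e i).2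
  refine ⟨p, ?_⟩
  have : f ∘ p = fun i => (e i : W) := funext hp
  rw [this]
  exact e.linearIndependent.map' _ (Submodule.ker_subtype _)

theorem exists_basis_prescribed (T : ι → Prop) [DecidablePred T] (v : {i // T i} → V)
    (hv : LinearIndependent K v) (hcard : Fintype.card ι = finrank K V) :
    ∃ β : Basis ι K V, ∀ i (h : T i), β i = v ⟨i, h⟩ := by
  classical
  let U := Submodule.span K (Set.range v)
  have hU : finrank K U = Fintype.card {i // T i} := finrank_span_eq_card hv
  have hs := Submodule.finrank_quotient_add_finrank U
  have hc := Fintype.card_subtype_compl T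
  have hle : Fintype.card {i // T i} ≤ Fintype.card ι := Fintype.card_subtype_le _
  have hr : LinearMap.range U.mkQ = ⊤ := Submodule.range_mkQ _
  obtain ⟨p, hp⟩ := exists_lift_range_basis U.mkQ (κ := {i // ¬ T i})
    (by rw [hr, finrank_top, hc]; omega)
  have hk : LinearMap.ker U.mkQ = U := Submodule.ker_mkQ U
  let q : Basis {i // ¬ ¬ T i} K (LinearMap.ker U.mkQ) :=
    ((Basis.span hv).map (LinearEquiv.ofEq _ _ hk.symm)).reindex
      (Equiv.subtypeEquivRight fun i => not_not.symm)
  obtain ⟨β, -, h2⟩ := exists_basis_of_ker U.mkQ (fun i => ¬ T i) p hp q hcard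
  refine ⟨β, fun i h => ?_⟩
  rw [h2 i (not_not.2 h)]
  simp [q, Basis.span_apply]
  rfl

/-- Match a basis of `V` that starts with a basis of `U` with one that starts inside `U'`. This
serves to rotate the image of `X` into the kernel of `Y`. -/
theorem exists_linearEquiv_map_le {U U' : Submodule K V} (h : finrank K U ≤ finrank K U') :
    ∃ φ : V ≃ₗ[K] V, U.map φ.toLinearMap ≤ U' := by
  classical
  let n := finrank K V
  have hn : finrank K U' ≤ n := Submodule.finrank_le U'
  have key : ∀ W : Submodule K V, ∃ β : Basis (Fin n) K V,
      ∀ i : Fin n, (i : ℕ) < finrank K W → β i ∈ W := by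
    intro W
    let e : {i : Fin n // (i : ℕ) < finrank K W} → V :=
      fun i => (finBasis K W ⟨i.1, i.2⟩ : V)
    have he : LinearIndependent K e := by
      have := ((finBasis K W).linearIndependent.map' W.subtype (Submodule.ker_subtype _)).comp
        (fun i : {i : Fin n // (i : ℕ) < finrank K W} => (⟨i.1, i.2⟩ : Fin (finrank K W)))
        (fun i j hij => Subtype.ext (Fin.ext (by simpa using hij)))
      exact this
    obtain ⟨β, hβ⟩ := exists_basis_prescribed _ e he (by simp [n])
    exact ⟨β, fun i hi => by rw [hβ i hi]; exact (finBasis K W ⟨i.1, hi⟩).2⟩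
  obtain ⟨β', hβ'⟩ := key U'
  let e : {i : Fin n // (i : ℕ) < finrank K U} → V := fun i => (finBasis K U ⟨i.1, i.2⟩ : V)
  have he : LinearIndependent K e :=
    ((finBasis K U).linearIndependent.map' U.subtype (Submodule.ker_subtype _)).comp
        (fun i : {i : Fin n // (i : ℕ) < finrank K U} => (⟨i.1, i.2⟩ : Fin (finrank K U)))
        (fun i j hij => Subtype.ext (Fin.ext (by simpa using hij)))
  obtain ⟨β, hβ⟩ := exists_basis_prescribed _ e he (by simp [n])
  refine ⟨β.equiv β' (Equiv.refl _), ?_⟩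
  have hspan : U = Submodule.span K (Set.range fun i => (finBasis K U i : V)) := by
    have := congrArg (Submodule.map U.subtype) (finBasis K U).span_eq
    rw [Submodule.map_span, Submodule.map_top, Submodule.range_subtype, ← Set.range_comp] at this
    exact this.symm
  rw [hspan, Submodule.map_span, Submodule.span_le]
  rintro _ ⟨_, ⟨i, rfl⟩, rfl⟩
  have hi : (i : ℕ) < n := lt_of_lt_of_le i.2 (Submodule.finrank_le U)
  have h1 : β ⟨i, hi⟩ = (finBasis K U i : V) := hβ ⟨i, hi⟩ i.2
  simp only [← h1, LinearEquiv.coe_coe, Basis.equiv_apply, Equiv.refl_apply]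
  exact hβ' _ (lt_of_lt_of_le i.2 h)

end LinearAlgebra

/-! ### Rank and minors -/

section Rank

open Matrix

variable {K : Type*} [Field K]

theorem exists_linearIndependent_rows {m n : Type*} [Fintype m] [Fintype n] (B : Matrix m n K) :
    ∃ r : Fin B.rank → m, LinearIndependent K (B.submatrix r id).row := by
  classical
  obtain ⟨t, ht, h1, h2⟩ := exists_linearIndependent K (Set.range B.row)
  have hfin : t.Finite := (Set.finite_range _).subset ht
  have := hfin.fintype
  have hc : Fintype.card t = B.rank := by
    rw [Matrix.rank_eq_finrank_span_row, ← h1, finrank_span_set_eq_card h2, Set.toFinset_card]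
  let e : Fin B.rank ≃ t := (Fintype.equivFinOfCardEq hc).symm
  choose r hr using fun i : t => ht i.2
  refine ⟨r ∘ e, ?_⟩
  have h3 := h2.comp e e.injective
  have h4 : (B.submatrix (r ∘ e) id).row = Subtype.val ∘ e := funext fun i => hr (e i)
  rw [h4]
  exact h3

/-- Passing to a maximal set of independent rows keeps the rank; independent columns of the result
then form an invertible square block. -/
theorem exists_submatrix_det_ne_zero {m n : Type*} [Fintype m] [Fintype n]
    (A : Matrix m n K) : ∃ (r : Fin A.rank → m) (s : Fin A.rank → n),
      (A.submatrix r s).det ≠ 0 := by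
  classical
  obtain ⟨r, hr⟩ := exists_linearIndependent_rows A
  have h1 : (A.submatrix r (id : n → n)).rank = A.rank := by
    have := LinearIndependent.rank_matrix hr
    simpa using this
  obtain ⟨s, hs⟩ := exists_linearIndependent_rows (A.submatrix r (id : n → n))ᵀ
  have h2 : (A.submatrix r (id : n → n))ᵀ.rank = A.rank := by rw [Matrix.rank_transpose, h1]
  refine ⟨r, s ∘ Fin.cast h2.symm, ?_⟩
  have h3 := hs.comp _ (Fin.cast_injective h2.symm)
  have h4 : LinearIndependent K (A.submatrix r (s ∘ Fin.cast h2.symm))ᵀ.row := h3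
  rw [Matrix.linearIndependent_rows_iff_isUnit] at h4
  rw [← Matrix.det_transpose]
  exact ((Matrix.isUnit_iff_isUnit_det _).1 h4).ne_zero

theorem le_rank_of_submatrix_det_ne_zero {m n : Type*} [Fintype m] [Fintype n]
    (A : Matrix m n K) {d : ℕ} (r : Fin d → m) (s : Fin d → n)
    (h : (A.submatrix r s).det ≠ 0) : d ≤ A.rank := by
  classical
  have h1 := Matrix.rank_of_det_ne_zero h
  rw [Fintype.card_fin] at h1
  rw [← h1]
  exact Matrix.rank_submatrix_le _ _ _

/-- The rank is at most `d` if and only if all `(d + 1)`-minors vanish. -/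
theorem rank_le_iff_minors {m n : Type*} [Fintype m] [Fintype n]
    (A : Matrix m n K) (d : ℕ) :
    A.rank ≤ d ↔ ∀ (r : Fin (d + 1) → m) (s : Fin (d + 1) → n), (A.submatrix r s).det = 0 := by
  constructor
  · intro h r s
    by_contra hne
    exact absurd (le_rank_of_submatrix_det_ne_zero A r s hne) (by omega)
  · intro h
    by_contra! hlt
    obtain ⟨r, s, hrs⟩ := exists_submatrix_det_ne_zero A
    have hli : LinearIndependent K (A.submatrix r s).row :=
      Matrix.linearIndependent_rows_iff_isUnit.2
        ((Matrix.isUnit_iff_isUnit_det _).2 (isUnit_iff_ne_zero.2 hrs))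
    -- The nonzero minor has size `A.rank`, which may exceed `d + 1`. Its first `d + 1` rows are
    -- still independent, so they contain a nonzero minor of the wanted size.
    have hrk : (A.submatrix (r ∘ Fin.castLE hlt) s).rank = d + 1 := by
      have := LinearIndependent.rank_matrix (M := A.submatrix (r ∘ Fin.castLE hlt) s)
        (hli.comp _ (Fin.castLE_injective hlt))
      simpa using this
    obtain ⟨r', s', h'⟩ := exists_submatrix_det_ne_zero (A.submatrix (r ∘ Fin.castLE hlt) s)
    refine absurd (h (r ∘ Fin.castLE hlt ∘ r' ∘ Fin.cast hrk.symm) (s ∘ s' ∘ Fin.cast hrk.symm)) ?_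
    rw [← Matrix.det_submatrix_equiv_self (finCongr hrk)] 
    exact h'

end Rank

/-! ### Normal form of complexes -/

section NormalForm

open Matrix

/-- The `b × a` matrix with diagonal entries `u i`. -/
def pattern {S : Type*} [Zero S] {a : ℕ} (b : ℕ) (u : Fin a → S) : Matrix (Fin b) (Fin a) S :=
  Matrix.of fun j i => if (j : ℕ) = (i : ℕ) then u i else 0

/-- The complex with diagonal matrices `u` (supported on the first `c` indices) and `v` (supported
on the remaining ones), transformed by `g`, `h`, `h'`. -/
def normalPair {S : Type u} [CommRing S] {a b : ℕ} (c : ℕ) (g : Matrix (Fin a) (Fin a) S)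
    (h h' : Matrix (Fin b) (Fin b) S) (u v : Fin a → S) : MatPair S a b :=
  (h * pattern b (fun i => if (i : ℕ) < c then u i else 0) * g.adjugate,
    g * (pattern b (fun i => if (i : ℕ) < c then 0 else v i))ᵀ * h'.adjugate)

theorem pattern_map {S T : Type*} [CommRing S] [CommRing T] (φ : S →+* T) {a b : ℕ}
    (u : Fin a → S) : (pattern b u).map φ = pattern b (fun i => φ (u i)) := by
  ext i j
  simp only [pattern, Matrix.map_apply, Matrix.of_apply]
  split_ifs <;> simp

/-- Adjugates replace inverses in `normalPair`, so the formula is polynomial in its parameters and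
survives every specialization, including those where `g` or `h` becomes singular. -/
theorem mapPair_normalPair {S T : Type u} [CommRing S] [CommRing T] (φ : S →+* T) {a b : ℕ} (c : ℕ)
    (g : Matrix (Fin a) (Fin a) S) (h h' : Matrix (Fin b) (Fin b) S) (u v : Fin a → S) :
    mapPair φ (normalPair c g h h' u v) =
      normalPair c (g.map φ) (h.map φ) (h'.map φ) (fun i => φ (u i)) (fun i => φ (v i)) := by
  have e1 : (pattern b (fun i => if (i : ℕ) < c then u i else 0)).map φ =
      pattern b (fun i => if (i : ℕ) < c then φ (u i) else 0) := by
    rw [pattern_map]; congr 1; funext i; split_ifs <;> simp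
  have e2 : (pattern b (fun i => if (i : ℕ) < c then 0 else v i)).map φ =
      pattern b (fun i => if (i : ℕ) < c then 0 else φ (v i)) := by
    rw [pattern_map]; congr 1; funext i; split_ifs <;> simp
  have e3 : g.adjugate.map φ = (g.map φ).adjugate := RingHom.map_adjugate φ g
  have e4 : h'.adjugate.map φ = (h'.map φ).adjugate := RingHom.map_adjugate φ h'
  simp only [mapPair, normalPair, Matrix.map_mul, Matrix.transpose_map, e1, e2, e3, e4]

theorem pattern_mul_transpose {S : Type*} [CommRing S] {a b : ℕ} {u v : Fin a → S}
    (huv : ∀ i, u i * v i = 0) : pattern b u * (pattern b v)ᵀ = 0 := by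
  ext i j
  simp only [Matrix.mul_apply, pattern, Matrix.of_apply, Matrix.transpose_apply, Matrix.zero_apply]
  refine Finset.sum_eq_zero fun l _ => ?_
  split_ifs <;> simp [huv]

theorem pattern_transpose_mul {S : Type*} [CommRing S] {a b : ℕ} {u v : Fin a → S}
    (huv : ∀ i, u i * v i = 0) : (pattern b v)ᵀ * pattern b u = 0 := by
  ext i j
  simp only [Matrix.mul_apply, pattern, Matrix.of_apply, Matrix.transpose_apply, Matrix.zero_apply]
  refine Finset.sum_eq_zero fun l _ => ?_
  split_ifs with h1 h2
  · obtain rfl : i = j := Fin.ext (h1.symm.trans h2)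
    rw [mul_comm, huv]
  all_goals simp

/-- The product `g.adjugate * g` in the middle is a scalar, and the two patterns are supported on
disjoint sets of indices. The outer matrices `h` and `h'` play no role, which leaves room for
complexes with `XY = 0` only. -/
theorem normalPair_fst_mul_snd {S : Type u} [CommRing S] {a b : ℕ} (c : ℕ)
    (g : Matrix (Fin a) (Fin a) S) (h h' : Matrix (Fin b) (Fin b) S) (u v : Fin a → S) :
    (normalPair c g h h' u v).1 * (normalPair c g h h' u v).2 = 0 := by
  simp only [normalPair]
  set P := pattern b (fun i => if (i : ℕ) < c then u i else 0)
  set Q := pattern b (fun i => if (i : ℕ) < c then 0 else v i)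
  have hPQ : P * Qᵀ = 0 := pattern_mul_transpose fun i => by split_ifs <;> simp
  calc h * P * g.adjugate * (g * Qᵀ * h'.adjugate)
      = h * P * (g.adjugate * g) * Qᵀ * h'.adjugate := by simp only [Matrix.mul_assoc]
    _ = g.det • (h * (P * Qᵀ) * h'.adjugate) := by
      rw [Matrix.adjugate_mul]; simp [Matrix.mul_assoc]
    _ = 0 := by rw [hPQ]; simp

/-- With `h' = h` the factor `h.adjugate * h` between `Y` and `X` is a scalar too, and this kills
the second product. -/
theorem normalPair_mem_circ {S : Type u} [CommRing S] {a b : ℕ} (c : ℕ)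
    (g : Matrix (Fin a) (Fin a) S) (h : Matrix (Fin b) (Fin b) S) (u v : Fin a → S) :
    normalPair c g h h u v ∈ circ S a b := by
  refine ⟨normalPair_fst_mul_snd c g h h u v, ?_⟩
  simp only [normalPair]
  set P := pattern b (fun i => if (i : ℕ) < c then u i else 0)
  set Q := pattern b (fun i => if (i : ℕ) < c then 0 else v i)
  have hPQ : Qᵀ * P = 0 := pattern_transpose_mul fun i => by split_ifs <;> simp
  calc g * Qᵀ * h.adjugate * (h * P * g.adjugate)
      = g * Qᵀ * (h.adjugate * h) * P * g.adjugate := by simp only [Matrix.mul_assoc]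
    _ = h.det • (g * (Qᵀ * P) * g.adjugate) := by
      rw [Matrix.adjugate_mul]; simp [Matrix.mul_assoc]
    _ = 0 := by rw [hPQ]; simp

theorem rank_pattern_le {K : Type*} [Field K] {a b : ℕ} (u : Fin a → K) (s : Finset (Fin a))
    (hs : ∀ i ∉ s, u i = 0) : (pattern b u).rank ≤ s.card := by
  classical
  rw [← Matrix.rank_transpose]
  refine Matrix.rank_le_card_of_support_subset _ _ fun i hi => ?_
  by_contra hn
  apply hi
  funext j
  simp [pattern, hs i (by simpa using hn)]

theorem rank_normalPair_fst_le {K : Type u} [Field K] {a b c : ℕ}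
    (g : Matrix (Fin a) (Fin a) K) (h h' : Matrix (Fin b) (Fin b) K) (u v : Fin a → K) :
    (normalPair c g h h' u v).1.rank ≤ c := by
  refine (Matrix.rank_mul_le_left _ _).trans ((Matrix.rank_mul_le_right _ _).trans ?_)
  refine (rank_pattern_le _ (Finset.univ.filter fun i : Fin a => (i : ℕ) < c) ?_).trans ?_
  · intro i hi
    simp only [Finset.mem_filter, Finset.mem_univ, true_and] at hi
    simp [hi]
  · rw [Fin.card_filter_val_lt]; omega

theorem rank_normalPair_snd_le {K : Type u} [Field K] {a b c : ℕ}
    (g : Matrix (Fin a) (Fin a) K) (h h' : Matrix (Fin b) (Fin b) K) (u v : Fin a → K) :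
    (normalPair c g h h' u v).2.rank ≤ a - c := by
  refine (Matrix.rank_mul_le_left _ _).trans ((Matrix.rank_mul_le_right _ _).trans ?_)
  rw [Matrix.rank_transpose]
  refine (rank_pattern_le _ (Finset.univ.filter fun i : Fin a => ¬ (i : ℕ) < c) ?_).trans ?_
  · intro i hi
    simp only [Finset.mem_filter, Finset.mem_univ, true_and, not_not] at hi
    simp [hi]
  · rw [Finset.filter_not, Finset.card_sdiff_of_subset (Finset.filter_subset _ _),
      Fin.card_filter_val_lt]
    simp

/-- Every circular complex with `rank X ≤ c` and `rank Y ≤ a - c` has a normal form. -/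
theorem exists_normalPair_of_circ {K : Type u} [Field K] {a b c : ℕ} (hab : a ≤ b) (hc : c ≤ a)
    (p : MatPair K a b) (hp : p ∈ circ K a b) (h1 : p.1.rank ≤ c) (h2 : p.2.rank ≤ a - c) :
    ∃ g h u v, IsUnit (Matrix.det h) ∧ p = normalPair c g h h u v := by
  classical
  obtain ⟨X, Y⟩ := p
  obtain ⟨hXY, hYX⟩ := hp
  simp only at hXY hYX h1 h2
  set r := X.rank with hr
  set s := Y.rank with hs
  let fX : (Fin a → K) →ₗ[K] (Fin b → K) := X.mulVecLin
  let fY : (Fin b → K) →ₗ[K] (Fin a → K) := Y.mulVecLin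
  have hfXY : ∀ y, fX (fY y) = 0 := fun y => by
    simp [fX, fY, Matrix.mulVec_mulVec, hXY]
  have hfYX : ∀ y, fY (fX y) = 0 := fun y => by
    simp [fX, fY, Matrix.mulVec_mulVec, hYX]
  have hkX : Module.finrank K (LinearMap.ker fX) = a - r := by
    have := LinearMap.finrank_range_add_finrank_ker fX
    rw [Module.finrank_fin_fun] at this
    have h : Module.finrank K (LinearMap.range fX) = r := rfl
    omega
  have hkY : Module.finrank K (LinearMap.ker fY) = b - s := by
    have := LinearMap.finrank_range_add_finrank_ker fY
    rw [Module.finrank_fin_fun] at this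
    have h : Module.finrank K (LinearMap.range fY) = s := rfl
    omega
  -- In both bases the indices below `r` carry the rank of `X` and those in `[c, c + s)` the rank of
  -- `Y`. The bounds `r ≤ c` and `c + s ≤ a` keep the two ranges disjoint and inside `[0, a)`. The
  -- bases are built so that `X f_i = e_i` on the first range, `Y e_j = f_j` on the second, and all
  -- other basis vectors are killed.
  let S1 : Fin a → Prop := fun i => (i : ℕ) < r
  let S2 : Fin b → Prop := fun j => c ≤ (j : ℕ) ∧ (j : ℕ) < c + s
  have cS1 : Fintype.card {i // S1 i} = r := by
    rw [Fintype.card_subtype, Fin.card_filter_val_lt]; omega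
  have eS2 : Fintype.card {j // S2 j} = s := by
    have e : {j // S2 j} ≃ Fin s :=
      ⟨fun j => ⟨j.1 - c, by have := j.2.1; have := j.2.2; omega⟩,
        fun i => ⟨⟨c + i, by omega⟩, by simp, by simp⟩,
        fun j => Subtype.ext (Fin.ext (by have := j.2.1; simp; omega)), fun i => Fin.ext (by simp)⟩
    simp [Fintype.card_congr e]
  obtain ⟨pX, hpX⟩ := exists_lift_range_basis fX (κ := {i // S1 i}) cS1
  obtain ⟨pY, hpY⟩ := exists_lift_range_basis fY (κ := {j // S2 j}) eS2
  -- a basis of the kernel of `X`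
  let T1 : {i // ¬ S1 i} → Prop := fun i => c ≤ (i.1 : ℕ) ∧ (i.1 : ℕ) < c + s
  let v1 : {i // T1 i} → LinearMap.ker fX := fun i =>
    ⟨fY (pY ⟨⟨i.1.1, lt_of_lt_of_le i.1.1.2 hab⟩, i.2⟩), hfXY _⟩
  have hv1 : LinearIndependent K v1 := by
    refine LinearIndependent.of_comp (LinearMap.ker fX).subtype ?_
    exact hpY.comp (fun i : {i // T1 i} =>
      (⟨⟨i.1.1, lt_of_lt_of_le i.1.1.2 hab⟩, i.2⟩ : {j // S2 j}))
      (fun i j hij => by simpa [Subtype.ext_iff, Fin.ext_iff] using hij)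
  obtain ⟨q1, hq1⟩ := exists_basis_prescribed T1 v1 hv1
    (by rw [Fintype.card_subtype_compl, cS1, hkX, Fintype.card_fin])
  -- a basis of the kernel of `Y`
  let T2 : {j // ¬ S2 j} → Prop := fun j => (j.1 : ℕ) < r
  have hT2a : ∀ j : {j // ¬ S2 j}, T2 j → (j.1 : ℕ) < a := fun j hj => by
    have : (j.1 : ℕ) < r := hj
    omega
  let v2 : {j // T2 j} → LinearMap.ker fY := fun j =>
    ⟨fX (pX ⟨⟨j.1.1, hT2a j.1 j.2⟩, j.2⟩), hfYX _⟩
  have hv2 : LinearIndependent K v2 := by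
    refine LinearIndependent.of_comp (LinearMap.ker fY).subtype ?_
    exact hpX.comp (fun j : {j // T2 j} => (⟨⟨j.1.1, hT2a j.1 j.2⟩, j.2⟩ : {i // S1 i}))
      (fun i j hij => by simpa [Subtype.ext_iff, Fin.ext_iff] using hij)
  obtain ⟨q2, hq2⟩ := exists_basis_prescribed T2 v2 hv2
    (by rw [Fintype.card_subtype_compl, eS2, hkY, Fintype.card_fin])
  obtain ⟨f, hf1, hf2⟩ := exists_basis_of_ker fX S1 pX hpX q1 (by simp)
  obtain ⟨e, he1, he2⟩ := exists_basis_of_ker fY S2 pY hpY q2 (by simp)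
  let u : Fin a → K := fun i => if (i : ℕ) < r then 1 else 0
  let v : Fin a → K := fun i => if c ≤ (i : ℕ) ∧ (i : ℕ) < c + s then 1 else 0
  let g : Matrix (Fin a) (Fin a) K := Matrix.of fun i j => f j i
  let h : Matrix (Fin b) (Fin b) K := Matrix.of fun i j => e j i
  have hg : IsUnit g.det := by
    rw [← Matrix.isUnit_iff_isUnit_det, ← Matrix.linearIndependent_cols_iff_isUnit]
    exact f.linearIndependent
  have hh : IsUnit h.det := by
    rw [← Matrix.isUnit_iff_isUnit_det, ← Matrix.linearIndependent_cols_iff_isUnit]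
    exact e.linearIndependent
  have hXg : X * g = h * pattern b u := by
    ext j i
    have h3 : (X * g) j i = fX (f i) j := rfl
    have h4 : (h * pattern b u) j i = u i * e ⟨i, by omega⟩ j := by
      simp only [Matrix.mul_apply, pattern, Matrix.of_apply, h]
      rw [Finset.sum_eq_single (⟨i, by omega⟩ : Fin b)]
      · simp [mul_comm]
      · intro j' _ hj'
        rw [if_neg (fun hh => hj' (Fin.ext hh)), mul_zero]
      · simp
    rw [h3, h4]
    by_cases hi : (i : ℕ) < r
    · have hn : ¬ S2 ⟨i, by omega⟩ := fun hn => by have := hn.1; simp only at this; omega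
      rw [hf1 i hi, he2 _ hn, hq2 ⟨_, hn⟩ hi]
      simp [u, hi, v2]
    · rw [hf2 i hi]
      have : fX (q1 ⟨i, hi⟩) = 0 := (q1 ⟨i, hi⟩).2
      simp [u, hi, this]
  have hYh : Y * h = g * (pattern b v)ᵀ := by
    ext i j
    have h3 : (Y * h) i j = fY (e j) i := rfl
    rw [h3]
    by_cases hj : S2 j
    · have hja : (j : ℕ) < a := by have := hj.2; omega
      have h4 : (g * (pattern b v)ᵀ) i j = f ⟨j, hja⟩ i := by
        simp only [Matrix.mul_apply, pattern, Matrix.of_apply, Matrix.transpose_apply, g]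
        rw [Finset.sum_eq_single (⟨j, hja⟩ : Fin a)]
        · simp [v, hj.1, hj.2]
        · intro j' _ hj'
          rw [if_neg (fun hh => hj' (Fin.ext hh.symm)), mul_zero]
        · simp
      have hn : ¬ S1 ⟨j, hja⟩ := fun hn => by
        have h5 := hj.1; have : (j : ℕ) < r := hn; omega
      rw [h4, he1 j hj, hf2 _ hn, hq1 ⟨_, hn⟩ hj]
    · have h4 : (g * (pattern b v)ᵀ) i j = 0 := by
        simp only [Matrix.mul_apply, pattern, Matrix.of_apply, Matrix.transpose_apply]
        refine Finset.sum_eq_zero fun l _ => ?_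
        split_ifs with hl
        · have : ¬ (c ≤ (l : ℕ) ∧ (l : ℕ) < c + s) := fun hl' => hj (by
            rw [← hl] at hl'; exact hl')
          simp [v, this]
        · simp
      rw [h4, he2 j hj]
      have : fY (q2 ⟨j, hj⟩) = 0 := (q2 ⟨j, hj⟩).2
      simp [this]
  -- The adjugate is the determinant times the inverse; the superfluous determinants are absorbed in
  -- the diagonal entries.
  refine ⟨g, h, fun i => g.det⁻¹ * u i, fun i => h.det⁻¹ * v i, hh, ?_⟩
  have p1 : pattern b (fun i : Fin a => if (i : ℕ) < c then g.det⁻¹ * u i else 0) =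
      g.det⁻¹ • pattern b u := by
    ext j i
    simp only [pattern, Matrix.of_apply, Matrix.smul_apply, smul_eq_mul, mul_ite, mul_zero, u]
    split_ifs <;> first | rfl | omega
  have p2 : pattern b (fun i : Fin a => if (i : ℕ) < c then 0 else h.det⁻¹ * v i) =
      h.det⁻¹ • pattern b v := by
    ext j i
    simp only [pattern, Matrix.of_apply, Matrix.smul_apply, smul_eq_mul, mul_ite, mul_zero, v]
    split_ifs <;> first | rfl | omega
  have q1 : X = h * pattern b (fun i => if (i : ℕ) < c then g.det⁻¹ * u i else 0) * g.adjugate := by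
    rw [p1, Matrix.mul_smul, ← hXg, Matrix.smul_mul, Matrix.mul_assoc, Matrix.mul_adjugate]
    simp [smul_smul, inv_mul_cancel₀ hg.ne_zero]
  have q2 : Y = g * (pattern b (fun i => if (i : ℕ) < c then 0 else h.det⁻¹ * v i))ᵀ *
      h.adjugate := by
    rw [p2, Matrix.transpose_smul, Matrix.mul_smul, ← hYh, Matrix.smul_mul, Matrix.mul_assoc,
      Matrix.mul_adjugate]
    simp [smul_smul, inv_mul_cancel₀ hh.ne_zero]
  exact Prod.ext q1 q2

/-- Since `rank X ≤ c ≤ b - (a - c) ≤ dim ker Y`, some automorphism `H` of `K^b` moves the image of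
`X` into the kernel of `Y`. Then `(X, YH)` is a circular complex, and undoing `H` turns its matrix
`h` on the side of `Y` into `h' = H h`. -/
theorem exists_normalPair_of_mul_eq_zero {K : Type u} [Field K] {a b c : ℕ} (hab : a ≤ b)
    (hc : c ≤ a) (p : MatPair K a b) (hp : p.1 * p.2 = 0) (h1 : p.1.rank ≤ c)
    (h2 : p.2.rank ≤ a - c) :
    ∃ g h h' u v, p = normalPair c g h h' u v := by
  classical
  obtain ⟨X, Y⟩ := p
  simp only at hp h1 h2
  let U := LinearMap.range X.mulVecLin
  let U' := LinearMap.ker Y.mulVecLin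
  have hU : Module.finrank K U ≤ Module.finrank K U' := by
    have := LinearMap.finrank_range_add_finrank_ker Y.mulVecLin
    rw [Module.finrank_fin_fun] at this
    have e1 : Module.finrank K (LinearMap.range Y.mulVecLin) = Y.rank := rfl
    have e2 : Module.finrank K U = X.rank := rfl
    have e3 : Module.finrank K U' = Module.finrank K (LinearMap.ker Y.mulVecLin) := rfl
    omega
  obtain ⟨φ, hφ⟩ := exists_linearEquiv_map_le hU
  let H := LinearMap.toMatrix' φ.toLinearMap
  let H' := LinearMap.toMatrix' φ.symm.toLinearMap
  have hHH : H * H' = 1 := by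
    rw [← LinearMap.toMatrix'_comp]; simp
  have hYH : Y * H * X = 0 := by
    refine Matrix.ext_of_mulVec_single fun i => ?_
    rw [← Matrix.mulVec_mulVec, ← Matrix.mulVec_mulVec, Matrix.zero_mulVec]
    have : φ (X *ᵥ Pi.single i 1) ∈ U' := hφ ⟨_, ⟨Pi.single i 1, rfl⟩, rfl⟩
    have h3 : H *ᵥ (X *ᵥ Pi.single i 1) = φ (X *ᵥ Pi.single i 1) :=
      LinearMap.toMatrix'_mulVec _ _
    rw [h3]
    exact this
  obtain ⟨g, h, u, v, hh, hgh⟩ := exists_normalPair_of_circ hab hc (X, Y * H)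
    ⟨by simp only [← Matrix.mul_assoc, hp, Matrix.zero_mul], hYH⟩ h1
    ((Matrix.rank_mul_le_left _ _).trans h2)
  have e1 := congrArg Prod.fst hgh
  have e2 := congrArg Prod.snd hgh
  simp only [normalPair] at e1 e2
  have hinv : (H * h).adjugate = h.adjugate * H.adjugate := Matrix.adjugate_mul_distrib _ _
  have hdet : H.det * H'.det = 1 := by rw [← Matrix.det_mul, hHH, Matrix.det_one]
  refine ⟨g, h, H * h, u, fun i => H'.det * v i, ?_⟩
  have p2 : pattern b (fun i : Fin a => if (i : ℕ) < c then 0 else H'.det * v i) =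
      H'.det • pattern b (fun i : Fin a => if (i : ℕ) < c then 0 else v i) := by
    ext j i
    simp only [pattern, Matrix.of_apply, Matrix.smul_apply, smul_eq_mul, mul_ite, mul_zero]
  refine Prod.ext e1 ?_
  simp only [normalPair]
  rw [p2, hinv, Matrix.transpose_smul, Matrix.mul_smul, Matrix.smul_mul, ← Matrix.mul_assoc, ← e2,
    Matrix.mul_assoc, Matrix.mul_adjugate, Matrix.mul_smul, smul_smul, mul_comm, hdet]
  simp

end NormalForm

/-! ### Generic complexes over a domain -/

section Generic

open Matrix

/-- The square submatrix of the first `d` rows and the last `d` columns. -/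
def corner {S : Type*} {m n : ℕ} (d : ℕ) (hm : d ≤ m) (hn : d ≤ n) (A : Matrix (Fin m) (Fin n) S) :
    Matrix (Fin d) (Fin d) S :=
  A.submatrix (Fin.castLE hm) fun j => ⟨n - d + j, by omega⟩

/-- The matrix whose `d × d` corner is the identity and whose other entries vanish. -/
def cornerOne (S : Type*) [Zero S] [One S] (m n d : ℕ) : Matrix (Fin m) (Fin n) S :=
  Matrix.of fun i j => if (i : ℕ) < d ∧ (j : ℕ) + d = n + i then 1 else 0

theorem corner_cornerOne {S : Type*} [Zero S] [One S] {m n d : ℕ} (hm : d ≤ m) (hn : d ≤ n) :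
    corner d hm hn (cornerOne S m n d) = 1 := by
  ext i j
  simp only [corner, cornerOne, Matrix.submatrix_apply, Matrix.of_apply, Fin.val_castLE,
    Matrix.one_apply, Fin.ext_iff]
  have := i.2
  have := j.2
  congr 1
  simp only [eq_iff_iff]
  omega

theorem rank_cornerOne_le {K : Type*} [Field K] {m n d : ℕ} (hm : d ≤ m) :
    (cornerOne K m n d).rank ≤ d := by
  refine (Matrix.rank_le_card_of_support_subset _
    (Finset.univ.filter fun i : Fin m => (i : ℕ) < d) fun i hi => ?_).trans ?_
  · by_contra hn
    apply hi
    funext j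
    simp only [Finset.coe_filter, Finset.mem_univ, true_and, Set.mem_ofPred_eq] at hn
    simp [cornerOne, hn]
  · rw [Fin.card_filter_val_lt]; omega

/-- The nonzero columns of `X` are the last `c`, the nonzero rows of `Y` the first `a - c`; the
nonzero columns of `Y` are the last `a - c`, the nonzero rows of `X` the first `c`. Both pairs are
disjoint, the second because `a ≤ b`. -/
theorem cornerOne_mem_circ {S : Type u} [CommRing S] {a b c : ℕ} (hab : a ≤ b) (hc : c ≤ a) :
    ((cornerOne S b a c, cornerOne S a b (a - c)) : MatPair S a b) ∈ circ S a b := by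
  constructor
  · ext i j
    simp only [cornerOne, Matrix.mul_apply, Matrix.of_apply, Matrix.zero_apply]
    refine Finset.sum_eq_zero fun l _ => ?_
    split_ifs <;> first | omega | simp
  · ext i j
    simp only [cornerOne, Matrix.mul_apply, Matrix.of_apply, Matrix.zero_apply]
    refine Finset.sum_eq_zero fun l _ => ?_
    split_ifs <;> first | omega | simp

theorem det_corner_map {S T : Type*} [CommRing S] [CommRing T] (φ : S →+* T) {m n d : ℕ}
    (hm : d ≤ m) (hn : d ≤ n) (A : Matrix (Fin m) (Fin n) S) :
    (corner d hm hn (A.map φ)).det = φ (corner d hm hn A).det := by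
  rw [RingHom.map_det]; rfl

theorem det_corner_ne_zero_of_map {S K : Type u} [CommRing S] [Field K] (φ : S →+* K) {m n d : ℕ}
    (hm : d ≤ m) (hn : d ≤ n) (A : Matrix (Fin m) (Fin n) S)
    (h : A.map φ = cornerOne K m n d) : (corner d hm hn A).det ≠ 0 := by
  intro h0
  have := det_corner_map φ hm hn A
  rw [h, corner_cornerOne, h0] at this
  simp at this

/-- There is a family of circular complexes over a domain, with nonvanishing corners, that
specializes to all circular complexes with `rank X ≤ c` and `rank Y ≤ a - c`. -/
theorem exists_generic_circ (k : Type u) [Field k] {a b c : ℕ} (hab : a ≤ b) (hc : c ≤ a) :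
    ∃ (D : Type u) (_ : CommRing D) (_ : IsDomain D) (_ : Algebra k D) (P : MatPair D a b),
      P ∈ circ D a b ∧ (corner c (hc.trans hab) hc P.1).det ≠ 0 ∧
      (corner (a - c) (Nat.sub_le a c) ((Nat.sub_le a c).trans hab) P.2).det ≠ 0 ∧
      ∀ (K : Type u) [Field K] [Algebra k K],
        (∀ φ : D →ₐ[k] K, (mapPair φ P).1.rank ≤ c ∧ (mapPair φ P).2.rank ≤ a - c) ∧
        ∀ p ∈ circ K a b, p.1.rank ≤ c → p.2.rank ≤ a - c → ∃ φ : D →ₐ[k] K, mapPair φ P = p := by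
  let I := (Fin a × Fin a) ⊕ (Fin b × Fin b) ⊕ Fin a ⊕ Fin a
  let D := MvPolynomial I k
  let g : Matrix (Fin a) (Fin a) D := Matrix.of fun i j => MvPolynomial.X (Sum.inl (i, j))
  let h : Matrix (Fin b) (Fin b) D := Matrix.of fun i j => MvPolynomial.X (Sum.inr (Sum.inl (i, j)))
  let u : Fin a → D := fun i => MvPolynomial.X (Sum.inr (Sum.inr (Sum.inl i)))
  let v : Fin a → D := fun i => MvPolynomial.X (Sum.inr (Sum.inr (Sum.inr i)))
  let P : MatPair D a b := normalPair c g h h u v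
  have hmap : ∀ (K : Type u) [Field K] [Algebra k K] (φ : D →ₐ[k] K), mapPair φ P =
      normalPair c (g.map φ) (h.map φ) (h.map φ) (fun i => φ (u i)) (fun i => φ (v i)) :=
    fun K _ _ φ => mapPair_normalPair (φ : D →+* K) c g h h u v
  have hspec : ∀ (K : Type u) [Field K] [Algebra k K], ∀ p ∈ circ K a b, p.1.rank ≤ c →
      p.2.rank ≤ a - c → ∃ φ : D →ₐ[k] K, mapPair φ P = p := by
    intro K _ _ p hp h1 h2
    obtain ⟨g', h', u', v', -, rfl⟩ := exists_normalPair_of_circ hab hc p hp h1 h2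
    refine ⟨MvPolynomial.aeval (Sum.elim (fun ij => g' ij.1 ij.2) (Sum.elim (fun ij => h' ij.1 ij.2)
      (Sum.elim u' v'))), ?_⟩
    rw [hmap]
    congr 1
    all_goals first
      | exact Matrix.ext fun i j => MvPolynomial.aeval_X _ _
      | exact funext fun i => MvPolynomial.aeval_X _ _
  -- A single specialization with identity corners proves that the generic corner minors do not
  -- vanish.
  obtain ⟨φ, hφ⟩ := hspec k _ (cornerOne_mem_circ hab hc) (rank_cornerOne_le (hc.trans hab))
    (rank_cornerOne_le (Nat.sub_le a c))
  refine ⟨D, inferInstance, inferInstance, inferInstance, P, normalPair_mem_circ _ _ _ _ _,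
    det_corner_ne_zero_of_map (φ : D →+* k) _ _ _ (congrArg Prod.fst hφ),
    det_corner_ne_zero_of_map (φ : D →+* k) _ _ _ (congrArg Prod.snd hφ),
    fun K _ _ => ⟨fun φ => ?_, hspec K⟩⟩
  rw [hmap]
  exact ⟨rank_normalPair_fst_le _ _ _ _ _, rank_normalPair_snd_le _ _ _ _ _⟩

/-- There is a family of complexes over a domain, with nonvanishing corners, that specializes to all
complexes with `rank X ≤ c` and `rank Y ≤ a - c`. -/
theorem exists_generic_complex (k : Type u) [Field k] {a b c : ℕ} (hab : a ≤ b) (hc : c ≤ a) :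
    ∃ (D : Type u) (_ : CommRing D) (_ : IsDomain D) (_ : Algebra k D) (P : MatPair D a b),
      P.1 * P.2 = 0 ∧ (corner c (hc.trans hab) hc P.1).det ≠ 0 ∧
      (corner (a - c) (Nat.sub_le a c) ((Nat.sub_le a c).trans hab) P.2).det ≠ 0 ∧
      ∀ (K : Type u) [Field K] [Algebra k K],
        (∀ φ : D →ₐ[k] K, (mapPair φ P).1.rank ≤ c ∧ (mapPair φ P).2.rank ≤ a - c) ∧
        ∀ p : MatPair K a b, p.1 * p.2 = 0 → p.1.rank ≤ c → p.2.rank ≤ a - c →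
          ∃ φ : D →ₐ[k] K, mapPair φ P = p := by
  -- Here `h'` has its own free entries, since only `XY = 0` is imposed.
  let I := (Fin a × Fin a) ⊕ (Fin b × Fin b) ⊕ (Fin b × Fin b) ⊕ Fin a ⊕ Fin a
  let D := MvPolynomial I k
  let g : Matrix (Fin a) (Fin a) D := Matrix.of fun i j => MvPolynomial.X (Sum.inl (i, j))
  let h : Matrix (Fin b) (Fin b) D := Matrix.of fun i j => MvPolynomial.X (Sum.inr (Sum.inl (i, j)))
  let h' : Matrix (Fin b) (Fin b) D :=
    Matrix.of fun i j => MvPolynomial.X (Sum.inr (Sum.inr (Sum.inl (i, j))))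
  let u : Fin a → D := fun i => MvPolynomial.X (Sum.inr (Sum.inr (Sum.inr (Sum.inl i))))
  let v : Fin a → D := fun i => MvPolynomial.X (Sum.inr (Sum.inr (Sum.inr (Sum.inr i))))
  let P : MatPair D a b := normalPair c g h h' u v
  have hmap : ∀ (K : Type u) [Field K] [Algebra k K] (φ : D →ₐ[k] K), mapPair φ P =
      normalPair c (g.map φ) (h.map φ) (h'.map φ) (fun i => φ (u i)) (fun i => φ (v i)) :=
    fun K _ _ φ => mapPair_normalPair (φ : D →+* K) c g h h' u v
  have hspec : ∀ (K : Type u) [Field K] [Algebra k K], ∀ p : MatPair K a b, p.1 * p.2 = 0 →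
      p.1.rank ≤ c → p.2.rank ≤ a - c → ∃ φ : D →ₐ[k] K, mapPair φ P = p := by
    intro K _ _ p hp h1 h2
    obtain ⟨g₁, h₁, h₁', u₁, v₁, rfl⟩ := exists_normalPair_of_mul_eq_zero hab hc p hp h1 h2
    refine ⟨MvPolynomial.aeval (Sum.elim (fun ij => g₁ ij.1 ij.2) (Sum.elim (fun ij => h₁ ij.1 ij.2)
      (Sum.elim (fun ij => h₁' ij.1 ij.2) (Sum.elim u₁ v₁)))), ?_⟩
    rw [hmap]
    congr 1
    all_goals first
      | exact Matrix.ext fun i j => MvPolynomial.aeval_X _ _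
      | exact funext fun i => MvPolynomial.aeval_X _ _
  obtain ⟨φ, hφ⟩ := hspec k _ (cornerOne_mem_circ hab hc).1 (rank_cornerOne_le (hc.trans hab))
    (rank_cornerOne_le (Nat.sub_le a c))
  refine ⟨D, inferInstance, inferInstance, inferInstance, P, normalPair_fst_mul_snd _ _ _ _ _ _,
    det_corner_ne_zero_of_map (φ : D →+* k) _ _ _ (congrArg Prod.fst hφ),
    det_corner_ne_zero_of_map (φ : D →+* k) _ _ _ (congrArg Prod.snd hφ),
    fun K _ _ => ⟨fun φ => ?_, hspec K⟩⟩
  rw [hmap]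
  exact ⟨rank_normalPair_fst_le _ _ _ _ _, rank_normalPair_snd_le _ _ _ _ _⟩

end Generic

/-! ### The irreducible components of the variety of circular complexes -/

section Components

open MvPolynomial

theorem map_mem_circ {R S : Type u} [CommRing R] [CommRing S] {a b : ℕ} (φ : R →+* S)
    {p : MatPair R a b} (hp : p ∈ circ R a b) : mapPair φ p ∈ circ S a b := by
  refine ⟨?_, ?_⟩
  · simp only [mapPair]
    rw [← Matrix.map_mul, hp.1, Matrix.map_zero _ (map_zero φ)]
  · simp only [mapPair]
    rw [← Matrix.map_mul, hp.2, Matrix.map_zero _ (map_zero φ)]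

theorem coords_mapPair {R S : Type u} {a b : ℕ} (φ : R → S) (p : MatPair R a b) :
    coords (mapPair φ p) = φ ∘ coords p := by
  funext i
  rcases i with i | i <;> rfl

theorem aeval_coords_mapPair {k R S : Type u} [Field k] [CommRing R] [CommRing S] [Algebra k R]
    [Algebra k S] {a b : ℕ} (φ : R →ₐ[k] S) (p : MatPair R a b)
    (f : MvPolynomial (CoordIdx a b) k) :
    aeval (coords (mapPair φ p)) f = φ (aeval (coords p) f) := by
  rw [coords_mapPair, ← AlgHom.comp_apply, MvPolynomial.comp_aeval]
  rfl

theorem mem_circ_iff {k R : Type u} [Field k] [CommRing R] [Algebra k R] {a b : ℕ}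
    (p : MatPair R a b) :
    p ∈ circ R a b ↔ ∀ f ∈ circIdeal k a b, aeval (coords p) f = 0 := by
  have key : (circIdeal k a b ≤ RingHom.ker (aeval (R := k) (coords p))) ↔ p ∈ circ R a b := by
    rw [circIdeal, Ideal.span_le, Set.union_subset_iff]
    refine and_congr ⟨fun h => ?_, fun h => ?_⟩ ⟨fun h => ?_, fun h => ?_⟩
    · ext i j
      have := h ⟨i, j, rfl⟩
      simpa [coords, RingHom.mem_ker, Matrix.mul_apply] using this
    · rintro _ ⟨i, j, rfl⟩
      have := congrFun (congrFun h i) j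
      simpa [coords, RingHom.mem_ker, Matrix.mul_apply] using this
    · ext i j
      have := h ⟨i, j, rfl⟩
      simpa [coords, RingHom.mem_ker, Matrix.mul_apply] using this
    · rintro _ ⟨i, j, rfl⟩
      have := congrFun (congrFun h i) j
      simpa [coords, RingHom.mem_ker, Matrix.mul_apply] using this
  rw [← key]
  rfl

theorem circIdeal_le_stratumIdeal (k : Type u) [Field k] (a b c : ℕ) :
    circIdeal k a b ≤ stratumIdeal k a b c :=
  fun f hf _ _ _ p hp => (mem_circ_iff p).1 hp.1 f hf

theorem det_X_aeval {k R : Type u} [Field k] [CommRing R] [Algebra k R] {a b d : ℕ}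
    (p : MatPair R a b) (e : Fin d → Fin d → CoordIdx a b) :
    aeval (coords p) (Matrix.det (Matrix.of fun i j => (X (e i j) : MvPolynomial (CoordIdx a b) k)))
      = Matrix.det (Matrix.of fun i j => coords p (e i j)) := by
  rw [AlgHom.map_det]
  congr 1
  ext i j
  simp

/-- The equations of `𝓛` and the minors of sizes `c + 1` of `X` and `a - c + 1` of `Y` vanish on the
open stratum, so they belong to its ideal. -/
theorem component_subset {k K : Type u} [Field k] [Field K] [Algebra k K] {a b c : ℕ}
    {p : MatPair K a b} (hp : p ∈ component k a b c K) :
    p ∈ circ K a b ∧ p.1.rank ≤ c ∧ p.2.rank ≤ a - c := by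
  refine ⟨(mem_circ_iff (k := k) p).2 fun f hf => hp f (circIdeal_le_stratumIdeal k a b c hf), ?_, ?_⟩
  · rw [rank_le_iff_minors]
    intro r s
    have h1 : Matrix.det (Matrix.of fun i j =>
        (X (Sum.inl (r i, s j)) : MvPolynomial (CoordIdx a b) k)) ∈ stratumIdeal k a b c := by
      intro L _ _ q hq
      rw [det_X_aeval]
      exact (rank_le_iff_minors q.1 c).1 hq.2.1.le r s
    have := hp _ h1
    rwa [det_X_aeval] at this
  · rw [rank_le_iff_minors]
    intro r s
    have h1 : Matrix.det (Matrix.of fun i j =>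
        (X (Sum.inr (r i, s j)) : MvPolynomial (CoordIdx a b) k)) ∈ stratumIdeal k a b c := by
      intro L _ _ q hq
      rw [det_X_aeval]
      exact (rank_le_iff_minors q.2 _).1 hq.2.2.le r s
    have := hp _ h1
    rwa [det_X_aeval] at this

theorem mem_openStratum_of_corners {K : Type u} [Field K] {a b c : ℕ} (hab : a ≤ b) (hc : c ≤ a)
    {p : MatPair K a b} (hp : p ∈ circ K a b) (h1 : p.1.rank ≤ c) (h2 : p.2.rank ≤ a - c)
    (h3 : (corner c (hc.trans hab) hc p.1).det ≠ 0)
    (h4 : (corner (a - c) (Nat.sub_le a c) ((Nat.sub_le a c).trans hab) p.2).det ≠ 0) :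
    p ∈ openStratum K a b c :=
  ⟨hp, h1.antisymm (le_rank_of_submatrix_det_ne_zero _ _ _ h3),
    h2.antisymm (le_rank_of_submatrix_det_ne_zero _ _ _ h4)⟩

theorem exists_injective_field (k : Type u) [Field k] (D : Type u) [CommRing D] [IsDomain D]
    [Algebra k D] : ∃ (L : Type u) (_ : Field L) (_ : Algebra k L) (ψ : D →ₐ[k] L),
      Function.Injective ψ :=
  ⟨FractionRing D, inferInstance, inferInstance, IsScalarTower.toAlgHom k D (FractionRing D),
    IsFractionRing.injective D (FractionRing D)⟩

theorem det_corner_map_ne_zero {S T : Type*} [CommRing S] [CommRing T] (φ : S →+* T)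
    (hφ : Function.Injective φ) {m n d : ℕ} (hm : d ≤ m) (hn : d ≤ n)
    (A : Matrix (Fin m) (Fin n) S) (h : (corner d hm hn A).det ≠ 0) :
    (corner d hm hn (A.map φ)).det ≠ 0 := by
  rw [det_corner_map]
  exact fun h0 => h (hφ (h0.trans (map_zero φ).symm))

/-- The generic complex, over the field of fractions. -/
theorem exists_generic_circ_field (k : Type u) [Field k] {a b c : ℕ} (hab : a ≤ b) (hc : c ≤ a) :
    ∃ (D : Type u) (_ : CommRing D) (_ : IsDomain D) (_ : Algebra k D) (P : MatPair D a b)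
      (L : Type u) (_ : Field L) (_ : Algebra k L) (ψ : D →ₐ[k] L),
      Function.Injective ψ ∧ P ∈ circ D a b ∧
      (mapPair ψ P).1.rank ≤ c ∧ (mapPair ψ P).2.rank ≤ a - c ∧
      (corner c (hc.trans hab) hc (mapPair ψ P).1).det ≠ 0 ∧
      (corner (a - c) (Nat.sub_le a c) ((Nat.sub_le a c).trans hab) (mapPair ψ P).2).det ≠ 0 ∧
      ∀ (K : Type u) [Field K] [Algebra k K],
        ∀ p ∈ circ K a b, p.1.rank ≤ c → p.2.rank ≤ a - c → ∃ φ : D →ₐ[k] K, mapPair φ P = p := by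
  obtain ⟨D, _, _, _, P, hP, h1, h2, h3⟩ := exists_generic_circ k hab hc
  obtain ⟨L, _, _, ψ, hψ⟩ := exists_injective_field k D
  exact ⟨D, _, ‹_›, _, P, L, _, _, ψ, hψ, hP, ((h3 _).1 ψ).1, ((h3 _).1 ψ).2,
    det_corner_map_ne_zero (ψ : D →+* L) hψ _ _ _ h1,
    det_corner_map_ne_zero (ψ : D →+* L) hψ _ _ _ h2, fun K _ _ => (h3 K).2⟩

theorem exists_generic_complex_field (k : Type u) [Field k] {a b c : ℕ} (hab : a ≤ b)
    (hc : c ≤ a) :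
    ∃ (D : Type u) (_ : CommRing D) (_ : IsDomain D) (_ : Algebra k D) (P : MatPair D a b)
      (L : Type u) (_ : Field L) (_ : Algebra k L) (ψ : D →ₐ[k] L),
      Function.Injective ψ ∧ P.1 * P.2 = 0 ∧
      (mapPair ψ P).1.rank ≤ c ∧ (mapPair ψ P).2.rank ≤ a - c ∧
      (corner c (hc.trans hab) hc (mapPair ψ P).1).det ≠ 0 ∧
      (corner (a - c) (Nat.sub_le a c) ((Nat.sub_le a c).trans hab) (mapPair ψ P).2).det ≠ 0 ∧
      ∀ (K : Type u) [Field K] [Algebra k K], ∀ p : MatPair K a b, p.1 * p.2 = 0 →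
        p.1.rank ≤ c → p.2.rank ≤ a - c → ∃ φ : D →ₐ[k] K, mapPair φ P = p := by
  obtain ⟨D, _, _, _, P, hP, h1, h2, h3⟩ := exists_generic_complex k hab hc
  obtain ⟨L, _, _, ψ, hψ⟩ := exists_injective_field k D
  exact ⟨D, _, ‹_›, _, P, L, _, _, ψ, hψ, hP, ((h3 _).1 ψ).1, ((h3 _).1 ψ).2,
    det_corner_map_ne_zero (ψ : D →+* L) hψ _ _ _ h1,
    det_corner_map_ne_zero (ψ : D →+* L) hψ _ _ _ h2, fun K _ _ => (h3 K).2⟩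

/-- Density of the stratum: a polynomial that vanishes on it vanishes at the generic complex `P`
over a field containing `D`, hence already in `D`, hence at every specialization of `P`. -/
theorem mem_component_iff {k K : Type u} [Field k] [Field K] [Algebra k K] {a b c : ℕ}
    (hab : a ≤ b) (hc : c ≤ a) (p : MatPair K a b) :
    p ∈ component k a b c K ↔ p ∈ circ K a b ∧ p.1.rank ≤ c ∧ p.2.rank ≤ a - c := by
  refine ⟨component_subset, fun ⟨hp, h1, h2⟩ f hf => ?_⟩
  obtain ⟨D, _, _, _, P, L, _, _, ψ, hψ, hP, r1, r2, c1, c2, hs⟩ :=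
    exists_generic_circ_field k hab hc
  obtain ⟨φ, rfl⟩ := hs K p hp h1 h2
  have h0 := hf L _ (mem_openStratum_of_corners hab hc (map_mem_circ (ψ : D →+* L) hP) r1 r2 c1 c2)
  have h0' : aeval (coords (mapPair ψ P)) f = 0 := h0
  rw [aeval_coords_mapPair] at h0' ⊢
  rw [hψ (h0'.trans (map_zero ψ).symm), map_zero]

/-- The ideal is the kernel of evaluation at one point with values in a field, the generic complex.
-/
theorem stratumIdeal_isPrime (k : Type u) [Field k] {a b c : ℕ} (hab : a ≤ b) (hc : c ≤ a) :
    (stratumIdeal k a b c).IsPrime := by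
  obtain ⟨D, _, _, _, P, L, _, _, ψ, hψ, hP, r1, r2, c1, c2, hs⟩ :=
    exists_generic_circ_field k hab hc
  have hgen := mem_openStratum_of_corners hab hc (map_mem_circ (ψ : D →+* L) hP) r1 r2 c1 c2
  have hker : stratumIdeal k a b c = RingHom.ker (aeval (R := k) (coords (mapPair ψ P))) := by
    refine le_antisymm (fun f hf => hf L _ hgen) fun f hf K _ _ p hp => ?_
    obtain ⟨φ, rfl⟩ := hs K p hp.1 hp.2.1.le hp.2.2.le
    rw [RingHom.mem_ker, aeval_coords_mapPair] at hf
    rw [aeval_coords_mapPair, hψ (hf.trans (map_zero ψ).symm), map_zero]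
  rw [hker]
  exact RingHom.ker_isPrime _

/-- The pair of `cornerOne` matrices for `c'` has ranks exactly `c'` and `a - c'`. The containment
of ideals puts it in `𝓛_c`, so `c' ≤ c` and `a - c' ≤ a - c`. -/
theorem stratumIdeal_le_iff (k : Type u) [Field k] {a b c c' : ℕ} (hab : a ≤ b) (hc : c ≤ a)
    (hc' : c' ≤ a) (h : stratumIdeal k a b c ≤ stratumIdeal k a b c') : c = c' := by
  have hmem := mem_openStratum_of_corners (K := k) hab hc' (cornerOne_mem_circ hab hc')
    (rank_cornerOne_le (hc'.trans hab)) (rank_cornerOne_le (Nat.sub_le a c'))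
    (by rw [corner_cornerOne]; simp) (by rw [corner_cornerOne]; simp)
  have h2 := component_subset (k := k) (c := c) fun f hf => h hf k _ hmem
  have h3 := hmem.2.1
  have h4 := hmem.2.2
  omega

/-- A prime over the ideal of `𝓛` has a generic point, which is a circular complex over a field.
With `c` the rank of its `X`, the inequality `rank X + rank Y ≤ a` puts it in `𝓛_c`, so the prime
contains the ideal of `𝓛_c`. The latter ideals are prime and mutually incomparable. -/
theorem minimalPrimes_circIdeal (k : Type u) [Field k] {a b : ℕ} (hab : a ≤ b) :
    (circIdeal k a b).minimalPrimes = stratumIdeal k a b '' Set.Iic a := by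
  have key : ∀ P : Ideal (MvPolynomial (CoordIdx a b) k), P.IsPrime → circIdeal k a b ≤ P →
      ∃ c ≤ a, stratumIdeal k a b c ≤ P := by
    intro P hP hle
    let A := MvPolynomial (CoordIdx a b) k ⧸ P
    let ψ : MvPolynomial (CoordIdx a b) k →ₐ[k] FractionRing A :=
      (IsScalarTower.toAlgHom k A (FractionRing A)).comp (Ideal.Quotient.mkₐ k P)
    have hψ : ∀ f, ψ f = 0 ↔ f ∈ P := by
      intro f
      rw [← Ideal.Quotient.eq_zero_iff_mem]
      exact map_eq_zero_iff _ (IsFractionRing.injective A (FractionRing A))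
    -- The tautological complex over the residue field of the prime `P`.
    let p : MatPair (FractionRing A) a b :=
      (Matrix.of fun i j => ψ (X (Sum.inl (i, j))), Matrix.of fun i j => ψ (X (Sum.inr (i, j))))
    have hp : ∀ f, aeval (coords p) f = ψ f := by
      intro f
      have : aeval (coords p) = ψ := by
        ext i
        rcases i with i | i <;> simp [p, coords]
      rw [this]
    have hpc : p ∈ circ _ a b :=
      (mem_circ_iff (k := k) p).2 fun f hf => by rw [hp]; exact (hψ f).2 (hle hf)
    have hr := Matrix.rank_add_rank_le_card_of_mul_eq_zero hpc.1
    rw [Fintype.card_fin] at hr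
    have hc : p.1.rank ≤ a := by omega
    refine ⟨p.1.rank, hc, fun f hf => ?_⟩
    have := (mem_component_iff (k := k) hab hc p).2 ⟨hpc, le_rfl, by omega⟩ f hf
    rw [hp] at this
    exact (hψ f).1 this
  ext P
  constructor
  · rintro ⟨⟨h1, h2⟩, h3⟩
    obtain ⟨c, hc, hle⟩ := key P h1 h2
    exact ⟨c, hc, le_antisymm hle
      (h3 ⟨stratumIdeal_isPrime k hab hc, circIdeal_le_stratumIdeal k a b c⟩ hle)⟩
  · rintro ⟨c, hc, rfl⟩
    refine ⟨⟨stratumIdeal_isPrime k hab hc, circIdeal_le_stratumIdeal k a b c⟩, fun Q hQ hle => ?_⟩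
    obtain ⟨c', hc', hle'⟩ := key Q hQ.1 hQ.2
    have := stratumIdeal_le_iff k hab hc' hc (hle'.trans hle)
    rwa [this] at hle'

theorem stratumIdeal_injOn (k : Type u) [Field k] {a b : ℕ} (hab : a ≤ b) :
    Set.InjOn (stratumIdeal k a b) (Set.Iic a) :=
  fun _ hc _ hc' h => stratumIdeal_le_iff k hab hc hc' h.le

/-- An element that vanishes in the residue fields of all primes is nilpotent. This is the device by
which identities over a reduced ring are checked over fields. -/
theorem eq_zero_of_forall_field {R : Type u} [CommRing R] [IsReduced R] {k : Type u} [Field k]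
    [Algebra k R] {x : R} (h : ∀ (K : Type u) [Field K] [Algebra k K] (φ : R →ₐ[k] K), φ x = 0) :
    x = 0 := by
  refine IsReduced.eq_zero x (nilpotent_iff_mem_prime.2 fun P hP => ?_)
  let A := R ⧸ P
  have := h (FractionRing A)
    ((IsScalarTower.toAlgHom k A (FractionRing A)).comp (Ideal.Quotient.mkₐ k P))
  rw [← Ideal.Quotient.eq_zero_iff_mem]
  exact (map_eq_zero_iff _ (IsFractionRing.injective A (FractionRing A))).1 this

theorem mem_component_iff_forall_field {k R : Type u} [Field k] [CommRing R] [Algebra k R]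
    [IsReduced R] {a b c : ℕ} (p : MatPair R a b) :
    p ∈ component k a b c R ↔ ∀ (K : Type u) [Field K] [Algebra k K] (φ : R →ₐ[k] K),
      mapPair φ p ∈ component k a b c K := by
  constructor
  · intro h K _ _ φ f hf
    rw [aeval_coords_mapPair, h f hf, map_zero]
  · intro h f hf
    refine eq_zero_of_forall_field (k := k) fun K _ _ φ => ?_
    rw [← aeval_coords_mapPair]
    exact h K φ f hf

theorem mem_circ_iff_forall_field {k R : Type u} [Field k] [CommRing R] [Algebra k R]
    [IsReduced R] {a b : ℕ} (p : MatPair R a b) :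
    p ∈ circ R a b ↔ ∀ (K : Type u) [Field K] [Algebra k K] (φ : R →ₐ[k] K),
      mapPair φ p ∈ circ K a b := by
  constructor
  · intro h K _ _ φ
    exact map_mem_circ (φ : R →+* K) h
  · intro h
    refine (mem_circ_iff (k := k) p).2 fun f hf => eq_zero_of_forall_field (k := k) fun K _ _ φ => ?_
    rw [← aeval_coords_mapPair]
    exact (mem_circ_iff (k := k) _).1 (h K φ) f hf

theorem mapPair_pairAct {R S : Type u} [CommRing R] [CommRing S] {a b : ℕ} (φ : R →+* S)
    (g : GL (Fin a) R) (h : GL (Fin b) R) (p : MatPair R a b) :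
    mapPair φ (pairAct g h p) =
      pairAct (Matrix.GeneralLinearGroup.map φ g) (Matrix.GeneralLinearGroup.map φ h)
        (mapPair φ p) := by
  have e1 : ((Matrix.GeneralLinearGroup.map φ g)⁻¹).1 = (g⁻¹).1.map φ := by
    rw [← Matrix.GeneralLinearGroup.map_inv]; rfl
  have e2 : ((Matrix.GeneralLinearGroup.map φ h)⁻¹).1 = (h⁻¹).1.map φ := by
    rw [← Matrix.GeneralLinearGroup.map_inv]; rfl
  simp only [mapPair, pairAct, Matrix.map_mul, e1, e2]
  rfl

theorem pairAct_mem_circ {R : Type u} [CommRing R] {a b : ℕ} (g : GL (Fin a) R) (h : GL (Fin b) R)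
    {p : MatPair R a b} (hp : p ∈ circ R a b) : pairAct g h p ∈ circ R a b := by
  have e1 : (g⁻¹).1 * g.1 = 1 := by rw [← Units.val_mul]; simp
  have e2 : (h⁻¹).1 * h.1 = 1 := by rw [← Units.val_mul]; simp
  constructor
  · simp only [pairAct]
    calc h.1 * p.1 * (g⁻¹).1 * (g.1 * p.2 * (h⁻¹).1)
        = h.1 * p.1 * ((g⁻¹).1 * g.1) * p.2 * (h⁻¹).1 := by simp only [Matrix.mul_assoc]
      _ = h.1 * (p.1 * p.2) * (h⁻¹).1 := by rw [e1]; simp [Matrix.mul_assoc]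
      _ = 0 := by rw [hp.1]; simp
  · simp only [pairAct]
    calc g.1 * p.2 * (h⁻¹).1 * (h.1 * p.1 * (g⁻¹).1)
        = g.1 * p.2 * ((h⁻¹).1 * h.1) * p.1 * (g⁻¹).1 := by simp only [Matrix.mul_assoc]
      _ = g.1 * (p.2 * p.1) * (g⁻¹).1 := by rw [e2]; simp [Matrix.mul_assoc]
      _ = 0 := by rw [hp.2]; simp

/-- Over fields membership is a matter of ranks, which do not grow under multiplication; reducedness
makes it enough to look at fields. -/
theorem pairAct_mem_component {k R : Type u} [Field k] [CommRing R] [Algebra k R] [IsReduced R]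
    {a b c : ℕ} (hab : a ≤ b) (hc : c ≤ a) (g : GL (Fin a) R) (h : GL (Fin b) R)
    {p : MatPair R a b} (hp : p ∈ component k a b c R) : pairAct g h p ∈ component k a b c R := by
  rw [mem_component_iff_forall_field] at hp ⊢
  intro K _ _ φ
  have e := mapPair_pairAct (φ : R →+* K) g h p
  have h1 := (mem_component_iff hab hc _).1 (hp K φ)
  rw [mem_component_iff hab hc]
  have e' : mapPair φ (pairAct g h p) = pairAct (Matrix.GeneralLinearGroup.map (φ : R →+* K) g)
    (Matrix.GeneralLinearGroup.map (φ : R →+* K) h) (mapPair φ p) := e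
  rw [e']
  exact ⟨pairAct_mem_circ _ _ h1.1,
    ((Matrix.rank_mul_le_left _ _).trans (Matrix.rank_mul_le_right _ _)).trans h1.2.1,
    ((Matrix.rank_mul_le_left _ _).trans (Matrix.rank_mul_le_right _ _)).trans h1.2.2⟩

end Components

/-! ### Coordinates, standard lattices and base change in the loop space -/

section Coordinates

variable {R : Type u} [CommRing R] {n : ℕ}

theorem exists_index (hn : 0 < n) (m : ℤ) : ∃ (q : ℤ) (i : Fin n), m = n * q + i + 1 := by
  have h0 : (0 : ℤ) < n := by exact_mod_cast hn
  refine ⟨(m - 1) / n, ⟨((m - 1) % n).toNat, ?_⟩, ?_⟩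
  · have := Int.emod_lt_of_pos (m - 1) h0
    have := Int.emod_nonneg (m - 1) h0.ne'
    omega
  · have h1 := Int.emod_nonneg (m - 1) h0.ne'
    have h2 := Int.mul_ediv_add_emod (m - 1) n
    simp only [Int.toNat_of_nonneg h1]
    omega

theorem dvd_index_iff (q : ℤ) (i j : Fin n) :
    (n : ℤ) ∣ n * q + i + 1 - ((j : ℤ) + 1) ↔ i = j := by
  constructor
  · rintro ⟨r, hr⟩
    have h1 : ((i : ℤ) - j) = n * (r - q) := by rw [mul_sub]; linarith
    have h2 : (n : ℤ) ∣ (i : ℤ) - j := ⟨_, h1⟩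
    have h3 := Int.eq_zero_of_abs_lt_dvd h2 (by rw [abs_lt]; constructor <;> omega)
    exact Fin.ext (by omega)
  · rintro rfl
    exact ⟨q, by ring⟩

theorem index_ediv (q : ℤ) (i : Fin n) : ((n : ℤ) * q + i + 1 - ((i : ℤ) + 1)) / n = q := by
  have h0 : (n : ℤ) ≠ 0 := by have := i.2; omega
  rw [show (n : ℤ) * q + i + 1 - ((i : ℤ) + 1) = n * q by ring, Int.mul_ediv_cancel_left _ h0]

theorem coordAt_index (q : ℤ) (i : Fin n) (v : LoopSpace R n) :
    coordAt (n * q + i + 1) v = (v i).coeff q := by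
  rw [coordAt, Finset.sum_eq_single i]
  · rw [if_pos ((dvd_index_iff q i i).2 rfl), index_ediv]
  · intro j _ hj
    rw [if_neg fun h => hj ((dvd_index_iff q i j).1 h).symm]
  · simp

/-- The coordinate at `e_m` as a linear map. -/
def coordLin (R : Type u) [CommRing R] (n : ℕ) (m : ℤ) : LoopSpace R n →ₗ[R] R where
  toFun := coordAt m
  map_add' v w := by
    simp only [coordAt, Pi.add_apply, HahnSeries.coeff_add, ← Finset.sum_add_distrib]
    exact Finset.sum_congr rfl fun i _ => by split_ifs <;> simp
  map_smul' r v := by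
    simp only [coordAt, Pi.smul_apply, HahnSeries.coeff_smul, RingHom.id_apply, smul_eq_mul,
      Finset.mul_sum]
    exact Finset.sum_congr rfl fun i _ => by split_ifs <;> simp

theorem coordAt_add (m : ℤ) (v w : LoopSpace R n) :
    coordAt m (v + w) = coordAt m v + coordAt m w := (coordLin R n m).map_add v w

theorem coordAt_sub (m : ℤ) (v w : LoopSpace R n) :
    coordAt m (v - w) = coordAt m v - coordAt m w := (coordLin R n m).map_sub v w

theorem coordAt_smul (m : ℤ) (r : R) (v : LoopSpace R n) :
    coordAt m (r • v) = r * coordAt m v := (coordLin R n m).map_smul r v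

theorem coordAt_zero (m : ℤ) : coordAt m (0 : LoopSpace R n) = 0 := (coordLin R n m).map_zero

theorem coordAt_sum {ι : Type*} (m : ℤ) (s : Finset ι) (f : ι → LoopSpace R n) :
    coordAt m (∑ i ∈ s, f i) = ∑ i ∈ s, coordAt m (f i) := map_sum (coordLin R n m) f s

theorem loopSpace_ext {v w : LoopSpace R n}
    (h : ∀ m, coordAt m v = coordAt m w) : v = w := by
  funext i
  ext q
  rw [← coordAt_index, ← coordAt_index, h]

theorem coordAt_e (hn : 0 < n) (m j : ℤ) : coordAt m (e R n j) = if m = j then 1 else 0 := by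
  obtain ⟨q, i, rfl⟩ := exists_index hn m
  obtain ⟨q', i', rfl⟩ := exists_index hn j
  rw [coordAt_index, e]
  by_cases h : i' = i
  · subst h
    rw [if_pos ((dvd_index_iff q' _ _).2 rfl), index_ediv, HahnSeries.coeff_single]
    have h0 : (n : ℤ) ≠ 0 := by omega
    congr 1
    simp only [add_left_inj, mul_eq_mul_left_iff, h0, or_false]
  · rw [if_neg fun hd => h ((dvd_index_iff _ _ _).1 hd), HahnSeries.coeff_zero, if_neg]
    intro heq
    apply h
    refine ((dvd_index_iff q i i').1 ?_).symm
    rw [heq]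
    exact ⟨q', by ring⟩

theorem coordAt_X_smul (hn : 0 < n) (m : ℤ) (v : LoopSpace R n) :
    coordAt m ((PowerSeries.X : R⟦X⟧) • v) = coordAt (m - n) v := by
  obtain ⟨q, i, rfl⟩ := exists_index hn m
  rw [show (n : ℤ) * q + i + 1 - n = n * (q - 1) + i + 1 by ring, coordAt_index, coordAt_index,
    Pi.smul_apply, Algebra.smul_def, LaurentSeries.coe_algebraMap, HahnSeries.ofPowerSeries_X,
    HahnSeries.coeff_single_mul, one_mul]

theorem coordAt_X_pow_smul (hn : 0 < n) (k : ℕ) (m : ℤ) (v : LoopSpace R n) :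
    coordAt m ((PowerSeries.X : R⟦X⟧) ^ k • v) = coordAt (m - n * k) v := by
  induction k generalizing m with
  | zero => simp
  | succ k ih =>
    rw [pow_succ', mul_smul, coordAt_X_smul hn, ih]
    congr 1
    push_cast
    ring

theorem exists_coordAt_eq_zero (v : LoopSpace R n) : ∃ j : ℤ, ∀ m < j, coordAt m v = 0 := by
  rcases Nat.eq_zero_or_pos n with rfl | hn
  · exact ⟨0, fun m _ => by simp [coordAt]⟩
  have h0 : (0 : ℤ) < n := by exact_mod_cast hn
  obtain ⟨q, hq⟩ : ∃ q : ℤ, ∀ i, q ≤ (v i).order := by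
    obtain ⟨q, hq⟩ := (Set.finite_range fun i => (v i).order).bddBelow
    exact ⟨q, fun i => hq ⟨i, rfl⟩⟩
  refine ⟨n * q, fun m hm => ?_⟩
  obtain ⟨p, i, rfl⟩ := exists_index hn m
  rw [coordAt_index]
  refine HahnSeries.coeff_eq_zero_of_lt_order (lt_of_lt_of_le ?_ (hq i))
  have : (n : ℤ) * p < n * q := by omega
  exact lt_of_mul_lt_mul_left this h0.le

theorem coeff_single_mul_ofPowerSeries_of_lt {q m : ℤ} (hm : m < q) (f : R⟦X⟧) :
    (HahnSeries.single q (1 : R) * HahnSeries.ofPowerSeries ℤ R f).coeff m = 0 := by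
  rw [HahnSeries.coeff_single_mul, PowerSeries.coeff_coe, if_pos (by omega), mul_zero]

theorem exists_eq_single_mul (x : R⸨X⸩) (q : ℤ) (h : ∀ m < q, x.coeff m = 0) :
    ∃ f : R⟦X⟧, x = HahnSeries.single q 1 * HahnSeries.ofPowerSeries ℤ R f := by
  refine ⟨PowerSeries.mk fun k => x.coeff (q + k), ?_⟩
  ext m
  rw [HahnSeries.coeff_single_mul, PowerSeries.coeff_coe, one_mul]
  split_ifs with hm
  · exact h m (by omega)
  · rw [PowerSeries.coeff_mk]
    congr 1
    omega

/-- The set of vectors whose coordinates before `j` vanish is stable under power series. -/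
theorem coordAt_smul_eq_zero (f : R⟦X⟧) {v : LoopSpace R n} {j : ℤ}
    (h : ∀ m < j, coordAt m v = 0) : ∀ m < j, coordAt m (f • v) = 0 := by
  rcases Nat.eq_zero_or_pos n with rfl | hn
  · intro m _; simp [coordAt]
  have h0 : (0 : ℤ) < n := by exact_mod_cast hn
  intro m hm
  obtain ⟨p, i, rfl⟩ := exists_index hn m
  rw [coordAt_index]
  obtain ⟨g, hg⟩ := exists_eq_single_mul (v i) (p + 1) (fun r hr => by
    rw [← coordAt_index]
    refine h _ (lt_of_le_of_lt ?_ hm)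
    have : (n : ℤ) * r ≤ n * p := mul_le_mul_of_nonneg_left (by omega) h0.le
    omega)
  rw [Pi.smul_apply, hg, Algebra.smul_def, LaurentSeries.coe_algebraMap, mul_left_comm, ← map_mul]
  exact coeff_single_mul_ofPowerSeries_of_lt (by omega) _

theorem e_index_smul (q : ℤ) (i : Fin n) (f : R⟦X⟧) :
    f • e R n (n * q + i + 1) =
      Pi.single i (HahnSeries.single q 1 * HahnSeries.ofPowerSeries ℤ R f) := by
  funext j
  rw [Pi.smul_apply, Algebra.smul_def, LaurentSeries.coe_algebraMap, e]
  by_cases h : i = j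
  · subst h
    rw [if_pos ((dvd_index_iff _ _ _).2 rfl), index_ediv, Pi.single_eq_same, mul_comm]
  · rw [if_neg fun hd => h ((dvd_index_iff _ _ _).1 hd), mul_zero, Pi.single_eq_of_ne (Ne.symm h)]

theorem mem_E (hn : 0 < n) {j : ℤ} {v : LoopSpace R n} :
    v ∈ E R n j ↔ ∀ m < j, coordAt m v = 0 := by
  have h0 : (0 : ℤ) < n := by exact_mod_cast hn
  constructor
  · intro h
    refine Submodule.span_induction ?_ ?_ ?_ ?_ h
    · rintro _ ⟨i, hi, rfl⟩ m hm
      rw [coordAt_e hn, if_neg (by have := hi.1; omega)]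
    · intro m _
      exact coordAt_zero m
    · intro x y _ _ hx hy m hm
      rw [coordAt_add, hx m hm, hy m hm, add_zero]
    · intro f x _ hx
      exact coordAt_smul_eq_zero f hx
  · intro h
    have hv : v = ∑ i, Pi.single i (v i) := (Finset.univ_sum_single v).symm
    rw [hv]
    refine Submodule.sum_mem _ fun i _ => ?_
    -- The unique index in `[j, j + n)` that belongs to the `i`-th entry.
    obtain ⟨q, hq1, hq2⟩ : ∃ q : ℤ, j ≤ n * q + i + 1 ∧ n * q + i + 1 < j + n := by
      refine ⟨-((i + 1 - j) / n), ?_⟩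
      have h1 := Int.emod_nonneg (i + 1 - j) h0.ne'
      have h2 := Int.emod_lt_of_pos (i + 1 - j) h0
      have h3 := Int.mul_ediv_add_emod (i + 1 - j) n
      rw [mul_neg]
      constructor <;> linarith
    obtain ⟨f, hf⟩ := exists_eq_single_mul (v i) q (fun r hr => by
      rw [← coordAt_index]
      refine h _ ?_
      have : (n : ℤ) * r ≤ n * (q - 1) := mul_le_mul_of_nonneg_left (by omega) h0.le
      linarith)
    rw [hf, ← e_index_smul]
    exact Submodule.smul_mem _ _ (Submodule.subset_span ⟨_, ⟨hq1, hq2⟩, rfl⟩)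

theorem e_mem_E (hn : 0 < n) {j m : ℤ} (h : j ≤ m) : e R n m ∈ E R n j :=
  (mem_E hn).2 fun i hi => by rw [coordAt_e hn, if_neg (by omega)]

theorem E_antitone (hn : 0 < n) {i j : ℤ} (h : i ≤ j) : E R n j ≤ E R n i :=
  fun _ hv => (mem_E hn).2 fun m hm => (mem_E hn).1 hv m (by omega)

/-- The part of `v` with indices in `[i, j)`. -/
noncomputable def segment (i j : ℤ) (v : LoopSpace R n) : LoopSpace R n :=
  ∑ m ∈ Finset.Ico i j, coordAt m v • e R n m

theorem coordAt_segment (hn : 0 < n) (i j m : ℤ) (v : LoopSpace R n) :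
    coordAt m (segment i j v) = if i ≤ m ∧ m < j then coordAt m v else 0 := by
  rw [segment, coordAt_sum]
  simp only [coordAt_smul, coordAt_e hn, mul_ite, mul_one, mul_zero, Finset.sum_ite_eq,
    Finset.mem_Ico]

theorem mem_E' (hn : 0 < n) {j : ℤ} {v : LoopSpace R n} :
    v ∈ E' R n j ↔ ∀ m ≥ j, coordAt m v = 0 := by
  constructor
  · intro h
    refine Submodule.span_induction ?_ ?_ ?_ ?_ h
    · rintro _ ⟨i, hi, rfl⟩ m hm
      have : i < j := hi
      rw [coordAt_e hn, if_neg (by omega)]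
    · intro m _
      exact coordAt_zero m
    · intro x y _ _ hx hy m hm
      rw [coordAt_add, hx m hm, hy m hm, add_zero]
    · intro f x _ hx m hm
      rw [coordAt_smul, hx m hm, mul_zero]
  · intro h
    obtain ⟨i, hi⟩ := exists_coordAt_eq_zero v
    have hv : v = segment i j v := loopSpace_ext fun m => by
      rw [coordAt_segment hn]
      split_ifs with hm
      · rfl
      · rcases lt_or_ge m i with h1 | h1
        · exact hi m h1
        · exact h m (by omega)
    rw [hv]
    exact Submodule.sum_mem _ fun m hm => Submodule.smul_mem _ _
      (Submodule.subset_span ⟨m, (Finset.mem_Ico.1 hm).2, rfl⟩)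

theorem X_smul_e (hn : 0 < n) (m : ℤ) : (PowerSeries.X : R⟦X⟧) • e R n m = e R n (m + n) :=
  loopSpace_ext fun j => by
    rw [coordAt_X_smul hn, coordAt_e hn, coordAt_e hn]
    congr 1
    simp only [eq_iff_iff]
    omega

theorem X_pow_smul_e (hn : 0 < n) (k : ℕ) (m : ℤ) :
    (PowerSeries.X : R⟦X⟧) ^ k • e R n m = e R n (m + n * k) :=
  loopSpace_ext fun j => by
    rw [coordAt_X_pow_smul hn, coordAt_e hn, coordAt_e hn]
    congr 1
    simp only [eq_iff_iff]
    omega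

theorem exists_X_smul_eq (hn : 0 < n) {j : ℤ} {v : LoopSpace R n} (hv : v ∈ E R n (j + n)) :
    ∃ w ∈ E R n j, (PowerSeries.X : R⟦X⟧) • w = v := by
  let w : LoopSpace R n := fun i => HahnSeries.single (-1) 1 * v i
  have hw : (PowerSeries.X : R⟦X⟧) • w = v := by
    funext i
    simp only [w]
    rw [Pi.smul_apply, Algebra.smul_def, LaurentSeries.coe_algebraMap, HahnSeries.ofPowerSeries_X,
      ← mul_assoc, HahnSeries.single_mul_single]
    simp
  refine ⟨w, (mem_E hn).2 fun m hm => ?_, hw⟩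
  have := coordAt_X_smul hn (m + n) w
  rw [hw, add_sub_cancel_right] at this
  rw [← this]
  exact (mem_E hn).1 hv _ (by omega)

/-- A power series acts on coordinates by finite sums. -/
theorem exists_smul_eq_sum (f : R⟦X⟧) (K : ℕ) (v : LoopSpace R n) :
    ∃ g : R⟦X⟧, f • v = ∑ k ∈ Finset.range K,
      PowerSeries.coeff k f • ((PowerSeries.X : R⟦X⟧) ^ k • v) +
        (PowerSeries.X : R⟦X⟧) ^ K • (g • v) := by
  refine ⟨PowerSeries.mk fun i => PowerSeries.coeff (i + K) f, ?_⟩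
  have hf : f = ∑ k ∈ Finset.range K, PowerSeries.coeff k f • (PowerSeries.X : R⟦X⟧) ^ k +
      (PowerSeries.X : R⟦X⟧) ^ K * PowerSeries.mk fun i => PowerSeries.coeff (i + K) f := by
    conv_lhs => rw [PowerSeries.eq_X_pow_mul_shift_add_trunc K f, add_comm]
    congr 1
    ext m
    rw [Polynomial.coeff_coe, PowerSeries.coeff_trunc, map_sum]
    simp [PowerSeries.coeff_X_pow]
  conv_lhs => rw [hf]
  rw [add_smul, mul_smul, Finset.sum_smul]
  simp only [smul_assoc]

/-- The coordinates with indices in `[j, j + l)`. -/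
noncomputable def window (R : Type u) [CommRing R] (n : ℕ) (j : ℤ) (l : ℕ) :
    LoopSpace R n →ₗ[R] (Fin l → R) :=
  LinearMap.pi fun i => coordLin R n (j + (i : ℕ))

theorem window_apply (j : ℤ) (l : ℕ) (v : LoopSpace R n) (i : Fin l) :
    window R n j l v i = coordAt (j + (i : ℕ)) v := rfl

theorem exists_window_eq (hn : 0 < n) (j : ℤ) (l : ℕ) (u : Fin l → R) :
    ∃ v ∈ E R n j, window R n j l v = u := by
  refine ⟨∑ i : Fin l, u i • e R n (j + (i : ℕ)), ?_, ?_⟩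
  · exact Submodule.sum_mem (Submodule.restrictScalars R (E R n j)) fun i _ =>
      Submodule.smul_mem _ _ (e_mem_E hn (by omega))
  · funext i
    rw [window_apply, coordAt_sum, Finset.sum_eq_single i]
    · rw [coordAt_smul, coordAt_e hn, if_pos rfl, mul_one]
    · intro i' _ hi'
      rw [coordAt_smul, coordAt_e hn, if_neg (fun h => hi' (Fin.ext (by omega))), mul_zero]
    · simp

theorem mem_E_of_window_eq_zero (hn : 0 < n) {j : ℤ} {l : ℕ} {v : LoopSpace R n}
    (hv : v ∈ E R n j) (h : window R n j l v = 0) : v ∈ E R n (j + l) :=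
  (mem_E hn).2 fun m hm => by
    rcases lt_or_ge m j with h1 | h1
    · exact (mem_E hn).1 hv m h1
    · obtain ⟨i, rfl⟩ : ∃ i : ℕ, m = j + i := ⟨(m - j).toNat, by omega⟩
      exact congrFun h (⟨i, by omega⟩ : Fin l)

/-- A lattice between `E_j` and `E_{j+l}` is determined by its window. -/
theorem mem_iff_window (hn : 0 < n) {j : ℤ} {l : ℕ} {Λ : Submodule R⟦X⟧ (LoopSpace R n)}
    (h1 : Λ ≤ E R n j) (h2 : E R n (j + l) ≤ Λ) (v : LoopSpace R n) :
    v ∈ Λ ↔ v ∈ E R n j ∧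
      window R n j l v ∈ (Λ.restrictScalars R).map (window R n j l) := by
  constructor
  · exact fun hv => ⟨h1 hv, v, hv, rfl⟩
  · rintro ⟨hv, w, hw, hwv⟩
    have h3 : v - w ∈ E R n (j + l) := mem_E_of_window_eq_zero hn
      (Submodule.sub_mem _ hv (h1 hw)) (by rw [map_sub, hwv, sub_self])
    have := Submodule.add_mem _ (h2 h3) hw
    rwa [sub_add_cancel] at this

/-- Base change of vectors. -/
def mapVec {S : Type u} [CommRing S] (φ : R →+* S) (v : LoopSpace R n) : LoopSpace S n :=
  fun i => (v i).map φ

theorem coordAt_mapVec {S : Type u} [CommRing S] (φ : R →+* S) (m : ℤ) (v : LoopSpace R n) :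
    coordAt m (mapVec φ v) = φ (coordAt m v) := by
  rcases Nat.eq_zero_or_pos n with rfl | hn
  · simp [coordAt]
  obtain ⟨q, i, rfl⟩ := exists_index hn m
  rw [coordAt_index, coordAt_index]
  rfl

theorem mapVec_mem_E {S : Type u} [CommRing S] (hn : 0 < n) (φ : R →+* S) {j : ℤ}
    {v : LoopSpace R n} (hv : v ∈ E R n j) : mapVec φ v ∈ E S n j :=
  (mem_E hn).2 fun m hm => by rw [coordAt_mapVec, (mem_E hn).1 hv m hm, map_zero]

theorem mapVec_e {S : Type u} [CommRing S] (hn : 0 < n) (φ : R →+* S) (j : ℤ) :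
    mapVec φ (e R n j) = e S n j :=
  loopSpace_ext fun m => by
    rw [coordAt_mapVec, coordAt_e hn, coordAt_e hn]
    split_ifs <;> simp

theorem mapVec_X_pow_smul {S : Type u} [CommRing S] (hn : 0 < n) (φ : R →+* S) (k : ℕ)
    (v : LoopSpace R n) : mapVec φ ((PowerSeries.X : R⟦X⟧) ^ k • v) =
      (PowerSeries.X : S⟦X⟧) ^ k • mapVec φ v :=
  loopSpace_ext fun m => by
    rw [coordAt_mapVec, coordAt_X_pow_smul hn, coordAt_X_pow_smul hn, coordAt_mapVec]

theorem mapVec_mem_pullLattice {S : Type u} [CommRing S] (φ : R →+* S)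
    {Λ : Submodule R⟦X⟧ (LoopSpace R n)} {v : LoopSpace R n} (hv : v ∈ Λ) :
    mapVec φ v ∈ pullLattice φ Λ :=
  Submodule.subset_span ⟨v, hv, rfl⟩

theorem pullLattice_le_E {S : Type u} [CommRing S] (hn : 0 < n) (φ : R →+* S) {j : ℤ}
    {Λ : Submodule R⟦X⟧ (LoopSpace R n)} (h : Λ ≤ E R n j) : pullLattice φ Λ ≤ E S n j := by
  refine Submodule.span_le.2 ?_
  rintro _ ⟨v, hv, rfl⟩
  exact mapVec_mem_E hn φ (h hv)

theorem E_le_pullLattice {S : Type u} [CommRing S] (hn : 0 < n) (φ : R →+* S) {j : ℤ}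
    {Λ : Submodule R⟦X⟧ (LoopSpace R n)} (h : E R n j ≤ Λ) : E S n j ≤ pullLattice φ Λ := by
  refine Submodule.span_le.2 ?_
  rintro _ ⟨i, hi, rfl⟩
  rw [← mapVec_e hn φ]
  exact mapVec_mem_pullLattice φ (h (e_mem_E hn hi.1))

/-- The span of the image of a submodule of a free module under a change of rings. -/
def spanMap {S : Type u} [CommRing S] (φ : R →+* S) {ι : Type*} (L : Submodule R (ι → R)) :
    Submodule S (ι → S) :=
  Submodule.span S ((fun v i => φ (v i)) '' (L : Set (ι → R)))

theorem window_mapVec {S : Type u} [CommRing S] (φ : R →+* S) (j : ℤ) (l : ℕ)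
    (v : LoopSpace R n) :
    window S n j l (mapVec φ v) = fun i => φ (window R n j l v i) :=
  funext fun i => by rw [window_apply, coordAt_mapVec, window_apply]

/-- A window sees only finitely many coordinates, so a power series acts on it through finitely many
powers of `t`. The `S[[t]]`-span of the lattice therefore has the same window as the `S`-span,
because the lattice is already stable under `t`. -/
theorem window_pullLattice {S : Type u} [CommRing S] (hn : 0 < n) (φ : R →+* S) (j : ℤ) (l : ℕ)
    (Λ : Submodule R⟦X⟧ (LoopSpace R n)) :
    ((pullLattice φ Λ).restrictScalars S).map (window S n j l) =
      spanMap φ ((Λ.restrictScalars R).map (window R n j l)) := by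
  apply le_antisymm
  · rintro _ ⟨x, hx, rfl⟩
    -- The window is only `S`-linear; quantifying over a multiplier `f` makes the induction pass
    -- through multiplication by power series.
    refine Submodule.span_induction
      (p := fun x _ => ∀ f : S⟦X⟧, window S n j l (f • x) ∈
        spanMap φ ((Λ.restrictScalars R).map (window R n j l))) ?_ ?_ ?_ ?_ hx 1 |> fun h => by
          rwa [one_smul] at h
    · rintro _ ⟨v, hv, rfl⟩ f
      change window S n j l (f • mapVec φ v) ∈ _
      obtain ⟨i, hi⟩ := exists_coordAt_eq_zero v
      -- The coordinates of `v` vanish before `i`, and each factor `t` shifts by `n ≥ 1`; this power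
      -- pushes `v` beyond the end `j + l` of the window.
      obtain ⟨g, hg⟩ := exists_smul_eq_sum f (j + l - i).toNat (mapVec φ v)
      rw [hg, map_add, map_sum]
      have h0 : window S n j l
          ((PowerSeries.X : S⟦X⟧) ^ (j + l - i).toNat • (g • mapVec φ v)) = 0 := by
        funext p
        rw [window_apply, coordAt_X_pow_smul hn]
        refine coordAt_smul_eq_zero g (j := i) (fun m hm => ?_) _ ?_
        · rw [coordAt_mapVec, hi m hm, map_zero]
        · have h1 : (1 : ℤ) ≤ n := by exact_mod_cast hn
          have h2 : (1 : ℤ) * ((j + l - i).toNat : ℤ) ≤ n * ((j + l - i).toNat : ℤ) :=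
            mul_le_mul_of_nonneg_right h1 (by omega)
          have := p.2
          omega
      rw [h0, add_zero]
      refine Submodule.sum_mem _ fun k _ => ?_
      rw [map_smul, ← mapVec_X_pow_smul hn, window_mapVec]
      exact Submodule.smul_mem _ _ (Submodule.subset_span
        ⟨_, ⟨_, Submodule.smul_mem Λ _ hv, rfl⟩, rfl⟩)
    · intro f
      rw [smul_zero, map_zero]
      exact Submodule.zero_mem _
    · intro x y _ _ h1 h2 f
      rw [smul_add, map_add]
      exact Submodule.add_mem _ (h1 f) (h2 f)
    · intro g x _ h1 f
      rw [smul_smul]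
      exact h1 _
  · refine Submodule.span_le.2 ?_
    rintro _ ⟨_, ⟨v, hv, rfl⟩, rfl⟩
    exact ⟨mapVec φ v, mapVec_mem_pullLattice φ hv, window_mapVec φ j l v⟩

theorem trunc_eq_window (R : Type u) [CommRing R] (a b : ℕ) :
    trunc R a b = window R (a + b) (a + 1) (a + 2 * b) := rfl

theorem mem_tMul {Λ : Submodule R⟦X⟧ (LoopSpace R n)} {v : LoopSpace R n} :
    v ∈ tMul Λ ↔ ∃ w ∈ Λ, (PowerSeries.X : R⟦X⟧) • w = v := Iff.rfl

end Coordinates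

/-! ### Relative codimension of subspaces, possibly of infinite dimension -/

section Cod

variable {K V W : Type*} [Field K] [AddCommGroup V] [Module K V] [AddCommGroup W] [Module K W]

/-- `J / (J ∩ L)` has dimension at most `r`. -/
def Cod (J L : Submodule K V) (r : ℕ) : Prop :=
  ∃ U : Submodule K V, FiniteDimensional K U ∧ Module.finrank K U ≤ r ∧ J ≤ L ⊔ U

theorem Cod.map (f : V →ₗ[K] W) {J L : Submodule K V} {r : ℕ} (h : Cod J L r) :
    Cod (J.map f) (L.map f) r := by
  obtain ⟨U, hU, hr, hJ⟩ := h
  refine ⟨U.map f, inferInstance, (Submodule.finrank_map_le f U).trans hr, ?_⟩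
  rw [← Submodule.map_sup]
  exact Submodule.map_mono hJ

theorem cod_of_span {J L : Submodule K V} {r : ℕ} (s : Finset V) (hs : s.card ≤ r)
    (h : J ≤ L ⊔ Submodule.span K (s : Set V)) : Cod J L r :=
  ⟨_, inferInstance, (finrank_span_finset_le_card s).trans hs, h⟩

theorem cod_zero_iff {J L : Submodule K V} : Cod J L 0 ↔ J ≤ L := by
  constructor
  · rintro ⟨U, hU, hr, hJ⟩
    have : U = ⊥ := Submodule.finrank_eq_zero.1 (by omega)
    rwa [this, sup_bot_eq] at hJ
  · exact fun h => ⟨⊥, inferInstance, by simp, by simpa using h⟩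

/-- The quotient of `J` by `J ∩ ker A` is `A(J)`, and a complement of the kernel in `J` serves as
the auxiliary subspace. This turns relative codimension into a rank, hence into minors. -/
theorem cod_ker_iff (A : V →ₗ[K] W) (J : Submodule K V) [FiniteDimensional K J] (r : ℕ) :
    Cod J (LinearMap.ker A) r ↔ Module.finrank K (J.map A) ≤ r := by
  constructor
  · rintro ⟨U, hU, hr, hJ⟩
    have h1 : J.map A ≤ U.map A := by
      refine (Submodule.map_mono hJ).trans ?_
      rw [Submodule.map_sup]
      refine sup_le ?_ le_rfl
      rintro _ ⟨x, hx, rfl⟩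
      rw [show A x = 0 from hx]
      exact Submodule.zero_mem _
    exact (Submodule.finrank_mono h1).trans ((Submodule.finrank_map_le A U).trans hr)
  · intro h
    let f := A.domRestrict J
    obtain ⟨C, hC⟩ := Submodule.exists_isCompl (LinearMap.ker f)
    have e1 : LinearMap.range f = J.map A := LinearMap.range_domRestrict J A
    have h1 := Submodule.finrank_add_eq_of_isCompl hC
    have h2 := LinearMap.finrank_range_add_finrank_ker f
    rw [e1] at h2
    refine ⟨C.map J.subtype, inferInstance, (Submodule.finrank_map_le _ _).trans (by omega), ?_⟩
    intro x hx
    have h3 : (⟨x, hx⟩ : J) ∈ LinearMap.ker f ⊔ C := by rw [hC.sup_eq_top]; trivial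
    obtain ⟨y, hy, z, hz, hyz⟩ := Submodule.mem_sup.1 h3
    have : x = (y : V) + z := (congrArg Subtype.val hyz).symm
    rw [this]
    exact Submodule.add_mem_sup hy ⟨z, hz, rfl⟩

end Cod

/-! ### Graphs of matrices in a space with integer coordinates -/

section CoordSystem

/-- Coordinates on a module, indexed by the integers. -/
structure CoordSystem (R M : Type*) [CommRing R] [AddCommGroup M] [Module R M] where
  /-- the coordinate functions -/
  coord : ℤ → M →ₗ[R] R
  /-- the indices of the basis vectors -/
  supp : Set ℤ
  /-- the basis vectors -/
  unit : ℤ → M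
  coord_unit : ∀ m ∈ supp, ∀ m', coord m' (unit m) = if m' = m then 1 else 0
  ext_zero : ∀ v, (∀ m, coord m v = 0) → v = 0
  exists_lower : ∀ v j, ∃ v', ∀ m, coord m v' = if m < j then coord m v else 0

variable {R M : Type*} [CommRing R] [AddCommGroup M] [Module R M] (C : CoordSystem R M)

/-- The vectors whose coordinates before `j` vanish. -/
def CoordSystem.above (j : ℤ) : Submodule R M where
  carrier := {v | ∀ m < j, C.coord m v = 0}
  add_mem' hv hw m hm := by rw [map_add, hv m hm, hw m hm, add_zero]
  zero_mem' m _ := map_zero _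
  smul_mem' r v hv m hm := by rw [map_smul, hv m hm, smul_zero]

/-- The graph of a matrix `Θ`: the coordinates with indices in `[j, j + s)` are determined by
the `r` following ones, and those before `j` vanish. -/
def CoordSystem.graph {s r : ℕ} (j : ℤ) (Θ : Matrix (Fin s) (Fin r) R) : Submodule R M where
  carrier := {v | (∀ m < j, C.coord m v = 0) ∧
    ∀ i : Fin s, C.coord (j + (i : ℕ)) v = ∑ l : Fin r, Θ i l * C.coord (j + s + (l : ℕ)) v}
  add_mem' hv hw := by
    refine ⟨fun m hm => by rw [map_add, hv.1 m hm, hw.1 m hm, add_zero], fun i => ?_⟩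
    rw [map_add, hv.2, hw.2, ← Finset.sum_add_distrib]
    exact Finset.sum_congr rfl fun l _ => by rw [map_add, mul_add]
  zero_mem' := by simp
  smul_mem' c v hv := by
    refine ⟨fun m hm => by rw [map_smul, hv.1 m hm, smul_zero], fun i => ?_⟩
    rw [map_smul, hv.2, smul_eq_mul, Finset.mul_sum]
    exact Finset.sum_congr rfl fun l _ => by rw [map_smul, smul_eq_mul]; ring

variable {C}

theorem CoordSystem.mem_graph {s r : ℕ} {j : ℤ} {Θ : Matrix (Fin s) (Fin r) R} {v : M} :
    v ∈ C.graph j Θ ↔ (∀ m < j, C.coord m v = 0) ∧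
      ∀ i : Fin s, C.coord (j + (i : ℕ)) v = ∑ l : Fin r, Θ i l * C.coord (j + s + (l : ℕ)) v :=
  Iff.rfl

theorem CoordSystem.ext {v w : M} (h : ∀ m, C.coord m v = C.coord m w) : v = w :=
  sub_eq_zero.1 (C.ext_zero _ fun m => by rw [map_sub, h, sub_self])

theorem CoordSystem.coord_sum_unit {κ : Type*} [Fintype κ] (f : κ → ℤ) (hf : ∀ i, f i ∈ C.supp)
    (x : κ → R) (m : ℤ) :
    C.coord m (∑ i, x i • C.unit (f i)) = ∑ i, if m = f i then x i else 0 := by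
  rw [map_sum]
  refine Finset.sum_congr rfl fun i _ => ?_
  rw [map_smul, C.coord_unit _ (hf i)]
  simp

/-- The vector with the coordinates `y` at `[j, j + s)` and `x` at `[j + s, j + s + r)`. -/
def CoordSystem.blockVec (C : CoordSystem R M) {s r : ℕ} (j : ℤ) (y : Fin s → R) (x : Fin r → R) :
    M :=
  ∑ i, y i • C.unit (j + (i : ℕ)) + ∑ l, x l • C.unit (j + s + (l : ℕ))

section blockVec

variable {s r : ℕ} {j : ℤ}

theorem CoordSystem.coord_blockVec (hs : ∀ m, j ≤ m → m < j + s + r → m ∈ C.supp)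
    (y : Fin s → R) (x : Fin r → R) (m : ℤ) : C.coord m (C.blockVec j y x) =
    (∑ i : Fin s, if m = j + (i : ℕ) then y i else 0) +
      ∑ l : Fin r, if m = j + s + (l : ℕ) then x l else 0 := by
  rw [CoordSystem.blockVec, map_add,
    C.coord_sum_unit (fun i : Fin s => j + (i : ℕ)) (fun i => hs _ (by omega) (by omega)),
    C.coord_sum_unit (fun l : Fin r => j + s + (l : ℕ)) (fun i => hs _ (by omega) (by omega))]

theorem CoordSystem.coord_blockVec_fst
    (hs : ∀ m, j ≤ m → m < j + s + r → m ∈ C.supp) (y : Fin s → R) (x : Fin r → R) (i : Fin s) :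
    C.coord (j + (i : ℕ)) (C.blockVec j y x) = y i := by
  rw [C.coord_blockVec hs, Finset.sum_eq_single i, Finset.sum_eq_zero, if_pos rfl, add_zero]
  · exact fun l _ => if_neg (by omega)
  · exact fun i' _ hi' => if_neg fun h => hi' (Fin.ext (by omega))
  · simp

theorem CoordSystem.coord_blockVec_snd
    (hs : ∀ m, j ≤ m → m < j + s + r → m ∈ C.supp) (y : Fin s → R) (x : Fin r → R) (l : Fin r) :
    C.coord (j + s + (l : ℕ)) (C.blockVec j y x) = x l := by
  rw [C.coord_blockVec hs, Finset.sum_eq_zero, Finset.sum_eq_single l, if_pos rfl, zero_add]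
  · exact fun i' _ hi' => if_neg fun h => hi' (Fin.ext (by omega))
  · simp
  · exact fun i _ => if_neg (by omega)

theorem CoordSystem.coord_blockVec_of_lt
    (hs : ∀ m, j ≤ m → m < j + s + r → m ∈ C.supp) (y : Fin s → R) (x : Fin r → R) {m : ℤ} (hm : m < j) :
    C.coord m (C.blockVec j y x) = 0 := by
  rw [C.coord_blockVec hs, Finset.sum_eq_zero, Finset.sum_eq_zero, add_zero]
  · exact fun l _ => if_neg (by omega)
  · exact fun i _ => if_neg (by omega)

theorem CoordSystem.coord_blockVec_of_ge
    (hs : ∀ m, j ≤ m → m < j + s + r → m ∈ C.supp) (y : Fin s → R) (x : Fin r → R) {m : ℤ} (hm : j + s + r ≤ m) :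
    C.coord m (C.blockVec j y x) = 0 := by
  rw [C.coord_blockVec hs, Finset.sum_eq_zero, Finset.sum_eq_zero, add_zero]
  · exact fun l _ => if_neg (by omega)
  · exact fun i _ => if_neg (by omega)

theorem CoordSystem.blockVec_mem_graph
    (hs : ∀ m, j ≤ m → m < j + s + r → m ∈ C.supp) (x : Fin r → R)
    (Θ : Matrix (Fin s) (Fin r) R) :
    C.blockVec j (Θ.mulVec x) x ∈ C.graph j Θ := by
  refine ⟨fun m hm => C.coord_blockVec_of_lt hs _ _ hm, fun i => ?_⟩
  rw [C.coord_blockVec_fst hs]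
  simp only [C.coord_blockVec_snd hs]
  rfl

end blockVec

/-- The columns of the matrix are read off from the vectors of the graph over the unit vectors. A
mere inclusion suffices; it is what comparing a translated coordinate flag with `Ψ(p)` provides. -/
theorem CoordSystem.graph_injective {s r : ℕ} {j : ℤ} {Θ Θ' : Matrix (Fin s) (Fin r) R}
    (hs : ∀ m, j ≤ m → m < j + s + r → m ∈ C.supp) (h : C.graph j Θ ≤ C.graph j Θ') : Θ = Θ' := by
  ext i l
  have h1 := (h (C.blockVec_mem_graph hs (Pi.single l 1) Θ)).2 i
  rw [C.coord_blockVec_fst hs] at h1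
  simp only [C.coord_blockVec_snd hs] at h1
  rw [Matrix.mulVec_single_one] at h1
  simpa [Pi.single_apply] using h1

theorem CoordSystem.ge_cases {j m : ℤ} {s : ℕ} (hm : j ≤ m) (hm' : m < j + s) :
    ∃ i : Fin s, m = j + (i : ℕ) :=
  ⟨⟨(m - j).toNat, by omega⟩, by simp; omega⟩

theorem CoordSystem.above_le_graph {s r : ℕ} {j : ℤ} (Θ : Matrix (Fin s) (Fin r) R) :
    C.above (j + s + r) ≤ C.graph j Θ := by
  intro v hv
  refine ⟨fun m hm => hv m (by omega), fun i => ?_⟩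
  rw [hv _ (by omega), Finset.sum_eq_zero]
  exact fun l _ => by rw [hv _ (by omega), mul_zero]

theorem CoordSystem.graph_le_above {s r : ℕ} {j : ℤ} (Θ : Matrix (Fin s) (Fin r) R) :
    C.graph j Θ ≤ C.above j := fun _ hv => hv.1

/-- A graph is transversal to the complement spanned by the coordinates before `j + s`: these are
determined by the later ones. -/
theorem CoordSystem.graph_lower_eq_zero {s r : ℕ} {j : ℤ} {Θ : Matrix (Fin s) (Fin r) R} {v : M}
    (hv : v ∈ C.graph j Θ) (h : ∀ m ≥ j + s, C.coord m v = 0) : v = 0 := by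
  refine C.ext_zero _ fun m => ?_
  rcases lt_or_ge m j with h1 | h1
  · exact hv.1 m h1
  rcases lt_or_ge m (j + s) with h2 | h2
  · obtain ⟨i, rfl⟩ := CoordSystem.ge_cases h1 h2
    rw [hv.2 i, Finset.sum_eq_zero]
    exact fun l _ => by rw [h _ (by omega), mul_zero]
  · exact h m h2

/-- A submodule between two steps of the filtration is a graph if it meets the complement of the
middle step trivially and projects onto the middle coordinates. -/
theorem CoordSystem.exists_eq_graph {s r : ℕ} {j : ℤ} {L : Submodule R M}
    (h1 : L ≤ C.above j) (h2 : C.above (j + s + r) ≤ L)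
    (h3 : ∀ v ∈ L, (∀ m ≥ j + s, C.coord m v = 0) → v = 0)
    (h4 : ∀ l : Fin r, ∃ v ∈ L, ∀ l' : Fin r, C.coord (j + s + (l' : ℕ)) v = if l' = l then 1 else 0) :
    ∃ Θ : Matrix (Fin s) (Fin r) R, L = C.graph j Θ := by
  choose w hw hw' using h4
  -- The columns of the matrix are the lower coordinates of lifts of the middle unit vectors.
  let Θ : Matrix (Fin s) (Fin r) R := Matrix.of fun i l => C.coord (j + (i : ℕ)) (w l)
  have hle : C.graph j Θ ≤ L := by
    intro v hv
    have : v - ∑ l : Fin r, C.coord (j + s + (l : ℕ)) v • w l ∈ C.above (j + s + r) := by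
      intro m hm
      rw [map_sub, map_sum]
      simp only [map_smul, smul_eq_mul]
      rcases lt_or_ge m j with h5 | h5
      · rw [hv.1 m h5, Finset.sum_eq_zero, sub_zero]
        exact fun l _ => by rw [h1 (hw l) m h5, mul_zero]
      rcases lt_or_ge m (j + s) with h6 | h6
      · obtain ⟨i, rfl⟩ := CoordSystem.ge_cases h5 h6
        rw [hv.2 i, sub_eq_zero]
        exact Finset.sum_congr rfl fun l _ => mul_comm _ _
      · obtain ⟨l, rfl⟩ := CoordSystem.ge_cases h6 hm
        simp [hw']
    have h6 : ∑ l : Fin r, C.coord (j + s + (l : ℕ)) v • w l ∈ L :=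
      L.sum_mem fun l _ => L.smul_mem _ (hw l)
    have h5 := L.add_mem (h2 this) h6
    rwa [sub_add_cancel] at h5
  refine ⟨Θ, le_antisymm (fun v hv => ?_) hle⟩
  -- Remove the middle coordinates with the `w l`, and the tail from `j + s + r` on, which lies in
  -- `L` by `h2`. What is left lies in `L` and has coordinates only before `j + s`, so `h3` makes it
  -- zero.
  let v' := v - ∑ l : Fin r, C.coord (j + s + (l : ℕ)) v • w l
  have hv' : v' ∈ L := L.sub_mem hv
    (L.sum_mem fun (l : Fin r) _ => L.smul_mem (C.coord (j + s + (l : ℕ)) v) (hw l))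
  obtain ⟨v₁, hv₁⟩ := C.exists_lower v' (j + s + r)
  have h5 : v' - v₁ ∈ C.above (j + s + r) := fun m hm => by
    rw [map_sub, hv₁, if_pos hm, sub_self]
  have h6 : v₁ = 0 := by
    have hv₁L : v₁ ∈ L := by
      have := L.sub_mem hv' (h2 h5)
      rwa [sub_sub_cancel] at this
    refine h3 _ hv₁L fun m hm => ?_
    rw [hv₁]
    split_ifs with h7
    · obtain ⟨l, rfl⟩ := CoordSystem.ge_cases hm h7
      simp [v', hw']
    · rfl
  rw [h6, sub_zero] at h5
  have h7 : ∑ l : Fin r, C.coord (j + s + (l : ℕ)) v • w l ∈ C.graph j Θ := by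
    refine Submodule.sum_mem _ fun l _ => Submodule.smul_mem _ _ ⟨h1 (hw l), fun i => ?_⟩
    simp [hw', Θ]
  have h8 := Submodule.add_mem _ (C.above_le_graph Θ h5) h7
  rwa [sub_add_cancel] at h8

end CoordSystem

/-! ### Recognizing graphs over a field by dimension -/

section CoordSystemField

variable {K M : Type*} [Field K] [AddCommGroup M] [Module K M] {C : CoordSystem K M}

/-- By transversality the `s` lower unit vectors stay independent modulo `L`, and the codimension
bound says that there is no room for more. So they span `above j` modulo `L`, and each middle unit
vector can be corrected by lower ones to lie in `L`. -/
theorem CoordSystem.exists_eq_graph_of_cod {s r : ℕ} {j : ℤ}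
    (hs : ∀ m, j ≤ m → m < j + s + r → m ∈ C.supp) {L : Submodule K M}
    (h2 : C.above (j + s + r) ≤ L) (h1 : Cod (C.above j) L s)
    (h3 : ∀ v ∈ L, (∀ m ≥ j + s, C.coord m v = 0) → v = 0) :
    ∃ Θ : Matrix (Fin s) (Fin r) K, L = C.graph j Θ := by
  have low : ∀ y : Fin s → K, ∀ m ≥ j + s, C.coord m (C.blockVec j y (0 : Fin r → K)) = 0 := by
    intro y m hm
    rcases lt_or_ge m (j + s + r) with h | h
    · obtain ⟨l, rfl⟩ := CoordSystem.ge_cases hm h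
      exact C.coord_blockVec_snd hs _ _ l
    · exact C.coord_blockVec_of_ge hs _ _ h
  obtain ⟨U, hU, hr, hJ⟩ := h1
  let f : (Fin s → K) →ₗ[K] M ⧸ L := L.mkQ ∘ₗ
    { toFun := fun y => C.blockVec j y (0 : Fin r → K)
      map_add' := fun y y' => by
        simp [CoordSystem.blockVec, add_smul, Finset.sum_add_distrib]
      map_smul' := fun c y => by
        simp [CoordSystem.blockVec, mul_smul, Finset.smul_sum] }
  have hf : ∀ y, f y = L.mkQ (C.blockVec j y (0 : Fin r → K)) := fun _ => rfl
  have hinj : Function.Injective f := by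
    rw [injective_iff_map_eq_zero]
    intro y hy
    rw [hf, Submodule.mkQ_apply, Submodule.Quotient.mk_eq_zero] at hy
    have h0 := h3 _ hy (low y)
    funext i
    have := C.coord_blockVec_fst hs y 0 i
    rw [h0, map_zero] at this
    exact this.symm
  have habove : ∀ y, C.blockVec j y (0 : Fin r → K) ∈ C.above j := fun y m hm =>
    C.coord_blockVec_of_lt hs _ _ hm
  have hmap : (C.above j).map L.mkQ ≤ U.map L.mkQ := by
    refine (Submodule.map_mono hJ).trans ?_
    rw [Submodule.map_sup, Submodule.mkQ_map_self, bot_sup_eq]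
  have hrange : LinearMap.range f ≤ (C.above j).map L.mkQ := by
    rintro _ ⟨y, rfl⟩
    exact ⟨_, habove y, rfl⟩
  have hfr : Module.finrank K (LinearMap.range f) = s := by
    rw [LinearMap.finrank_range_of_inj hinj, Module.finrank_fin_fun]
  have heq : LinearMap.range f = U.map L.mkQ :=
    Submodule.eq_of_le_of_finrank_le (hrange.trans hmap)
      (by rw [hfr]; exact (Submodule.finrank_map_le _ _).trans hr)
  have hdec : ∀ v ∈ C.above j, ∃ y : Fin s → K, v - C.blockVec j y (0 : Fin r → K) ∈ L := by
    intro v hv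
    have h5 : L.mkQ v ∈ LinearMap.range f := by rw [heq]; exact hmap ⟨v, hv, rfl⟩
    obtain ⟨y, hy⟩ := h5
    refine ⟨y, ?_⟩
    rw [← Submodule.Quotient.mk_eq_zero, Submodule.Quotient.mk_sub]
    exact sub_eq_zero.2 hy.symm
  refine C.exists_eq_graph ?_ h2 h3 fun l => ?_
  -- That `L` lies in `above j` is not assumed. Cut off the part of `v` before `j` and correct the
  -- rest by lower unit vectors; the difference to `v` lies in `L` and has coordinates only before
  -- `j + s`, so it vanishes.
  · intro v hv
    obtain ⟨v₁, hv₁⟩ := C.exists_lower v j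
    have h5 : v - v₁ ∈ C.above j := fun m hm => by rw [map_sub, hv₁, if_pos hm, sub_self]
    obtain ⟨y, hy⟩ := hdec _ h5
    have h6 := h3 _ (L.sub_mem hv hy) fun m hm => by
      rw [map_sub, map_sub, map_sub, hv₁, if_neg (by omega), low y m hm]
      ring
    rw [sub_eq_zero.1 h6]
    exact (C.above j).sub_mem h5 (habove y)
  · obtain ⟨y, hy⟩ := hdec (C.unit (j + s + (l : ℕ))) fun m hm => by
      rw [C.coord_unit _ (hs _ (by omega) (by omega)), if_neg (by omega)]
    refine ⟨_, hy, fun l' => ?_⟩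
    rw [map_sub, C.coord_unit _ (hs _ (by omega) (by omega)), low y _ (by omega), sub_zero]
    simp [Fin.ext_iff]

/-- The graph meets `above (j + s)` in the vectors whose middle coordinates are killed by `Θ`, so
the codimension of this intersection is the rank of `Θ`. -/
theorem CoordSystem.rank_le_of_cod {s r c : ℕ} {j : ℤ}
    (hs : ∀ m, j ≤ m → m < j + s + r → m ∈ C.supp) {Θ : Matrix (Fin s) (Fin r) K}
    (h : Cod (C.above (j + s)) (C.graph j Θ) c) : Θ.rank ≤ c := by
  -- The defect in the graph equation. It vanishes on the graph, and on vectors without lower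
  -- coordinates it is `Θ` applied to the middle ones.
  let ψ : M →ₗ[K] (Fin s → K) := LinearMap.pi fun i =>
    ∑ l, Θ i l • C.coord (j + s + (l : ℕ)) - C.coord (j + (i : ℕ))
  have hψ : ∀ v i, ψ v i = ∑ l, Θ i l * C.coord (j + s + (l : ℕ)) v - C.coord (j + (i : ℕ)) v := by
    intro v i
    simp [ψ, LinearMap.sum_apply]
  obtain ⟨U, hU, hr, hJ⟩ := h.map ψ
  have h0 : (C.graph j Θ).map ψ = ⊥ := by
    rw [eq_bot_iff]
    rintro _ ⟨v, hv, rfl⟩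
    rw [Submodule.mem_bot]
    funext i
    rw [hψ, hv.2 i, sub_self, Pi.zero_apply]
  rw [h0, bot_sup_eq] at hJ
  refine (Submodule.finrank_mono (le_trans ?_ hJ)).trans hr
  rintro _ ⟨x, rfl⟩
  refine ⟨C.blockVec j (0 : Fin s → K) x, fun m hm => ?_, ?_⟩
  · rcases lt_or_ge m j with h5 | h5
    · exact C.coord_blockVec_of_lt hs _ _ h5
    · obtain ⟨i, rfl⟩ := CoordSystem.ge_cases h5 hm
      exact C.coord_blockVec_fst hs _ _ i
  · funext i
    rw [hψ, C.coord_blockVec_fst hs]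
    simp only [C.coord_blockVec_snd hs, Pi.zero_apply, sub_zero]
    rfl

end CoordSystemField

/-! ### The finite and the infinite coordinate systems, and windows between them -/

section Systems

/-- The coordinates of `R^l`, indexed by the integers in `[m₀, m₀ + l)`. -/
def finCoords (R : Type u) [CommRing R] (m₀ : ℤ) (l : ℕ) : CoordSystem R (Fin l → R) where
  coord m := if h : m₀ ≤ m ∧ m < m₀ + l then LinearMap.proj ⟨(m - m₀).toNat, by omega⟩ else 0
  supp := Set.Ico m₀ (m₀ + l)
  unit m := fun i => if m = m₀ + (i : ℕ) then 1 else 0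
  coord_unit m hm m' := by
    have h1 := hm.1
    have h2 := hm.2
    by_cases h : m₀ ≤ m' ∧ m' < m₀ + l
    · rw [dif_pos h, LinearMap.proj_apply]
      congr 1
      simp only [eq_iff_iff]
      omega
    · rw [dif_neg h, LinearMap.zero_apply, if_neg (by omega)]
  ext_zero v h := by
    funext i
    have := h (m₀ + (i : ℕ))
    rw [dif_pos ⟨by omega, by omega⟩, LinearMap.proj_apply] at this
    simpa using this
  exists_lower v j := by
    refine ⟨fun i => if m₀ + (i : ℕ) < j then v i else 0, fun m => ?_⟩
    by_cases h : m₀ ≤ m ∧ m < m₀ + l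
    · rw [dif_pos h, LinearMap.proj_apply, LinearMap.proj_apply]
      congr 1
      simp only [eq_iff_iff]
      omega
    · rw [dif_neg h]
      simp

/-- The coordinates of the loop space. -/
noncomputable def loopCoords (R : Type u) [CommRing R] {n : ℕ} (hn : 0 < n) :
    CoordSystem R (LoopSpace R n) where
  coord m := coordLin R n m
  supp := Set.univ
  unit m := e R n m
  coord_unit m _ m' := coordAt_e hn m' m
  ext_zero v h := loopSpace_ext fun m => (h m).trans (coordAt_zero m).symm
  exists_lower v j := by
    obtain ⟨i, hi⟩ := exists_coordAt_eq_zero v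
    refine ⟨segment i j v, fun m => (coordAt_segment hn i j m v).trans ?_⟩
    by_cases h1 : i ≤ m
    · simp [h1, coordLin]
    · rw [if_neg (by tauto)]
      have : coordLin R n m v = 0 := hi m (by omega)
      rw [this, ite_self]

variable {R : Type u} [CommRing R]

theorem loopCoords_coord {n : ℕ} (hn : 0 < n) (m : ℤ) (v : LoopSpace R n) :
    (loopCoords R hn).coord m v = coordAt m v := rfl

theorem loopCoords_above {n : ℕ} (hn : 0 < n) (j : ℤ) :
    (loopCoords R hn).above j = (E R n j).restrictScalars R := by
  ext v
  exact (mem_E hn).symm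

theorem finCoords_coord_of_mem {m₀ : ℤ} {l : ℕ} (i : Fin l) (u : Fin l → R) :
    (finCoords R m₀ l).coord (m₀ + (i : ℕ)) u = u i := by
  simp only [finCoords]
  rw [dif_pos ⟨by omega, by omega⟩, LinearMap.proj_apply]
  congr 1
  ext
  simp

theorem finCoords_coord_of_notMem {m₀ m : ℤ} {l : ℕ} (h : ¬ (m₀ ≤ m ∧ m < m₀ + l))
    (u : Fin l → R) : (finCoords R m₀ l).coord m u = 0 := by
  simp only [finCoords]
  rw [dif_neg h, LinearMap.zero_apply]

theorem finCoords_coord_map {S : Type u} [CommRing S] (φ : R →+* S) (m₀ m : ℤ) {l : ℕ}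
    (u : Fin l → R) :
    (finCoords S m₀ l).coord m (fun i => φ (u i)) = φ ((finCoords R m₀ l).coord m u) := by
  by_cases h : m₀ ≤ m ∧ m < m₀ + l
  · obtain ⟨i, rfl⟩ := CoordSystem.ge_cases h.1 h.2
    rw [finCoords_coord_of_mem, finCoords_coord_of_mem]
  · rw [finCoords_coord_of_notMem h, finCoords_coord_of_notMem h, map_zero]

theorem finCoords_coord_window {n : ℕ} (j m : ℤ) (l : ℕ) (v : LoopSpace R n) :
    (finCoords R j l).coord m (window R n j l v) =
      if j ≤ m ∧ m < j + l then coordAt m v else 0 := by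
  split_ifs with h
  · obtain ⟨i, rfl⟩ := CoordSystem.ge_cases h.1 h.2
    rw [finCoords_coord_of_mem, window_apply]
  · exact finCoords_coord_of_notMem h _

/-- The window of a graph is a graph. -/
theorem window_map_graph {n : ℕ} (hn : 0 < n) {m₀ j : ℤ} {l s r : ℕ} (h1 : m₀ ≤ j)
    (h2 : j + s + r ≤ m₀ + l) (Θ : Matrix (Fin s) (Fin r) R) :
    ((loopCoords R hn).graph j Θ).map (window R n m₀ l) = (finCoords R m₀ l).graph j Θ := by
  have key : ∀ v : LoopSpace R n, (∀ m < m₀, coordAt m v = 0) →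
      (v ∈ (loopCoords R hn).graph j Θ ↔ window R n m₀ l v ∈ (finCoords R m₀ l).graph j Θ) := by
    intro v hv
    rw [CoordSystem.mem_graph, CoordSystem.mem_graph]
    refine and_congr ⟨fun h m hm => ?_, fun h m hm => ?_⟩ (forall_congr' fun i => ?_)
    · rw [finCoords_coord_window]
      split_ifs
      · exact h m hm
      · rfl
    · rcases lt_or_ge m m₀ with h3 | h3
      · exact hv m h3
      · have := h m hm
        rwa [finCoords_coord_window, if_pos ⟨h3, by omega⟩] at this
    · rw [finCoords_coord_window, if_pos ⟨by omega, by omega⟩, loopCoords_coord]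
      have : ∀ l' : Fin r, (finCoords R m₀ l).coord (j + s + (l' : ℕ)) (window R n m₀ l v) =
          (loopCoords R hn).coord (j + s + (l' : ℕ)) v := fun l' => by
        rw [finCoords_coord_window, if_pos ⟨by omega, by omega⟩, loopCoords_coord]
      simp only [this]
  apply le_antisymm
  · rintro _ ⟨v, hv, rfl⟩
    exact (key v fun m hm => hv.1 m (by omega)).1 hv
  · intro u hu
    obtain ⟨v, hv, rfl⟩ := exists_window_eq hn m₀ l u
    exact ⟨v, (key v ((mem_E hn).1 hv)).2 hu, rfl⟩

/-- A lattice is a graph if its window is one. -/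
theorem eq_graph_of_window {n : ℕ} (hn : 0 < n) {m₀ j : ℤ} {l s r : ℕ} (h1 : m₀ ≤ j)
    (h2 : j + s + r ≤ m₀ + l) {Θ : Matrix (Fin s) (Fin r) R}
    {Λ : Submodule R⟦X⟧ (LoopSpace R n)} (h3 : Λ ≤ E R n m₀) (h4 : E R n (m₀ + l) ≤ Λ)
    (h : (Λ.restrictScalars R).map (window R n m₀ l) = (finCoords R m₀ l).graph j Θ) :
    Λ.restrictScalars R = (loopCoords R hn).graph j Θ := by
  ext v
  rw [Submodule.restrictScalars_mem, mem_iff_window hn h3 h4, h, ← window_map_graph hn h1 h2]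
  constructor
  · rintro ⟨hv, w, hw, hwv⟩
    have hw' : w ∈ E R n m₀ := (mem_E hn).2 fun m hm => hw.1 m (by omega)
    have h5 := mem_E_of_window_eq_zero (l := l) hn (Submodule.sub_mem _ hv hw')
      (by rw [map_sub, hwv, sub_self])
    have h6 : v - w ∈ (loopCoords R hn).graph j Θ := by
      refine CoordSystem.above_le_graph Θ ?_
      rw [loopCoords_above]
      exact E_antitone hn h2 h5
    have := Submodule.add_mem _ h6 hw
    rwa [sub_add_cancel] at this
  · exact fun hv => ⟨(mem_E hn).2 fun m hm => hv.1 m (by omega), v, hv, rfl⟩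

theorem above_le_spanMap {S : Type u} [CommRing S] (φ : R →+* S) {m₀ J : ℤ} {l : ℕ}
    {L : Submodule R (Fin l → R)} (h : (finCoords R m₀ l).above J ≤ L) :
    (finCoords S m₀ l).above J ≤ spanMap φ L := by
  classical
  intro y hy
  rw [pi_eq_sum_univ' y]
  refine Submodule.sum_mem _ fun i _ => ?_
  by_cases hi : m₀ + (i : ℕ) < J
  · have : y i = 0 := by
      have := hy _ hi
      rwa [finCoords_coord_of_mem] at this
    rw [this, zero_smul]
    exact Submodule.zero_mem _
  · refine Submodule.smul_mem _ _ (Submodule.subset_span ⟨Pi.single i 1, h ?_, ?_⟩)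
    · intro m hm
      by_cases hm' : m₀ ≤ m ∧ m < m₀ + l
      · obtain ⟨i', rfl⟩ := CoordSystem.ge_cases hm'.1 hm'.2
        rw [finCoords_coord_of_mem, Pi.single_eq_of_ne]
        rintro rfl
        exact hi hm
      · exact finCoords_coord_of_notMem hm' _
    · funext i'
      by_cases h' : i' = i <;> simp [h']

/-- The base change satisfies the equations of the new graph and is itself a graph by
`CoordSystem.exists_eq_graph`; nested graphs of the same shape coincide. -/
theorem spanMap_graph {S : Type u} [CommRing S] (φ : R →+* S) {m₀ j : ℤ} {l s r : ℕ} (h1 : m₀ ≤ j)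
    (h2 : j + s + r ≤ m₀ + l) (Θ : Matrix (Fin s) (Fin r) R) :
    spanMap φ ((finCoords R m₀ l).graph j Θ) = (finCoords S m₀ l).graph j (Θ.map φ) := by
  have hle : spanMap φ ((finCoords R m₀ l).graph j Θ) ≤ (finCoords S m₀ l).graph j (Θ.map φ) := by
    refine Submodule.span_le.2 ?_
    rintro _ ⟨u, hu, rfl⟩
    refine ⟨fun m hm => ?_, fun i => ?_⟩
    · rw [finCoords_coord_map, hu.1 m hm, map_zero]
    · simp only [finCoords_coord_map, hu.2 i, map_sum, map_mul, Matrix.map_apply]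
  have hsR : ∀ m, j ≤ m → m < j + s + r → m ∈ (finCoords R m₀ l).supp :=
    fun m _ _ => ⟨by omega, by omega⟩
  have hsS : ∀ m, j ≤ m → m < j + s + r → m ∈ (finCoords S m₀ l).supp :=
    fun m _ _ => ⟨by omega, by omega⟩
  obtain ⟨Θ', hΘ'⟩ := CoordSystem.exists_eq_graph (C := finCoords S m₀ l) (s := s) (r := r) (j := j)
    (L := spanMap φ ((finCoords R m₀ l).graph j Θ)) (hle.trans (CoordSystem.graph_le_above _))
    (above_le_spanMap φ (CoordSystem.above_le_graph _))
    (fun v hv => CoordSystem.graph_lower_eq_zero (hle hv))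
    (fun p => ⟨_, Submodule.subset_span ⟨_, CoordSystem.blockVec_mem_graph hsR (Pi.single p 1) Θ, rfl⟩,
      fun p' => by
        rw [finCoords_coord_map, CoordSystem.coord_blockVec_snd hsR, Pi.single_apply]
        split_ifs <;> simp⟩)
  rw [hΘ'] at hle ⊢
  rw [CoordSystem.graph_injective hsS hle]

end Systems

/-! ### From fields to reduced rings -/

section Reduced

variable {k R : Type u} [Field k] [CommRing R] [Algebra k R]

/-- A submodule of `R^l` contains vectors with arbitrary coordinates in a set `J` if this holds for
its base changes to all fields. -/
theorem exists_mem_eq_of_forall_field {l : ℕ} (L : Submodule R (Fin l → R)) (J : Set (Fin l))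
    (h : ∀ (K : Type u) [Field K] [Algebra k K] (φ : R →ₐ[k] K) (y : Fin l → K),
      ∃ w ∈ spanMap (φ : R →+* K) L, ∀ i ∈ J, w i = y i) (u : Fin l → R) :
    ∃ w ∈ L, ∀ i ∈ J, w i = u i := by
  classical
  let N : Submodule R (Fin l → R) :=
    { carrier := {u | ∀ i ∈ J, u i = 0}
      add_mem' := fun hv hw i hi => by simp [hv i hi, hw i hi]
      zero_mem' := fun i _ => rfl
      smul_mem' := fun c v hv i hi => by simp [hv i hi] }
  suffices htop : L ⊔ N = ⊤ by
    have hu : u ∈ L ⊔ N := by rw [htop]; trivial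
    obtain ⟨w, hw, x, hx, rfl⟩ := Submodule.mem_sup.1 hu
    exact ⟨w, hw, fun i hi => by simp [hx i hi]⟩
  -- A Nakayama argument. If `L + N` is proper, it lies in a maximal submodule, whose quotient is a
  -- residue field `R/I`. The resulting functional `g` kills `L` and the coordinates outside `J`;
  -- its base change `G` must then vanish by the hypothesis for `R/I`, although `g` is onto.
  by_contra hne
  obtain ⟨Q, hQ, hle⟩ := (eq_top_or_exists_le_coatom (L ⊔ N)).resolve_left hne
  have hs : IsSimpleModule R ((Fin l → R) ⧸ Q) := isSimpleModule_iff_isCoatom.2 hQ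
  obtain ⟨I, hI, ⟨ψ⟩⟩ := isSimpleModule_iff_quot_maximal.1 hs
  let : Field (R ⧸ I) := Ideal.Quotient.field I
  let φ : R →ₐ[k] R ⧸ I := Ideal.Quotient.mkₐ k I
  let g : (Fin l → R) →ₗ[R] R ⧸ I := ψ.toLinearMap ∘ₗ Q.mkQ
  let G : (Fin l → R ⧸ I) →ₗ[R ⧸ I] R ⧸ I :=
    ∑ i, g (Pi.single i 1) • LinearMap.proj i
  have hG : ∀ y, G y = ∑ i, g (Pi.single i 1) * y i := fun y => by
    simp [G, LinearMap.sum_apply]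
  have hGφ : ∀ v : Fin l → R, G (fun i => φ (v i)) = g v := by
    intro v
    rw [hG]
    conv_rhs => rw [pi_eq_sum_univ' v, map_sum]
    refine Finset.sum_congr rfl fun i _ => ?_
    rw [map_smul, mul_comm]
    have h1 : (Pi.single i 1 : Fin l → R) = fun j => if i = j then 1 else 0 := by
      funext j
      simp [Pi.single_apply, eq_comm]
    rw [h1, Algebra.smul_def]
    rfl
  have hg0 : ∀ v ∈ L ⊔ N, g v = 0 := by
    intro v hv
    have : Q.mkQ v = 0 := (Submodule.Quotient.mk_eq_zero Q).2 (hle hv)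
    simp [g, this]
  have hGL : ∀ y ∈ spanMap (φ : R →+* R ⧸ I) L, G y = 0 := by
    intro y hy
    have : spanMap (φ : R →+* R ⧸ I) L ≤ LinearMap.ker G := by
      refine Submodule.span_le.2 ?_
      rintro _ ⟨v, hv, rfl⟩
      exact (hGφ v).trans (hg0 v (Submodule.mem_sup_left hv))
    exact this hy
  have hsingle : ∀ i, i ∉ J → g (Pi.single i 1) = 0 := fun i hi => by
    refine hg0 _ (Submodule.mem_sup_right fun i' hi' => ?_)
    rw [Pi.single_eq_of_ne]
    rintro rfl
    exact hi hi'
  have hG0 : ∀ y, G y = 0 := by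
    intro y
    obtain ⟨w, hw, hwy⟩ := h _ φ y
    rw [← hGL w hw, hG, hG]
    refine Finset.sum_congr rfl fun i _ => ?_
    by_cases hi : i ∈ J
    · rw [hwy i hi]
    · rw [hsingle i hi, zero_mul, zero_mul]
  obtain ⟨x, hx⟩ : ∃ x, g x = 1 := (ψ.surjective.comp Q.mkQ_surjective) 1
  rw [← hGφ, hG0] at hx
  exact zero_ne_one hx

/-- Over a reduced ring, a submodule of `R^l` is a graph if its base changes to fields are. -/
theorem exists_eq_graph_of_forall_field [IsReduced R] {m₀ j : ℤ} {l s r : ℕ} (h1 : m₀ ≤ j)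
    (h2 : j + s + r ≤ m₀ + l) (L : Submodule R (Fin l → R))
    (h : ∀ (K : Type u) [Field K] [Algebra k K] (φ : R →ₐ[k] K),
      ∃ Θ : Matrix (Fin s) (Fin r) K, spanMap (φ : R →+* K) L = (finCoords K m₀ l).graph j Θ) :
    ∃ Θ : Matrix (Fin s) (Fin r) R, L = (finCoords R m₀ l).graph j Θ := by
  have hsup : ∀ {S : Type u} [CommRing S] (m : ℤ), j ≤ m → m < j + s + r →
      m ∈ (finCoords S m₀ l).supp := fun m _ _ => ⟨by omega, by omega⟩
  have hmap : ∀ {K : Type u} [Field K] [Algebra k K] (φ : R →ₐ[k] K) {v : Fin l → R}, v ∈ L →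
      (fun i => φ (v i)) ∈ spanMap (φ : R →+* K) L :=
    fun φ v hv => Submodule.subset_span ⟨v, hv, rfl⟩
  have hcoord : ∀ {K : Type u} [Field K] [Algebra k K] (φ : R →ₐ[k] K) (m : ℤ) (v : Fin l → R),
      (finCoords K m₀ l).coord m (fun i => φ (v i)) = φ ((finCoords R m₀ l).coord m v) :=
    fun {K} _ _ φ m v => finCoords_coord_map (φ : R →+* K) m₀ m v
  -- The one existence statement: `L` projects onto all the coordinates from `j + s` on. What
  -- remains afterwards are equations, and these are tested over fields because `R` is reduced.
  have hupper : ∀ u : Fin l → R, ∃ w ∈ L, ∀ m ≥ j + s,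
      (finCoords R m₀ l).coord m w = (finCoords R m₀ l).coord m u := by
    intro u
    have hK : ∀ (K : Type u) [Field K] [Algebra k K] (φ : R →ₐ[k] K) (y : Fin l → K),
        ∃ w ∈ spanMap (φ : R →+* K) L, ∀ i ∈ {i : Fin l | j + s ≤ m₀ + (i : ℕ)}, w i = y i := by
      intro K _ _ φ y
      obtain ⟨Θ, hΘ⟩ := h K φ
      let C := finCoords K m₀ l
      obtain ⟨y₁, hy₁⟩ := C.exists_lower y (j + s + r)
      let b := C.blockVec j (Θ.mulVec fun p => C.coord (j + s + (p : ℕ)) y)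
        (fun p : Fin r => C.coord (j + s + (p : ℕ)) y)
      refine ⟨b + (y - y₁), ?_, fun i hi => ?_⟩
      · rw [hΘ]
        refine Submodule.add_mem _ (C.blockVec_mem_graph hsup _ Θ)
          (CoordSystem.above_le_graph _ fun m hm => ?_)
        rw [map_sub, hy₁, if_pos hm, sub_self]
      · have hi' : j + s ≤ m₀ + (i : ℕ) := hi
        rw [← finCoords_coord_of_mem (m₀ := m₀) i (b + (y - y₁)),
          ← finCoords_coord_of_mem (m₀ := m₀) i y]
        change C.coord _ _ = C.coord _ _
        rw [map_add, map_sub, hy₁]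
        split_ifs with hlt
        · obtain ⟨p, hp⟩ := CoordSystem.ge_cases hi' hlt
          rw [hp, C.coord_blockVec_snd hsup, sub_self, add_zero]
        · rw [C.coord_blockVec_of_ge hsup _ _ (by omega), sub_zero, zero_add]
    obtain ⟨w, hw, hwu⟩ := exists_mem_eq_of_forall_field (k := k) L
      {i | j + s ≤ m₀ + (i : ℕ)} hK u
    refine ⟨w, hw, fun m hm => ?_⟩
    by_cases hm' : m₀ ≤ m ∧ m < m₀ + l
    · obtain ⟨i, rfl⟩ := CoordSystem.ge_cases hm'.1 hm'.2
      rw [finCoords_coord_of_mem, finCoords_coord_of_mem]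
      exact hwu i hm
    · rw [finCoords_coord_of_notMem hm', finCoords_coord_of_notMem hm']
  refine CoordSystem.exists_eq_graph ?_ ?_ ?_ ?_
  · intro v hv m hm
    refine eq_zero_of_forall_field (k := k) fun K _ _ φ => ?_
    obtain ⟨Θ, hΘ⟩ := h K φ
    have h3 := hmap φ hv
    rw [hΘ] at h3
    rw [← hcoord]
    exact h3.1 m hm
  · intro v hv
    obtain ⟨w, hw, hwv⟩ := hupper v
    -- The vectors agree from `j + s` on by choice of `w`. Over every field the graph equation
    -- expresses the lower coordinates of `w` through middle ones that vanish, so `w` has no lower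
    -- coordinates either.
    have : w = v := by
      refine (finCoords R m₀ l).ext fun m => ?_
      rw [← sub_eq_zero]
      refine eq_zero_of_forall_field (k := k) fun K _ _ φ => ?_
      rw [map_sub, sub_eq_zero]
      obtain ⟨Θ, hΘ⟩ := h K φ
      have h3 := hmap φ hw
      rw [hΘ] at h3
      rcases lt_or_ge m (j + s) with h4 | h4
      · rw [hv m (by omega), map_zero, ← hcoord]
        rcases lt_or_ge m j with h5 | h5
        · exact h3.1 m h5
        · obtain ⟨i, rfl⟩ := CoordSystem.ge_cases h5 h4
          rw [h3.2 i, Finset.sum_eq_zero]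
          intro p _
          rw [hcoord, hwv _ (by omega), hv _ (by omega), map_zero, mul_zero]
      · rw [hwv m h4]
    rwa [← this]
  · intro v hv h0
    refine (finCoords R m₀ l).ext_zero _ fun m => ?_
    refine eq_zero_of_forall_field (k := k) fun K _ _ φ => ?_
    obtain ⟨Θ, hΘ⟩ := h K φ
    have h3 := hmap φ hv
    rw [hΘ] at h3
    rw [← hcoord, CoordSystem.graph_lower_eq_zero h3, map_zero]
    intro m hm
    rw [hcoord, h0 m hm, map_zero]
  · intro p
    obtain ⟨w, hw, hwu⟩ := hupper ((finCoords R m₀ l).unit (j + s + (p : ℕ)))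
    refine ⟨w, hw, fun p' => ?_⟩
    rw [hwu _ (by omega), (finCoords R m₀ l).coord_unit _ (hsup _ (by omega) (by omega))]
    simp [Fin.ext_iff]

end Reduced

/-! ### Bounds on relative codimension are closed conditions -/

section Closed

variable {k R : Type u} [Field k] [CommRing R] [Algebra k R]

/-- The submodule of the vectors supported in `J`. -/
def coordSpan (R : Type u) [CommRing R] {l : ℕ} (J : Set (Fin l)) : Submodule R (Fin l → R) :=
  Submodule.span R (Set.range fun i : J => Pi.single (i : Fin l) (1 : R))

theorem mem_coordSpan {l : ℕ} {J : Set (Fin l)} {u : Fin l → R} :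
    u ∈ coordSpan R J ↔ ∀ i ∉ J, u i = 0 := by
  constructor
  · intro h i hi
    refine Submodule.span_induction ?_ rfl ?_ ?_ h
    · rintro _ ⟨i', rfl⟩
      refine Pi.single_eq_of_ne ?_ _
      rintro rfl
      exact hi i'.2
    · intro x y _ _ hx hy
      simp [hx, hy]
    · intro c x _ hx
      simp [hx]
  · intro h
    rw [pi_eq_sum_univ' u]
    refine Submodule.sum_mem _ fun i _ => ?_
    by_cases hi : i ∈ J
    · refine Submodule.smul_mem _ _ (Submodule.subset_span ⟨⟨i, hi⟩, ?_⟩)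
      funext j
      simp [Pi.single_apply, eq_comm]
    · rw [h i hi, zero_smul]
      exact Submodule.zero_mem _

theorem finCoords_above_eq_coordSpan (m₀ J : ℤ) (l : ℕ) :
    (finCoords R m₀ l).above J = coordSpan R {i : Fin l | J ≤ m₀ + (i : ℕ)} := by
  ext u
  rw [mem_coordSpan]
  constructor
  · intro h i hi
    have hi' : m₀ + (i : ℕ) < J := not_le.1 hi
    have := h _ hi'
    rwa [finCoords_coord_of_mem] at this
  · intro h m hm
    by_cases hm' : m₀ ≤ m ∧ m < m₀ + l
    · obtain ⟨i, rfl⟩ := CoordSystem.ge_cases hm'.1 hm'.2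
      rw [finCoords_coord_of_mem]
      exact h i (not_le.2 hm)
    · exact finCoords_coord_of_notMem hm' u

/-- The locus where a direct summand of `R^l` has small relative codimension in a coordinate
subspace is closed. -/
theorem exists_ideal_cod {l : ℕ} (L : Submodule R (Fin l → R))
    (hL : Module.Projective R ((Fin l → R) ⧸ L)) (J : Set (Fin l)) (d : ℕ) :
    ∃ I : Ideal R, ∀ (K : Type u) [Field K] [Algebra k K] (φ : R →ₐ[k] K),
      Cod (coordSpan K J) (spanMap (φ : R →+* K) L) d ↔ ∀ f ∈ I, φ f = 0 := by
  classical
  -- Projectivity of the quotient yields a projector `p` with kernel `L`. Its matrix stays a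
  -- projector with the right kernel after base change, so the condition becomes a bound on the rank
  -- of the columns in `J`.
  obtain ⟨s, hs⟩ := Module.projective_lifting_property L.mkQ LinearMap.id L.mkQ_surjective
  let p : (Fin l → R) →ₗ[R] (Fin l → R) := s ∘ₗ L.mkQ
  have hp0 : ∀ v, p v = 0 ↔ v ∈ L := by
    intro v
    constructor
    · intro h
      have := congrArg L.mkQ h
      rw [map_zero] at this
      have h2 : L.mkQ (s (L.mkQ v)) = L.mkQ v := LinearMap.congr_fun hs (L.mkQ v)
      exact (Submodule.Quotient.mk_eq_zero L).1 (h2.symm.trans this)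
    · intro h
      have : L.mkQ v = 0 := (Submodule.Quotient.mk_eq_zero L).2 h
      simp [p, this]
  have hpL : ∀ v, v - p v ∈ L := by
    intro v
    rw [← hp0, map_sub, sub_eq_zero]
    have h2 : L.mkQ (s (L.mkQ v)) = L.mkQ v := LinearMap.congr_fun hs (L.mkQ v)
    exact (congrArg s h2).symm
  let P := LinearMap.toMatrix' p
  have hP : ∀ v, P.mulVec v = p v := LinearMap.toMatrix'_mulVec p
  let I : Ideal R := Ideal.span (Set.range fun rs : (Fin (d + 1) → Fin l) × (Fin (d + 1) → J) =>
    (P.submatrix rs.1 fun i => (rs.2 i : Fin l)).det)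
  refine ⟨I, fun K _ _ φ => ?_⟩
  let Q : Matrix (Fin l) (Fin l) K := P.map φ
  have hQ : ∀ v : Fin l → R, Q.mulVec (fun i => φ (v i)) = fun i => φ (p v i) := by
    intro v
    funext i
    rw [← hP]
    simp [Q, Matrix.mulVec, dotProduct, map_sum]
  have hker : spanMap (φ : R →+* K) L = LinearMap.ker Q.mulVecLin := by
    apply le_antisymm
    · refine Submodule.span_le.2 ?_
      rintro _ ⟨v, hv, rfl⟩
      have := hQ v
      rw [(hp0 v).2 hv] at this
      refine this.trans ?_
      funext i
      simp
    · intro y hy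
      have hy0 : Q.mulVec y = 0 := hy
      -- A vector killed by the projector is the combination of the vectors `e_i - p e_i`, which
      -- come from `L`.
      have h1 : y = ∑ i, y i • fun j => φ ((Pi.single i 1 - p (Pi.single i 1) : Fin l → R) j) := by
        have h2 : ∀ i, (fun j => φ ((Pi.single i 1 - p (Pi.single i 1) : Fin l → R) j)) =
            (Pi.single i 1 : Fin l → K) - Q.mulVec (Pi.single i 1) := by
          intro i
          have h3 : (Pi.single i 1 : Fin l → K) = fun j => φ ((Pi.single i 1 : Fin l → R) j) := by
            funext j
            by_cases hj : j = i <;> simp [hj]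
          rw [h3, hQ]
          funext j
          simp
        simp only [h2, smul_sub, Finset.sum_sub_distrib, ← Matrix.mulVec_smul]
        rw [← Matrix.mulVec_sum]
        have h4 : ∑ i, y i • (Pi.single i 1 : Fin l → K) = y := by
          conv_rhs => rw [pi_eq_sum_univ' y]
        rw [h4, hy0, sub_zero]
      rw [h1]
      exact Submodule.sum_mem _ fun i _ => Submodule.smul_mem _ _
        (Submodule.subset_span ⟨_, hpL _, rfl⟩)
  have hmap : (coordSpan K J).map Q.mulVecLin =
      LinearMap.range (Q.submatrix id (fun i : J => (i : Fin l))).mulVecLin := by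
    rw [coordSpan, Submodule.map_span, Matrix.range_mulVecLin, ← Set.range_comp]
    congr 1
    congr 1
    funext i
    simp only [Function.comp_apply, Matrix.mulVecLin_apply, Matrix.mulVec_single_one]
    rfl
  have hrank : Module.finrank K ((coordSpan K J).map Q.mulVecLin) =
      (Q.submatrix id (fun i : J => (i : Fin l))).rank := by
    rw [hmap]
    rfl
  rw [hker, cod_ker_iff, hrank, rank_le_iff_minors]
  have hdet : ∀ (r : Fin (d + 1) → Fin l) (c : Fin (d + 1) → J),
      ((Q.submatrix id (fun i : J => (i : Fin l))).submatrix r c).det =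
        φ (P.submatrix r fun i => (c i : Fin l)).det := by
    intro r c
    rw [AlgHom.map_det]
    rfl
  constructor
  · intro h f hf
    have : I ≤ RingHom.ker φ := by
      refine Ideal.span_le.2 ?_
      rintro _ ⟨⟨r, c⟩, rfl⟩
      exact (hdet r c).symm.trans (h r c)
    exact this hf
  · intro h r c
    rw [hdet]
    exact h _ (Ideal.subset_span ⟨(r, c), rfl⟩)

end Closed

/-! ### The matrix of Ψ and the two graphs -/

section Coefficients

variable {R : Type u} [CommRing R] {a b : ℕ}

/-- The coefficient of `t^q` in the first `a` entries. -/
def fstCoeff (R : Type u) [CommRing R] (a b : ℕ) (q : ℤ) :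
    LoopSpace R (a + b) →ₗ[R] (Fin a → R) where
  toFun v i := (v (Fin.castAdd b i)).coeff q
  map_add' _ _ := rfl
  map_smul' _ _ := rfl

/-- The coefficient of `t^q` in the last `b` entries. -/
def sndCoeff (R : Type u) [CommRing R] (a b : ℕ) (q : ℤ) :
    LoopSpace R (a + b) →ₗ[R] (Fin b → R) where
  toFun v i := (v (Fin.natAdd a i)).coeff q
  map_add' _ _ := rfl
  map_smul' _ _ := rfl

theorem fstCoeff_apply (q : ℤ) (v : LoopSpace R (a + b)) (i : Fin a) :
    fstCoeff R a b q v i = (v (Fin.castAdd b i)).coeff q := rfl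

theorem sndCoeff_apply (q : ℤ) (v : LoopSpace R (a + b)) (i : Fin b) :
    sndCoeff R a b q v i = (v (Fin.natAdd a i)).coeff q := rfl

theorem ext_coeff {v w : LoopSpace R (a + b)} (h1 : ∀ q, fstCoeff R a b q v = fstCoeff R a b q w)
    (h2 : ∀ q, sndCoeff R a b q v = sndCoeff R a b q w) : v = w := by
  funext i
  refine Fin.addCases (fun i => ?_) (fun i => ?_) i <;> ext q
  · exact congrFun (h1 q) i
  · exact congrFun (h2 q) i

theorem fstCoeff_eq_coordAt (q : ℤ) (v : LoopSpace R (a + b)) (i : Fin a) :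
    fstCoeff R a b q v i = coordAt (((a + b : ℕ) : ℤ) * q + i + 1) v :=
  (coordAt_index q (Fin.castAdd b i) v).symm

theorem sndCoeff_eq_coordAt (q : ℤ) (v : LoopSpace R (a + b)) (i : Fin b) :
    sndCoeff R a b q v i = coordAt (((a + b : ℕ) : ℤ) * q + a + i + 1) v := by
  rw [sndCoeff_apply, ← coordAt_index q (Fin.natAdd a i) v, Fin.val_natAdd]
  congr 1
  push_cast
  ring

theorem forall_coordAt_iff (hn : 0 < a + b) (P : ℤ → R → Prop) (v : LoopSpace R (a + b)) :
    (∀ m, P m (coordAt m v)) ↔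
      (∀ q (i : Fin a), P (((a + b : ℕ) : ℤ) * q + i + 1) (fstCoeff R a b q v i)) ∧
      ∀ q (i : Fin b), P (((a + b : ℕ) : ℤ) * q + a + i + 1) (sndCoeff R a b q v i) := by
  constructor
  · intro h
    exact ⟨fun q i => by rw [fstCoeff_eq_coordAt]; exact h _,
      fun q i => by rw [sndCoeff_eq_coordAt]; exact h _⟩
  · rintro ⟨h1, h2⟩ m
    obtain ⟨q, i, rfl⟩ := exists_index hn m
    refine Fin.addCases (fun i => ?_) (fun i => ?_) i
    · have := h1 q i
      rw [fstCoeff_eq_coordAt] at this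
      exact this
    · have := h2 q i
      rw [sndCoeff_eq_coordAt] at this
      rw [Fin.val_natAdd]
      convert this using 2 <;> push_cast <;> ring

theorem forall_lt_first_iff (hn : 0 < a + b) (q₀ : ℤ) (v : LoopSpace R (a + b)) :
    (∀ m < ((a + b : ℕ) : ℤ) * q₀ + 1, coordAt m v = 0) ↔
      (∀ q < q₀, fstCoeff R a b q v = 0) ∧ ∀ q < q₀, sndCoeff R a b q v = 0 := by
  have h0 : (0 : ℤ) < ((a + b : ℕ) : ℤ) := by exact_mod_cast hn
  rw [forall_coordAt_iff hn (fun m x => m < ((a + b : ℕ) : ℤ) * q₀ + 1 → x = 0)]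
  refine and_congr ⟨fun h q hq => funext fun i => h q i ?_, fun h q i hlt => ?_⟩
    ⟨fun h q hq => funext fun i => h q i ?_, fun h q i hlt => ?_⟩
  · have : ((a + b : ℕ) : ℤ) * (q + 1) ≤ ((a + b : ℕ) : ℤ) * q₀ :=
      mul_le_mul_of_nonneg_left hq h0.le
    rw [mul_add, mul_one] at this
    push_cast at this ⊢
    omega
  · refine congrFun (h q ?_) i
    by_contra hge
    have : ((a + b : ℕ) : ℤ) * q₀ ≤ ((a + b : ℕ) : ℤ) * q :=
      mul_le_mul_of_nonneg_left (not_lt.1 hge) h0.le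
    omega
  · have : ((a + b : ℕ) : ℤ) * (q + 1) ≤ ((a + b : ℕ) : ℤ) * q₀ :=
      mul_le_mul_of_nonneg_left hq h0.le
    rw [mul_add, mul_one] at this
    push_cast at this ⊢
    omega
  · refine congrFun (h q ?_) i
    by_contra hge
    have : ((a + b : ℕ) : ℤ) * q₀ ≤ ((a + b : ℕ) : ℤ) * q :=
      mul_le_mul_of_nonneg_left (not_lt.1 hge) h0.le
    omega

theorem forall_lt_second_iff (hn : 0 < a + b) (q₀ : ℤ) (v : LoopSpace R (a + b)) :
    (∀ m < ((a + b : ℕ) : ℤ) * q₀ + a + 1, coordAt m v = 0) ↔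
      (∀ q ≤ q₀, fstCoeff R a b q v = 0) ∧ ∀ q < q₀, sndCoeff R a b q v = 0 := by
  have h0 : (0 : ℤ) < ((a + b : ℕ) : ℤ) := by exact_mod_cast hn
  rw [forall_coordAt_iff hn (fun m x => m < ((a + b : ℕ) : ℤ) * q₀ + a + 1 → x = 0)]
  refine and_congr ⟨fun h q hq => funext fun i => h q i ?_, fun h q i hlt => ?_⟩
    ⟨fun h q hq => funext fun i => h q i ?_, fun h q i hlt => ?_⟩
  · have : ((a + b : ℕ) : ℤ) * q ≤ ((a + b : ℕ) : ℤ) * q₀ :=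
      mul_le_mul_of_nonneg_left hq h0.le
    omega
  · refine congrFun (h q ?_) i
    by_contra hge
    have : ((a + b : ℕ) : ℤ) * (q₀ + 1) ≤ ((a + b : ℕ) : ℤ) * q :=
      mul_le_mul_of_nonneg_left (not_le.1 hge) h0.le
    rw [mul_add, mul_one] at this
    push_cast at this hlt
    omega
  · have : ((a + b : ℕ) : ℤ) * (q + 1) ≤ ((a + b : ℕ) : ℤ) * q₀ :=
      mul_le_mul_of_nonneg_left hq h0.le
    rw [mul_add, mul_one] at this
    push_cast at this ⊢
    omega
  · refine congrFun (h q ?_) i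
    by_contra hge
    have : ((a + b : ℕ) : ℤ) * q₀ ≤ ((a + b : ℕ) : ℤ) * q :=
      mul_le_mul_of_nonneg_left (not_lt.1 hge) h0.le
    omega

theorem mem_E_first (hn : 0 < a + b) (q₀ : ℤ) {j : ℤ} (hj : j = ((a + b : ℕ) : ℤ) * q₀ + 1)
    {v : LoopSpace R (a + b)} : v ∈ E R (a + b) j ↔
      (∀ q < q₀, fstCoeff R a b q v = 0) ∧ ∀ q < q₀, sndCoeff R a b q v = 0 := by
  rw [mem_E hn, hj, forall_lt_first_iff hn]

theorem mem_E_second (hn : 0 < a + b) (q₀ : ℤ) {j : ℤ} (hj : j = ((a + b : ℕ) : ℤ) * q₀ + a + 1)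
    {v : LoopSpace R (a + b)} : v ∈ E R (a + b) j ↔
      (∀ q ≤ q₀, fstCoeff R a b q v = 0) ∧ ∀ q < q₀, sndCoeff R a b q v = 0 := by
  rw [mem_E hn, hj, forall_lt_second_iff hn]

/-- The indices `a+1, …, a+b` are the coefficients of `t^0` in the last `b` entries, and `a+b+1, …,
2a+b` those of `t^1` in the first `a` entries. -/
theorem mem_graph_fst (hn : 0 < a + b) (X : Matrix (Fin b) (Fin a) R) {v : LoopSpace R (a + b)} :
    v ∈ (loopCoords R hn).graph (a + 1) X ↔ (∀ q ≤ 0, fstCoeff R a b q v = 0) ∧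
      (∀ q < 0, sndCoeff R a b q v = 0) ∧
      sndCoeff R a b 0 v = X.mulVec (fstCoeff R a b 1 v) := by
  rw [CoordSystem.mem_graph, ← and_assoc]
  refine and_congr ?_ ?_
  · rw [← forall_lt_second_iff hn 0]
    simp only [mul_zero, zero_add]
    rfl
  · rw [funext_iff]
    refine forall_congr' fun i => ?_
    simp only [loopCoords_coord, Matrix.mulVec, dotProduct, fstCoeff_eq_coordAt,
      sndCoeff_eq_coordAt]
    have h1 : (a : ℤ) + 1 + (i : ℕ) = ((a + b : ℕ) : ℤ) * 0 + a + (i : ℕ) + 1 := by ring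
    have h2 : ∀ l : Fin a, (a : ℤ) + 1 + b + (l : ℕ) = ((a + b : ℕ) : ℤ) * 1 + (l : ℕ) + 1 :=
      fun l => by push_cast; ring
    rw [h1]
    simp only [h2]

theorem mem_graph_snd (hn : 0 < a + b) (Y : Matrix (Fin a) (Fin b) R) {v : LoopSpace R (a + b)} :
    v ∈ (loopCoords R hn).graph (a + b + 1) Y ↔ (∀ q ≤ 0, fstCoeff R a b q v = 0) ∧
      (∀ q ≤ 0, sndCoeff R a b q v = 0) ∧
      fstCoeff R a b 1 v = Y.mulVec (sndCoeff R a b 1 v) := by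
  rw [CoordSystem.mem_graph, ← and_assoc]
  refine and_congr ?_ ?_
  · have := forall_lt_first_iff hn 1 v
    have h1 : ∀ q : ℤ, q < 1 ↔ q ≤ 0 := fun q => by omega
    simp only [mul_one, h1] at this
    rw [← this]
    push_cast
    rfl
  · rw [funext_iff]
    refine forall_congr' fun i => ?_
    simp only [loopCoords_coord, Matrix.mulVec, dotProduct, fstCoeff_eq_coordAt,
      sndCoeff_eq_coordAt]
    have h1 : (a : ℤ) + b + 1 + (i : ℕ) = ((a + b : ℕ) : ℤ) * 1 + (i : ℕ) + 1 := by
      push_cast; ring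
    have h2 : ∀ l : Fin b,
        (a : ℤ) + b + 1 + a + (l : ℕ) = ((a + b : ℕ) : ℤ) * 1 + a + (l : ℕ) + 1 :=
      fun l => by push_cast; ring
    rw [h1]
    simp only [h2]

theorem fstCoeff_X_smul (q : ℤ) (v : LoopSpace R (a + b)) :
    fstCoeff R a b q ((PowerSeries.X : R⟦X⟧) • v) = fstCoeff R a b (q - 1) v := by
  funext i
  rw [fstCoeff_apply, fstCoeff_apply, Pi.smul_apply, Algebra.smul_def,
    LaurentSeries.coe_algebraMap, HahnSeries.ofPowerSeries_X, HahnSeries.coeff_single_mul, one_mul]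

theorem sndCoeff_X_smul (q : ℤ) (v : LoopSpace R (a + b)) :
    sndCoeff R a b q ((PowerSeries.X : R⟦X⟧) • v) = sndCoeff R a b (q - 1) v := by
  funext i
  rw [sndCoeff_apply, sndCoeff_apply, Pi.smul_apply, Algebra.smul_def,
    LaurentSeries.coe_algebraMap, HahnSeries.ofPowerSeries_X, HahnSeries.coeff_single_mul, one_mul]

/-- The vector with the coefficients `x` of `t^q` in the first entries and `y` of `t^r` in the
last ones. -/
noncomputable def monomialVec (q : ℤ) (x : Fin a → R) (r : ℤ) (y : Fin b → R) : LoopSpace R (a + b) :=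
  Fin.append (fun i => HahnSeries.single q (x i)) (fun i => HahnSeries.single r (y i))

theorem fstCoeff_monomialVec (q : ℤ) (x : Fin a → R) (r : ℤ) (y : Fin b → R) (q' : ℤ) :
    fstCoeff R a b q' (monomialVec q x r y) = if q' = q then x else 0 := by
  funext i
  rw [fstCoeff_apply, monomialVec, Fin.append_left, HahnSeries.coeff_single]
  split_ifs <;> rfl

theorem sndCoeff_monomialVec (q : ℤ) (x : Fin a → R) (r : ℤ) (y : Fin b → R) (q' : ℤ) :
    sndCoeff R a b q' (monomialVec q x r y) = if q' = r then y else 0 := by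
  funext i
  rw [sndCoeff_apply, monomialVec, Fin.append_right, HahnSeries.coeff_single]
  split_ifs <;> rfl

theorem blockMat_mulVec_castAdd {S : Type u} [CommRing S] (A : Matrix (Fin a) (Fin a) S)
    (B : Matrix (Fin a) (Fin b) S) (C : Matrix (Fin b) (Fin a) S) (D : Matrix (Fin b) (Fin b) S)
    (v : Fin (a + b) → S) (i : Fin a) : (blockMat A B C D).mulVec v (Fin.castAdd b i) =
      ∑ l, A i l * v (Fin.castAdd b l) + ∑ l, B i l * v (Fin.natAdd a l) := by
  simp [blockMat, Matrix.mulVec, dotProduct, Fin.sum_univ_add]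

theorem blockMat_mulVec_natAdd {S : Type u} [CommRing S] (A : Matrix (Fin a) (Fin a) S)
    (B : Matrix (Fin a) (Fin b) S) (C : Matrix (Fin b) (Fin a) S) (D : Matrix (Fin b) (Fin b) S)
    (v : Fin (a + b) → S) (i : Fin b) : (blockMat A B C D).mulVec v (Fin.natAdd a i) =
      ∑ l, C i l * v (Fin.castAdd b l) + ∑ l, D i l * v (Fin.natAdd a l) := by
  simp [blockMat, Matrix.mulVec, dotProduct, Fin.sum_univ_add]

theorem coeff_t_mul (f : R⸨X⸩) (q : ℤ) : (t R * f).coeff q = f.coeff (q - 1) := by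
  rw [t, HahnSeries.coeff_single_mul, one_mul]

theorem coeff_C_mul (r : R) (f : R⸨X⸩) (q : ℤ) : (HahnSeries.C r * f).coeff q = r * f.coeff q := by
  rw [HahnSeries.C_mul_eq_smul, HahnSeries.coeff_smul, smul_eq_mul]

theorem fstCoeff_lusztigMatrix (p : MatPair R a b) (v : LoopSpace R (a + b)) (q : ℤ) :
    fstCoeff R a b q ((lusztigMatrix p).mulVec v) =
      fstCoeff R a b (q - 1) v + p.2.mulVec (sndCoeff R a b (q - 1) v) := by
  funext i
  rw [fstCoeff_apply, lusztigMatrix, blockMat_mulVec_castAdd, HahnSeries.coeff_add]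
  congr 1
  · rw [Finset.sum_eq_single i]
    · simp [coeff_t_mul, fstCoeff_apply]
    · intro l _ hl
      simp [Matrix.one_apply_ne hl.symm]
    · simp
  · simp [mul_assoc, coeff_t_mul, Matrix.mulVec, dotProduct, sndCoeff_apply, HahnSeries.coeff_sum]

theorem sndCoeff_lusztigMatrix (p : MatPair R a b) (v : LoopSpace R (a + b)) (q : ℤ) :
    sndCoeff R a b q ((lusztigMatrix p).mulVec v) =
      p.1.mulVec (fstCoeff R a b q v) + sndCoeff R a b (q - 1) v := by
  funext i
  rw [sndCoeff_apply, lusztigMatrix, blockMat_mulVec_natAdd, HahnSeries.coeff_add]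
  congr 1
  · simp [Matrix.mulVec, dotProduct, fstCoeff_apply, HahnSeries.coeff_sum]
  · rw [Finset.sum_eq_single i]
    · simp [coeff_t_mul, sndCoeff_apply]
    · intro l _ hl
      simp [Matrix.one_apply_ne hl.symm]
    · simp

theorem exists_lusztigMatrix_mulVec_eq {p : MatPair R a b} (hp : p ∈ circ R a b)
    (v : LoopSpace R (a + b)) : ∃ w, (lusztigMatrix p).mulVec w = v ∧
      (∀ q, fstCoeff R a b q w =
        fstCoeff R a b (q + 1) v - p.2.mulVec (sndCoeff R a b (q + 1) v)) ∧
      ∀ q, sndCoeff R a b q w =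
        sndCoeff R a b (q + 1) v - p.1.mulVec (fstCoeff R a b (q + 2) v) := by
  -- The inverse matrix is `[[t⁻¹, -t⁻¹Y], [-t⁻²X, t⁻¹]]`; that it is an inverse uses both `XY = 0`
  -- and `YX = 0`.
  let w : LoopSpace R (a + b) := Fin.append
    (fun i => HahnSeries.single (-1) 1 *
      (v (Fin.castAdd b i) - ∑ l, HahnSeries.C (p.2 i l) * v (Fin.natAdd a l)))
    (fun i => HahnSeries.single (-1) 1 * v (Fin.natAdd a i) -
      HahnSeries.single (-2) 1 * ∑ l, HahnSeries.C (p.1 i l) * v (Fin.castAdd b l))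
  have h1 : ∀ q, fstCoeff R a b q w =
      fstCoeff R a b (q + 1) v - p.2.mulVec (sndCoeff R a b (q + 1) v) := by
    intro q
    funext i
    simp only [fstCoeff_apply, w, Fin.append_left, HahnSeries.coeff_single_mul, one_mul,
      HahnSeries.coeff_sub, HahnSeries.coeff_sum, coeff_C_mul, Pi.sub_apply, Matrix.mulVec,
      dotProduct, sndCoeff_apply, sub_neg_eq_add]
  have h2 : ∀ q, sndCoeff R a b q w =
      sndCoeff R a b (q + 1) v - p.1.mulVec (fstCoeff R a b (q + 2) v) := by
    intro q
    funext i
    simp only [fstCoeff_apply, w, Fin.append_right, HahnSeries.coeff_single_mul, one_mul,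
      HahnSeries.coeff_sub, HahnSeries.coeff_sum, coeff_C_mul, Pi.sub_apply, Matrix.mulVec,
      dotProduct, sndCoeff_apply, sub_neg_eq_add]
  refine ⟨w, ext_coeff (fun q => ?_) (fun q => ?_), h1, h2⟩
  · rw [fstCoeff_lusztigMatrix, h1, h2, Matrix.mulVec_sub, Matrix.mulVec_mulVec, hp.2,
      Matrix.zero_mulVec, sub_add_cancel, sub_zero, sub_add_cancel]
  · rw [sndCoeff_lusztigMatrix, h1, h2, Matrix.mulVec_sub, Matrix.mulVec_mulVec, hp.1,
      Matrix.zero_mulVec, sub_add_cancel, sub_zero, show q - 1 + 2 = q + 1 by ring]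
    abel

theorem mem_translate {n : ℕ} {g : Matrix (Fin n) (Fin n) R⸨X⸩}
    {Λ : Submodule R⟦X⟧ (LoopSpace R n)} {v : LoopSpace R n} :
    v ∈ translate g Λ ↔ ∃ w ∈ Λ, g.mulVec w = v := Iff.rfl

/-- For `w = (w₁, w₂)` in `E_1` the image is `(t(w₁ + Y w₂), X w₁ + t w₂)`. Its constant coefficient
in the last entries is `X w₁(0)`, which equals `X` of the coefficient `w₁(0) + Y w₂(0)` because `XY
= 0`. The explicit inverse gives the other inclusion. -/
theorem Psi_fst {p : MatPair R a b} (hn : 0 < a + b) (hp : p ∈ circ R a b) :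
    (Psi p).1.restrictScalars R = (loopCoords R hn).graph (a + 1) p.1 := by
  ext v
  rw [mem_graph_fst hn]
  change v ∈ translate (lusztigMatrix p) (E R (a + b) 1) ↔ _
  rw [mem_translate]
  constructor
  · rintro ⟨w, hw, rfl⟩
    rw [mem_E_first hn 0 (by simp)] at hw
    refine ⟨fun q hq => ?_, fun q hq => ?_, ?_⟩
    · rw [fstCoeff_lusztigMatrix, hw.1 _ (by omega), hw.2 _ (by omega), Matrix.mulVec_zero, add_zero]
    · rw [sndCoeff_lusztigMatrix, hw.1 _ (by omega), hw.2 _ (by omega), Matrix.mulVec_zero, add_zero]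
    · rw [sndCoeff_lusztigMatrix, fstCoeff_lusztigMatrix, hw.2 (0 - 1) (by omega), add_zero,
        Matrix.mulVec_add, Matrix.mulVec_mulVec, hp.1, Matrix.zero_mulVec, add_zero, sub_self]
  · rintro ⟨h1, h2, h3⟩
    obtain ⟨w, hw, hw1, hw2⟩ := exists_lusztigMatrix_mulVec_eq hp v
    refine ⟨w, (mem_E_first hn 0 (by simp)).2 ⟨fun q hq => ?_, fun q hq => ?_⟩, hw⟩
    · rw [hw1, h1 _ (by omega)]
      rcases eq_or_lt_of_le (show q + 1 ≤ 0 by omega) with h | h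
      · rw [h, h3, Matrix.mulVec_mulVec, hp.2, Matrix.zero_mulVec, sub_zero]
      · rw [h2 _ h, Matrix.mulVec_zero, sub_zero]
    · rw [hw2]
      rcases eq_or_lt_of_le (show q + 1 ≤ 0 by omega) with h | h
      · rw [h, h3, show q + 2 = 1 by omega, sub_self]
      · rw [h2 _ h, h1 _ (by omega), Matrix.mulVec_zero, sub_zero]

theorem Psi_snd {p : MatPair R a b} (hn : 0 < a + b) (hp : p ∈ circ R a b) :
    (Psi p).2.restrictScalars R = (loopCoords R hn).graph (a + b + 1) p.2 := by
  ext v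
  rw [mem_graph_snd hn]
  change v ∈ translate (lusztigMatrix p) (E R (a + b) (a + 1)) ↔ _
  rw [mem_translate]
  constructor
  · rintro ⟨w, hw, rfl⟩
    rw [mem_E_second hn 0 (by simp)] at hw
    refine ⟨fun q hq => ?_, fun q hq => ?_, ?_⟩
    · rw [fstCoeff_lusztigMatrix, hw.1 _ (by omega), hw.2 _ (by omega), Matrix.mulVec_zero, add_zero]
    · rw [sndCoeff_lusztigMatrix, hw.1 _ (by omega), hw.2 _ (by omega), Matrix.mulVec_zero, add_zero]
    · rw [sndCoeff_lusztigMatrix, fstCoeff_lusztigMatrix, hw.1 (1 - 1) (by omega), zero_add,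
        Matrix.mulVec_add, Matrix.mulVec_mulVec, hp.2, Matrix.zero_mulVec, zero_add]
  · rintro ⟨h1, h2, h3⟩
    obtain ⟨w, hw, hw1, hw2⟩ := exists_lusztigMatrix_mulVec_eq hp v
    refine ⟨w, (mem_E_second hn 0 (by simp)).2 ⟨fun q hq => ?_, fun q hq => ?_⟩, hw⟩
    · rw [hw1]
      rcases eq_or_lt_of_le hq with rfl | h
      · rw [zero_add, h3, sub_self]
      · rw [h1 _ (by omega), h2 _ (by omega), Matrix.mulVec_zero, sub_zero]
    · rw [hw2, h2 _ (by omega)]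
      rcases eq_or_lt_of_le (show q + 1 ≤ 0 by omega) with h | h
      · rw [show q + 2 = 1 by omega, h3, Matrix.mulVec_mulVec, hp.1, Matrix.zero_mulVec, sub_zero]
      · rw [h1 _ (by omega), Matrix.mulVec_zero, sub_zero]

theorem mem_Psi_fst {p : MatPair R a b} (hn : 0 < a + b) (hp : p ∈ circ R a b)
    {v : LoopSpace R (a + b)} : v ∈ (Psi p).1 ↔ (∀ q ≤ 0, fstCoeff R a b q v = 0) ∧
      (∀ q < 0, sndCoeff R a b q v = 0) ∧
      sndCoeff R a b 0 v = p.1.mulVec (fstCoeff R a b 1 v) := by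
  rw [← mem_graph_fst hn, ← Psi_fst hn hp, Submodule.restrictScalars_mem]

theorem mem_Psi_snd {p : MatPair R a b} (hn : 0 < a + b) (hp : p ∈ circ R a b)
    {v : LoopSpace R (a + b)} : v ∈ (Psi p).2 ↔ (∀ q ≤ 0, fstCoeff R a b q v = 0) ∧
      (∀ q ≤ 0, sndCoeff R a b q v = 0) ∧
      fstCoeff R a b 1 v = p.2.mulVec (sndCoeff R a b 1 v) := by
  rw [← mem_graph_snd hn, ← Psi_snd hn hp, Submodule.restrictScalars_mem]

/-- The incidence relations between the graphs are the equations of `𝓛`: each inclusion is tested on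
the vectors of a graph over the unit vectors. Once they hold, both lattices agree with those of `Ψ`
by the graph descriptions. -/
theorem eq_Psi_of_graph (hn : 0 < a + b) {X : Matrix (Fin b) (Fin a) R}
    {Y : Matrix (Fin a) (Fin b) R} {Λ : LPair R (a + b)}
    (h1 : Λ.1.restrictScalars R = (loopCoords R hn).graph (a + 1) X)
    (h2 : Λ.2.restrictScalars R = (loopCoords R hn).graph (a + b + 1) Y)
    (h3 : Λ.2 ≤ Λ.1) (h4 : tMul Λ.1 ≤ Λ.2) : (X, Y) ∈ circ R a b ∧ Psi (X, Y) = Λ := by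
  have m1 : ∀ v, v ∈ Λ.1 ↔ v ∈ (loopCoords R hn).graph (a + 1) X := fun v => by
    rw [← h1, Submodule.restrictScalars_mem]
  have m2 : ∀ v, v ∈ Λ.2 ↔ v ∈ (loopCoords R hn).graph (a + b + 1) Y := fun v => by
    rw [← h2, Submodule.restrictScalars_mem]
  simp only [mem_graph_fst hn] at m1
  simp only [mem_graph_snd hn] at m2
  have hc : (X, Y) ∈ circ R a b := by
    constructor
    · change X * Y = 0
      refine Matrix.ext_of_mulVec_single fun l => ?_
      -- The vector of `Λ₂` over the `l`-th unit vector has no coefficient of `t^0`; membership in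
      -- `Λ₁` therefore reads `0 = X Y e_l`.
      have : monomialVec 1 (Y.mulVec (Pi.single l 1)) 1 (Pi.single l 1) ∈ Λ.1 := by
        refine h3 ((m2 _).2 ⟨fun q hq => ?_, fun q hq => ?_, ?_⟩)
        · rw [fstCoeff_monomialVec, if_neg (by omega)]
        · rw [sndCoeff_monomialVec, if_neg (by omega)]
        · rw [fstCoeff_monomialVec, sndCoeff_monomialVec, if_pos rfl, if_pos rfl]
      have := ((m1 _).1 this).2.2
      rw [fstCoeff_monomialVec, sndCoeff_monomialVec, if_pos rfl, if_neg (by omega),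
        Matrix.mulVec_mulVec] at this
      rw [← this, Matrix.zero_mulVec]
    · change Y * X = 0
      refine Matrix.ext_of_mulVec_single fun l => ?_
      -- Multiplied by `t`, the vector of `Λ₁` has `X e_l` at `t^1` in the last entries and nothing
      -- at `t^1` in the first; membership in `Λ₂` reads `0 = Y X e_l`.
      have : (PowerSeries.X : R⟦X⟧) • monomialVec 1 (Pi.single l 1) 0 (X.mulVec (Pi.single l 1)) ∈
          Λ.2 := by
        refine h4 ⟨_, (m1 _).2 ⟨fun q hq => ?_, fun q hq => ?_, ?_⟩, rfl⟩
        · rw [fstCoeff_monomialVec, if_neg (by omega)]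
        · rw [sndCoeff_monomialVec, if_neg (by omega)]
        · rw [fstCoeff_monomialVec, sndCoeff_monomialVec, if_pos rfl, if_pos rfl]
      have := ((m2 _).1 this).2.2
      rw [fstCoeff_X_smul, sndCoeff_X_smul, fstCoeff_monomialVec, sndCoeff_monomialVec,
        if_neg (by omega), if_pos (by omega), Matrix.mulVec_mulVec] at this
      rw [← this, Matrix.zero_mulVec]
  refine ⟨hc, Prod.ext ?_ ?_⟩
  · ext v
    rw [mem_Psi_fst hn hc, m1]
  · ext v
    rw [mem_Psi_snd hn hc, m2]

theorem Psi_injOn (hn : 0 < a + b) : Set.InjOn (Psi (R := R)) (circ R a b) := by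
  intro p hp p' hp' h
  refine Prod.ext (CoordSystem.graph_injective (C := loopCoords R hn) (j := a + 1)
    (fun _ _ _ => trivial) ?_) (CoordSystem.graph_injective (C := loopCoords R hn)
    (j := a + b + 1) (fun _ _ _ => trivial) ?_)
  · rw [← Psi_fst hn hp, ← Psi_fst hn hp', h]
  · rw [← Psi_snd hn hp, ← Psi_snd hn hp', h]

end Coefficients

/-! ### Quotients of lattices -/

section LQuot

variable {R : Type u} [CommRing R] {n : ℕ}

/-- A linear map on `Λ` with kernel `Λ ∩ M` identifies `Λ / (Λ ∩ M)` with its image. -/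
noncomputable def lquotEquiv {W : Type*} [AddCommGroup W] [Module R W]
    {Λ M : Submodule R⟦X⟧ (LoopSpace R n)} (f : LoopSpace R n →ₗ[R] W)
    (hf : ∀ v ∈ Λ, f v = 0 ↔ v ∈ M) : LQuot Λ M ≃ₗ[R] (Λ.restrictScalars R).map f :=
  let g : Λ →ₗ[R] W := f ∘ₗ Λ.subtype.restrictScalars R
  (Submodule.Quotient.restrictScalarsEquiv R (M.submoduleOf Λ)).symm ≪≫ₗ
    Submodule.quotEquivOfEq _ (LinearMap.ker g) (by
      ext v
      exact (hf v.1 v.2).symm) ≪≫ₗ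
    g.quotKerEquivRange ≪≫ₗ LinearEquiv.ofEq _ _ (by
      ext w
      constructor
      · rintro ⟨v, rfl⟩
        exact ⟨v.1, v.2, rfl⟩
      · rintro ⟨v, hv, rfl⟩
        exact ⟨⟨v, hv⟩, rfl⟩)

/-- A linear map from `Λ` onto `W` with kernel `Λ ∩ M` identifies `Λ / (Λ ∩ M)` with `W`. -/
noncomputable def lquotEquivOfSurj {W : Type*} [AddCommGroup W] [Module R W]
    {Λ M : Submodule R⟦X⟧ (LoopSpace R n)} (f : LoopSpace R n →ₗ[R] W)
    (hf : ∀ v ∈ Λ, f v = 0 ↔ v ∈ M) (hs : ∀ w, ∃ v ∈ Λ, f v = w) : LQuot Λ M ≃ₗ[R] W :=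
  lquotEquiv f hf ≪≫ₗ LinearEquiv.ofTop _ (eq_top_iff.2 fun w _ => hs w)

theorem rankAtStalk_lquot {d : ℕ} {Λ M : Submodule R⟦X⟧ (LoopSpace R n)}
    (f : LoopSpace R n →ₗ[R] (Fin d → R)) (hf : ∀ v ∈ Λ, f v = 0 ↔ v ∈ M)
    (hs : ∀ w, ∃ v ∈ Λ, f v = w) (p : PrimeSpectrum R) :
    Module.rankAtStalk (R := R) (LQuot Λ M) p = d := by
  have := p.nontrivial
  rw [Module.rankAtStalk_eq_of_equiv (lquotEquivOfSurj f hf hs),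
    Module.rankAtStalk_eq_finrank_of_free]
  simp

theorem finrank_lquot_of_surj {d : ℕ} [Nontrivial R] {Λ M : Submodule R⟦X⟧ (LoopSpace R n)}
    (f : LoopSpace R n →ₗ[R] (Fin d → R)) (hf : ∀ v ∈ Λ, f v = 0 ↔ v ∈ M)
    (hs : ∀ w, ∃ v ∈ Λ, f v = w) : Module.finrank R (LQuot Λ M) = d := by
  rw [(lquotEquivOfSurj f hf hs).finrank_eq, Module.finrank_fin_fun]

/-- The quotient is free: its coordinates are the `d` entries before the graph starts and the `s`
defects in the graph equation. -/
theorem projective_lquot_of_graph (hn : 0 < n) {s r d : ℕ} {m₀ j : ℤ} (hj : j = m₀ + d)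
    {Θ : Matrix (Fin s) (Fin r) R} {Λ : Submodule R⟦X⟧ (LoopSpace R n)}
    (h : Λ.restrictScalars R = (loopCoords R hn).graph j Θ) :
    Module.Projective R (LQuot (E R n m₀) Λ) := by
  subst hj
  let C := loopCoords R hn
  let f : LoopSpace R n →ₗ[R] (Fin d → R) × (Fin s → R) :=
    (LinearMap.pi fun i : Fin d => C.coord (m₀ + (i : ℕ))).prod
      (LinearMap.pi fun i : Fin s => C.coord (m₀ + d + (i : ℕ)) -
        ∑ l, Θ i l • C.coord (m₀ + d + s + (l : ℕ)))
  have h1 : ∀ v i, (f v).1 i = C.coord (m₀ + (i : ℕ)) v := fun _ _ => rfl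
  have h2 : ∀ v i, (f v).2 i = C.coord (m₀ + d + (i : ℕ)) v -
      ∑ l, Θ i l * C.coord (m₀ + d + s + (l : ℕ)) v := fun v i => by
    simp [f, LinearMap.sum_apply]
  refine Module.Projective.of_equiv (lquotEquivOfSurj f (fun v hv => ?_) fun w => ?_).symm
  · rw [← Submodule.restrictScalars_mem R Λ, h, CoordSystem.mem_graph, Prod.ext_iff]
    refine and_congr ⟨fun h0 m hm => ?_, fun h0 => funext fun i => ?_⟩
      ⟨fun h0 i => ?_, fun h0 => funext fun i => ?_⟩
    · rcases lt_or_ge m m₀ with h3 | h3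
      · exact (mem_E hn).1 hv m h3
      · obtain ⟨i, rfl⟩ := CoordSystem.ge_cases h3 hm
        exact congrFun h0 i
    · exact h0 _ (by omega)
    · have := congrFun h0 i
      rw [h2] at this
      exact sub_eq_zero.1 this
    · rw [h2, h0 i, sub_self]
      rfl
  · have hs : ∀ m, m₀ ≤ m → m < m₀ + d + s → m ∈ C.supp := fun _ _ _ => trivial
    refine ⟨C.blockVec m₀ w.1 w.2, (mem_E hn).2 fun m hm => C.coord_blockVec_of_lt hs _ _ hm,
      Prod.ext (funext fun i => ?_) (funext fun i => ?_)⟩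
    · rw [h1, C.coord_blockVec_fst hs]
    · rw [h2, C.coord_blockVec_snd hs, Finset.sum_eq_zero, sub_zero]
      intro l _
      rw [C.coord_blockVec_of_ge hs _ _ (by omega), mul_zero]

theorem projective_window (hn : 0 < n) {m₀ : ℤ} {l : ℕ} {Λ : Submodule R⟦X⟧ (LoopSpace R n)}
    (h1 : Λ ≤ E R n m₀) (h2 : E R n (m₀ + l) ≤ Λ) (h : Module.Projective R (LQuot (E R n m₀) Λ)) :
    Module.Projective R ((Fin l → R) ⧸ (Λ.restrictScalars R).map (window R n m₀ l)) := by
  let L := (Λ.restrictScalars R).map (window R n m₀ l)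
  refine Module.Projective.of_equiv (lquotEquivOfSurj (Λ := E R n m₀) (M := Λ)
    (L.mkQ ∘ₗ window R n m₀ l) (fun v hv => ?_) fun w => ?_)
  · rw [mem_iff_window hn h1 h2, LinearMap.comp_apply, Submodule.mkQ_apply,
      Submodule.Quotient.mk_eq_zero]
    exact (and_iff_right hv).symm
  · obtain ⟨u, rfl⟩ := L.mkQ_surjective w
    obtain ⟨v, hv, rfl⟩ := exists_window_eq hn m₀ l u
    exact ⟨v, hv, rfl⟩

/-- Both lattices are determined by the window `[j, j + s + r)`, where base change of a graph is
known. -/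
theorem pullLattice_graph (hn : 0 < n) {S : Type u} [CommRing S] (φ : R →+* S) {s r : ℕ} {j : ℤ}
    {Θ : Matrix (Fin s) (Fin r) R} {Λ : Submodule R⟦X⟧ (LoopSpace R n)}
    (h : Λ.restrictScalars R = (loopCoords R hn).graph j Θ) :
    (pullLattice φ Λ).restrictScalars S = (loopCoords S hn).graph j (Θ.map φ) := by
  have h1 : Λ ≤ E R n j := by
    change Λ.restrictScalars R ≤ (E R n j).restrictScalars R
    rw [h, ← loopCoords_above hn]
    exact CoordSystem.graph_le_above _
  have h2 : E R n (j + (s + r : ℕ)) ≤ Λ := by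
    change (E R n _).restrictScalars R ≤ Λ.restrictScalars R
    rw [h, ← loopCoords_above hn, Nat.cast_add, ← add_assoc]
    exact CoordSystem.above_le_graph _
  refine eq_graph_of_window hn (m₀ := j) (l := s + r) le_rfl (by push_cast; omega)
    (pullLattice_le_E hn φ h1) (E_le_pullLattice hn φ h2) ?_
  rw [window_pullLattice hn, h, window_map_graph hn le_rfl (by push_cast; omega),
    spanMap_graph φ le_rfl (by push_cast; omega)]

end LQuot

/-! ### Ψ as a morphism: base change, flags, equivariance, descent from fields -/

section Psi

variable {R : Type u} [CommRing R] {a b : ℕ}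

theorem pullLattice_Psi (hn : 0 < a + b) {S : Type u} [CommRing S] (φ : R →+* S)
    {p : MatPair R a b} (hp : p ∈ circ R a b) :
    (pullLattice φ (Psi p).1, pullLattice φ (Psi p).2) = Psi (mapPair φ p) := by
  have hp' := map_mem_circ φ hp
  refine Prod.ext (Submodule.restrictScalars_injective S _ _ ?_)
    (Submodule.restrictScalars_injective S _ _ ?_)
  · rw [Psi_fst hn hp', pullLattice_graph hn φ (Psi_fst hn hp)]
    rfl
  · rw [Psi_snd hn hp', pullLattice_graph hn φ (Psi_snd hn hp)]
    rfl

theorem mem_tMul_Psi_fst (hn : 0 < a + b) {p : MatPair R a b} (hp : p ∈ circ R a b)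
    {v : LoopSpace R (a + b)} : v ∈ tMul (Psi p).1 ↔ (∀ q ≤ 1, fstCoeff R a b q v = 0) ∧
      (∀ q < 1, sndCoeff R a b q v = 0) ∧
      sndCoeff R a b 1 v = p.1.mulVec (fstCoeff R a b 2 v) := by
  rw [mem_tMul]
  constructor
  · rintro ⟨w, hw, rfl⟩
    rw [mem_Psi_fst hn hp] at hw
    simp only [fstCoeff_X_smul, sndCoeff_X_smul]
    exact ⟨fun q hq => hw.1 _ (by omega), fun q hq => hw.2.1 _ (by omega), hw.2.2⟩
  · rintro ⟨h1, h2, h3⟩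
    obtain ⟨w, -, rfl⟩ := exists_X_smul_eq hn (j := 1) (v := v) ((mem_E_first hn 1 (by ring)).2
      ⟨fun q hq => h1 q hq.le, h2⟩)
    simp only [fstCoeff_X_smul, sndCoeff_X_smul] at h1 h2 h3
    refine ⟨w, (mem_Psi_fst hn hp).2 ⟨fun q hq => ?_, fun q hq => ?_, h3⟩, rfl⟩
    · have := h1 (q + 1) (by omega)
      rwa [add_sub_cancel_right] at this
    · have := h2 (q + 1) (by omega)
      rwa [add_sub_cancel_right] at this

theorem Psi_snd_le_fst (hn : 0 < a + b) {p : MatPair R a b} (hp : p ∈ circ R a b) :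
    (Psi p).2 ≤ (Psi p).1 := by
  intro v hv
  rw [mem_Psi_snd hn hp] at hv
  refine (mem_Psi_fst hn hp).2 ⟨hv.1, fun q hq => hv.2.1 q hq.le, ?_⟩
  rw [hv.2.1 0 le_rfl, hv.2.2, Matrix.mulVec_mulVec, hp.1, Matrix.zero_mulVec]

theorem tMul_Psi_fst_le_snd (hn : 0 < a + b) {p : MatPair R a b} (hp : p ∈ circ R a b) :
    tMul (Psi p).1 ≤ (Psi p).2 := by
  intro v hv
  rw [mem_tMul_Psi_fst hn hp] at hv
  refine (mem_Psi_snd hn hp).2 ⟨fun q hq => hv.1 q (by omega), fun q hq => hv.2.1 q (by omega), ?_⟩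
  rw [hv.1 1 le_rfl, hv.2.2, Matrix.mulVec_mulVec, hp.2, Matrix.zero_mulVec]

theorem le_E_of_graph {n : ℕ} (hn : 0 < n) {s r : ℕ} {j j' : ℤ} (hj : j' ≤ j)
    {Θ : Matrix (Fin s) (Fin r) R} {Λ : Submodule R⟦X⟧ (LoopSpace R n)}
    (h : Λ.restrictScalars R = (loopCoords R hn).graph j Θ) : Λ ≤ E R n j' := by
  refine le_trans ?_ (E_antitone hn hj)
  change Λ.restrictScalars R ≤ (E R n j).restrictScalars R
  rw [h, ← loopCoords_above hn]
  exact CoordSystem.graph_le_above _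

theorem E_le_of_graph {n : ℕ} (hn : 0 < n) {s r : ℕ} {j j' : ℤ} (hj : j + s + r ≤ j')
    {Θ : Matrix (Fin s) (Fin r) R} {Λ : Submodule R⟦X⟧ (LoopSpace R n)}
    (h : Λ.restrictScalars R = (loopCoords R hn).graph j Θ) : E R n j' ≤ Λ := by
  refine le_trans (E_antitone hn hj) ?_
  change (E R n _).restrictScalars R ≤ Λ.restrictScalars R
  rw [h, ← loopCoords_above hn]
  exact CoordSystem.above_le_graph _

/-- The ranks come from explicit maps onto `R^a` and `R^b`: the defect in the equation with `Y` on
`Λ₁`, and the defect in the equation of `tΛ₁` with `X` on `Λ₂`. When such a defect vanishes, `XY =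
0` or `YX = 0` supplies the other vanishing coordinates. -/
theorem isAffFlag_Psi (hn : 0 < a + b) {p : MatPair R a b} (hp : p ∈ circ R a b) :
    IsAffFlag R a b (Psi p) := by
  -- Both graphs lie between `E_{1-2n}` and `E_{1+2n} = E_{2a+2b+1}`; `d` is the distance from `1 -
  -- 2n` to the start of the graph.
  refine ⟨⟨2, E_le_of_graph hn ?_ (Psi_fst hn hp), le_E_of_graph hn ?_ (Psi_fst hn hp),
      projective_lquot_of_graph hn (d := 2 * (a + b) + a) ?_ (Psi_fst hn hp)⟩,
    ⟨2, E_le_of_graph hn ?_ (Psi_snd hn hp), le_E_of_graph hn ?_ (Psi_snd hn hp),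
      projective_lquot_of_graph hn (d := 3 * (a + b)) ?_ (Psi_snd hn hp)⟩,
    Psi_snd_le_fst hn hp, tMul_Psi_fst_le_snd hn hp, ?_, ?_⟩
  any_goals push_cast; omega
  · refine rankAtStalk_lquot (fstCoeff R a b 1 - p.2.mulVecLin ∘ₗ sndCoeff R a b 1)
      (fun v hv => ?_) fun w => ⟨monomialVec 1 w 0 (p.1.mulVec w), ?_, ?_⟩
    · rw [mem_Psi_snd hn hp]
      rw [mem_Psi_fst hn hp] at hv
      change fstCoeff R a b 1 v - p.2.mulVec (sndCoeff R a b 1 v) = 0 ↔ _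
      rw [sub_eq_zero]
      refine ⟨fun h => ⟨hv.1, fun q hq => ?_, h⟩, fun h => h.2.2⟩
      rcases eq_or_lt_of_le hq with rfl | hq
      · rw [hv.2.2, h, Matrix.mulVec_mulVec, hp.1, Matrix.zero_mulVec]
      · exact hv.2.1 q hq
    · refine (mem_Psi_fst hn hp).2 ⟨fun q hq => ?_, fun q hq => ?_, ?_⟩
      · rw [fstCoeff_monomialVec, if_neg (by omega)]
      · rw [sndCoeff_monomialVec, if_neg (by omega)]
      · rw [fstCoeff_monomialVec, sndCoeff_monomialVec, if_pos rfl, if_pos rfl]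
    · change fstCoeff R a b 1 _ - p.2.mulVec (sndCoeff R a b 1 _) = w
      rw [fstCoeff_monomialVec, sndCoeff_monomialVec, if_pos rfl, if_neg (by omega),
        Matrix.mulVec_zero, sub_zero]
  · refine rankAtStalk_lquot (sndCoeff R a b 1 - p.1.mulVecLin ∘ₗ fstCoeff R a b 2)
      (fun v hv => ?_) fun w => ⟨monomialVec 1 (p.2.mulVec w) 1 w, ?_, ?_⟩
    · rw [mem_tMul_Psi_fst hn hp]
      rw [mem_Psi_snd hn hp] at hv
      change sndCoeff R a b 1 v - p.1.mulVec (fstCoeff R a b 2 v) = 0 ↔ _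
      rw [sub_eq_zero]
      refine ⟨fun h => ⟨fun q hq => ?_, fun q hq => hv.2.1 q (by omega), h⟩, fun h => h.2.2⟩
      rcases eq_or_lt_of_le hq with rfl | hq
      · rw [hv.2.2, h, Matrix.mulVec_mulVec, hp.2, Matrix.zero_mulVec]
      · exact hv.1 q (by omega)
    · refine (mem_Psi_snd hn hp).2 ⟨fun q hq => ?_, fun q hq => ?_, ?_⟩
      · rw [fstCoeff_monomialVec, if_neg (by omega)]
      · rw [sndCoeff_monomialVec, if_neg (by omega)]
      · rw [fstCoeff_monomialVec, sndCoeff_monomialVec, if_pos rfl, if_pos rfl]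
    · change sndCoeff R a b 1 _ - p.1.mulVec (fstCoeff R a b 2 _) = w
      rw [fstCoeff_monomialVec, sndCoeff_monomialVec, if_pos rfl, if_neg (by omega),
        Matrix.mulVec_zero, sub_zero]

theorem fstCoeff_diagMat (g : GL (Fin a) R) (h : GL (Fin b) R) (v : LoopSpace R (a + b)) (q : ℤ) :
    fstCoeff R a b q ((diagMat g h).mulVec v) = g.1.mulVec (fstCoeff R a b q v) := by
  funext i
  rw [fstCoeff_apply, diagMat, blockMat_mulVec_castAdd, HahnSeries.coeff_add]
  simp [Matrix.mulVec, dotProduct, fstCoeff_apply, HahnSeries.coeff_sum]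

theorem sndCoeff_diagMat (g : GL (Fin a) R) (h : GL (Fin b) R) (v : LoopSpace R (a + b)) (q : ℤ) :
    sndCoeff R a b q ((diagMat g h).mulVec v) = h.1.mulVec (sndCoeff R a b q v) := by
  funext i
  rw [sndCoeff_apply, diagMat, blockMat_mulVec_natAdd, HahnSeries.coeff_add]
  simp [Matrix.mulVec, dotProduct, sndCoeff_apply, HahnSeries.coeff_sum]

theorem Psi_pairAct (hn : 0 < a + b) (g : GL (Fin a) R) (h : GL (Fin b) R) {p : MatPair R a b}
    (hp : p ∈ circ R a b) : Psi (pairAct g h p) = translateFlag (diagMat g h) (Psi p) := by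
  have hp' := pairAct_mem_circ g h hp
  have hg : (g⁻¹).1 * g.1 = 1 := g.inv_mul
  have hh : (h⁻¹).1 * h.1 = 1 := h.inv_mul
  have hg' : g.1 * (g⁻¹).1 = 1 := g.mul_inv
  have hh' : h.1 * (h⁻¹).1 = 1 := h.mul_inv
  have hcancel : ∀ v : LoopSpace R (a + b),
      (diagMat g h).mulVec ((diagMat g⁻¹ h⁻¹).mulVec v) = v := by
    refine fun v => ext_coeff (fun q => ?_) fun q => ?_
    · rw [fstCoeff_diagMat, fstCoeff_diagMat, Matrix.mulVec_mulVec, hg', Matrix.one_mulVec]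
    · rw [sndCoeff_diagMat, sndCoeff_diagMat, Matrix.mulVec_mulVec, hh', Matrix.one_mulVec]
  refine Prod.ext (Submodule.ext fun v => ?_) (Submodule.ext fun v => ?_)
  · rw [mem_Psi_fst hn hp']
    change _ ↔ v ∈ translate (diagMat g h) (Psi p).1
    rw [mem_translate]
    constructor
    · rintro ⟨h1, h2, h3⟩
      refine ⟨_, (mem_Psi_fst hn hp).2 ⟨fun q hq => ?_, fun q hq => ?_, ?_⟩, hcancel v⟩
      · rw [fstCoeff_diagMat, h1 q hq, Matrix.mulVec_zero]
      · rw [sndCoeff_diagMat, h2 q hq, Matrix.mulVec_zero]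
      · rw [fstCoeff_diagMat, sndCoeff_diagMat, h3, Matrix.mulVec_mulVec, Matrix.mulVec_mulVec]
        simp only [pairAct]
        rw [Matrix.mul_assoc, ← Matrix.mul_assoc, hh, Matrix.one_mul]
    · rintro ⟨w, hw, rfl⟩
      rw [mem_Psi_fst hn hp] at hw
      simp only [fstCoeff_diagMat, sndCoeff_diagMat]
      refine ⟨fun q hq => ?_, fun q hq => ?_, ?_⟩
      · rw [hw.1 q hq, Matrix.mulVec_zero]
      · rw [hw.2.1 q hq, Matrix.mulVec_zero]
      · rw [hw.2.2, Matrix.mulVec_mulVec, Matrix.mulVec_mulVec]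
        simp only [pairAct]
        rw [Matrix.mul_assoc, hg, Matrix.mul_one]
  · rw [mem_Psi_snd hn hp']
    change _ ↔ v ∈ translate (diagMat g h) (Psi p).2
    rw [mem_translate]
    constructor
    · rintro ⟨h1, h2, h3⟩
      refine ⟨_, (mem_Psi_snd hn hp).2 ⟨fun q hq => ?_, fun q hq => ?_, ?_⟩, hcancel v⟩
      · rw [fstCoeff_diagMat, h1 q hq, Matrix.mulVec_zero]
      · rw [sndCoeff_diagMat, h2 q hq, Matrix.mulVec_zero]
      · rw [fstCoeff_diagMat, sndCoeff_diagMat, h3, Matrix.mulVec_mulVec, Matrix.mulVec_mulVec]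
        simp only [pairAct]
        rw [Matrix.mul_assoc, ← Matrix.mul_assoc, hg, Matrix.one_mul]
    · rintro ⟨w, hw, rfl⟩
      rw [mem_Psi_snd hn hp] at hw
      simp only [fstCoeff_diagMat, sndCoeff_diagMat]
      refine ⟨fun q hq => ?_, fun q hq => ?_, ?_⟩
      · rw [hw.1 q hq, Matrix.mulVec_zero]
      · rw [hw.2.1 q hq, Matrix.mulVec_zero]
      · rw [hw.2.2, Matrix.mulVec_mulVec, Matrix.mulVec_mulVec]
        simp only [pairAct]
        rw [Matrix.mul_assoc, hh, Matrix.mul_one]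

/-- Over a reduced ring, a family of flags lies in the image of `Ψ` if its fibers do. -/
theorem exists_Psi_eq_of_forall_field {k : Type u} [Field k] [Algebra k R] [IsReduced R]
    (hn : 0 < a + b) {Λ : LPair R (a + b)} (hΛ : IsAffFlag R a b Λ)
    (h : ∀ (K : Type u) [Field K] [Algebra k K] (φ : R →ₐ[k] K),
      ∃ p ∈ circ K a b, Psi p = (affFlag k a b).pull φ Λ) : ∃ p ∈ circ R a b, Psi p = Λ := by
  obtain ⟨⟨N₁, h1, h2, -⟩, ⟨N₂, h3, h4, -⟩, h5, h6, -⟩ := hΛ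
  have hle : ∀ {x y : ℕ}, x ≤ y → ((a + b : ℕ) : ℤ) * x ≤ ((a + b : ℕ) : ℤ) * y := fun hxy => by
    exact_mod_cast Nat.mul_le_mul_left _ hxy
  have key : ∀ {s r : ℕ} {j : ℤ} {N : ℕ} (Λ' : Submodule R⟦X⟧ (LoopSpace R (a + b))),
      E R (a + b) (1 + ((a + b : ℕ) : ℤ) * N) ≤ Λ' → Λ' ≤ E R (a + b) (1 - ((a + b : ℕ) : ℤ) * N) →
      1 - ((a + b : ℕ) : ℤ) * 2 ≤ j → j + s + r ≤ 1 + ((a + b : ℕ) : ℤ) * 2 →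
      (∀ (K : Type u) [Field K] [Algebra k K] (φ : R →ₐ[k] K), ∃ Θ : Matrix (Fin s) (Fin r) K,
        (pullLattice φ.toRingHom Λ').restrictScalars K = (loopCoords K hn).graph j Θ) →
      ∃ Θ : Matrix (Fin s) (Fin r) R, Λ'.restrictScalars R = (loopCoords R hn).graph j Θ := by
    intro s r j N Λ' hl hu hj1 hj2 hK
    -- The window must contain both the bounds of the given lattice, measured by `N`, and the range
    -- of the graphs, measured by `2`.
    have e1 := hle (le_max_left N 2)
    have e2 := hle (le_max_right N 2)
    have e3 : 1 - ((a + b : ℕ) : ℤ) * (max N 2 : ℕ) + ((2 * ((a + b) * max N 2) : ℕ) : ℤ) =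
        1 + ((a + b : ℕ) : ℤ) * (max N 2 : ℕ) := by
      push_cast
      ring
    have hw1 : 1 - ((a + b : ℕ) : ℤ) * (max N 2 : ℕ) ≤ j := by
      refine le_trans ?_ hj1
      exact sub_le_sub_left e2 1
    have hw2 : j + s + r ≤
        1 - ((a + b : ℕ) : ℤ) * (max N 2 : ℕ) + ((2 * ((a + b) * max N 2) : ℕ) : ℤ) := by
      rw [e3]
      exact hj2.trans (add_le_add_right e2 1)
    obtain ⟨Θ, hΘ⟩ := exists_eq_graph_of_forall_field (k := k) (s := s) (r := r) hw1 hw2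
      ((Λ'.restrictScalars R).map (window R (a + b) _ _)) fun K _ _ φ => by
        obtain ⟨Θ, hΘ⟩ := hK K φ
        refine ⟨Θ, ?_⟩
        rw [← window_map_graph hn hw1 hw2, ← hΘ]
        exact (window_pullLattice hn φ.toRingHom _ _ Λ').symm
    refine ⟨Θ, eq_graph_of_window hn hw1 hw2 (hu.trans (E_antitone hn ?_))
      ((E_antitone hn ?_).trans hl) hΘ⟩
    · exact sub_le_sub_left e1 1
    · rw [e3]
      exact add_le_add_right e1 1
  obtain ⟨X, hX⟩ := key (s := b) (r := a) (j := a + 1) Λ.1 h1 h2 (by push_cast; omega)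
    (by push_cast; omega) fun K _ _ φ => by
      obtain ⟨p, hp, hΛ'⟩ := h K φ
      exact ⟨p.1, by rw [← Psi_fst hn hp, hΛ']; rfl⟩
  obtain ⟨Y, hY⟩ := key (s := a) (r := b) (j := a + b + 1) Λ.2 h3 h4 (by push_cast; omega)
    (by push_cast; omega) fun K _ _ φ => by
      obtain ⟨p, hp, hΛ'⟩ := h K φ
      exact ⟨p.2, by rw [← Psi_snd hn hp, hΛ']; rfl⟩
  exact ⟨_, eq_Psi_of_graph hn hX hY h5 h6⟩

end Psi

/-! ### The image of 𝓛_c described by dimensions -/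

section LatticeLocus

variable {K : Type u} [Field K] {a b : ℕ}

theorem cod_of_finrank_map_mkQ {V : Type*} [AddCommGroup V] [Module K V] {J L : Submodule K V}
    {d : ℕ} (hd : 0 < d) (h : Module.finrank K (J.map L.mkQ) = d) : Cod J L d := by
  -- Infinite-dimensional spaces have `finrank` zero, so `0 < d` is what guarantees finiteness.
  have : FiniteDimensional K (J.map L.mkQ) := Module.finite_of_finrank_pos (by omega)
  obtain ⟨s, hs⟩ := L.mkQ.exists_rightInverse_of_surjective (Submodule.range_mkQ _)
  refine ⟨(J.map L.mkQ).map s, inferInstance, (Submodule.finrank_map_le s _).trans h.le, ?_⟩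
  intro v hv
  have : v - s (L.mkQ v) ∈ L := by
    rw [← Submodule.Quotient.mk_eq_zero]
    change L.mkQ (v - _) = 0
    rw [map_sub, sub_eq_zero]
    exact (LinearMap.congr_fun hs (L.mkQ v)).symm
  rw [← sub_add_cancel v (s (L.mkQ v))]
  exact Submodule.add_mem_sup this ⟨_, ⟨v, hv, rfl⟩, rfl⟩

theorem cod_of_finrank_lquot {n d : ℕ} {M Λ : Submodule K⟦X⟧ (LoopSpace K n)} (hd : 0 < d)
    (h : Module.finrank K (LQuot M Λ) = d) : Cod (M.restrictScalars K) (Λ.restrictScalars K) d := by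
  refine cod_of_finrank_map_mkQ hd ?_
  rw [← h]
  exact (lquotEquiv (Λ := M) (M := Λ) (Λ.restrictScalars K).mkQ
    fun v _ => Submodule.Quotient.mk_eq_zero _).finrank_eq.symm

/-- Taking the coefficient of `t^0` in the last entries has kernel `Λ₁ ∩ E_(3)`, and by the graph
equation its image is the column space of `X`. -/
theorem finrank_lquot_Psi_fst (hn : 0 < a + b) {p : MatPair K a b} (hp : p ∈ circ K a b) :
    Module.finrank K (LQuot (Psi p).1 (E K (a + b) (a + b + 1))) = p.1.rank := by
  rw [(lquotEquiv (sndCoeff K a b 0) fun v hv => ?_).finrank_eq, Matrix.rank,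
    show ((Psi p).1.restrictScalars K).map (sndCoeff K a b 0) = LinearMap.range p.1.mulVecLin from ?_]
  · ext w
    constructor
    · rintro ⟨v, hv, rfl⟩
      exact ⟨_, ((mem_Psi_fst hn hp).1 hv).2.2.symm⟩
    · rintro ⟨x, rfl⟩
      refine ⟨monomialVec 1 x 0 (p.1.mulVec x), (mem_Psi_fst hn hp).2
        ⟨fun q hq => ?_, fun q hq => ?_, ?_⟩, ?_⟩
      · rw [fstCoeff_monomialVec, if_neg (by omega)]
      · rw [sndCoeff_monomialVec, if_neg (by omega)]
      · rw [fstCoeff_monomialVec, sndCoeff_monomialVec, if_pos rfl, if_pos rfl]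
      · rw [sndCoeff_monomialVec, if_pos rfl]
        rfl
  · rw [mem_E_first hn 1 (by push_cast; ring)]
    rw [mem_Psi_fst hn hp] at hv
    refine ⟨fun h => ⟨fun q hq => hv.1 q (by omega), fun q hq => ?_⟩, fun h => h.2 0 (by omega)⟩
    rcases eq_or_lt_of_le (show q ≤ 0 by omega) with rfl | h'
    · exact h
    · exact hv.2.1 q h'

theorem finrank_lquot_Psi_snd (hn : 0 < a + b) {p : MatPair K a b} (hp : p ∈ circ K a b) :
    Module.finrank K (LQuot (Psi p).2 (E K (a + b) (2 * a + b + 1))) = p.2.rank := by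
  rw [(lquotEquiv (fstCoeff K a b 1) fun v hv => ?_).finrank_eq, Matrix.rank,
    show ((Psi p).2.restrictScalars K).map (fstCoeff K a b 1) = LinearMap.range p.2.mulVecLin from ?_]
  · ext w
    constructor
    · rintro ⟨v, hv, rfl⟩
      exact ⟨_, ((mem_Psi_snd hn hp).1 hv).2.2.symm⟩
    · rintro ⟨x, rfl⟩
      refine ⟨monomialVec 1 (p.2.mulVec x) 1 x, (mem_Psi_snd hn hp).2
        ⟨fun q hq => ?_, fun q hq => ?_, ?_⟩, ?_⟩
      · rw [fstCoeff_monomialVec, if_neg (by omega)]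
      · rw [sndCoeff_monomialVec, if_neg (by omega)]
      · rw [fstCoeff_monomialVec, sndCoeff_monomialVec, if_pos rfl, if_pos rfl]
      · rw [fstCoeff_monomialVec, if_pos rfl]
        rfl
  · rw [mem_E_second hn 1 (by push_cast; ring)]
    rw [mem_Psi_snd hn hp] at hv
    refine ⟨fun h => ⟨fun q hq => ?_, fun q hq => hv.2.1 q (by omega)⟩, fun h => h.1 1 le_rfl⟩
    rcases eq_or_lt_of_le hq with rfl | h'
    · exact h
    · exact hv.1 q (by omega)

theorem inf_E'_eq_bot_iff {n : ℕ} (hn : 0 < n) {j : ℤ} {Λ : Submodule K⟦X⟧ (LoopSpace K n)} :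
    Λ.restrictScalars K ⊓ E' K n j = ⊥ ↔
      ∀ v ∈ Λ.restrictScalars K, (∀ m ≥ j, (loopCoords K hn).coord m v = 0) → v = 0 := by
  rw [eq_bot_iff]
  constructor
  · exact fun h v hv h' => h ⟨hv, (mem_E' hn).2 h'⟩
  · exact fun h v hv => h v hv.1 ((mem_E' hn).1 hv.2)

theorem inf_E'_eq_bot_of_graph {n : ℕ} (hn : 0 < n) {s r : ℕ} {j : ℤ}
    {Θ : Matrix (Fin s) (Fin r) K} {Λ : Submodule K⟦X⟧ (LoopSpace K n)}
    (h : Λ.restrictScalars K = (loopCoords K hn).graph j Θ) :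
    Λ.restrictScalars K ⊓ E' K n (j + s) = ⊥ := by
  rw [inf_E'_eq_bot_iff hn, h]
  exact fun v hv => CoordSystem.graph_lower_eq_zero hv

theorem Psi_mem_latticeLocus (hn : 0 < a + b) {c : ℕ} {p : MatPair K a b} (hp : p ∈ circ K a b)
    (h1 : p.1.rank ≤ c) (h2 : p.2.rank ≤ a - c) : Psi p ∈ latticeLocus K a b c := by
  refine ⟨isAffFlag_Psi hn hp, le_E_of_graph hn le_rfl (Psi_fst hn hp),
    E_le_of_graph hn (by omega) (Psi_fst hn hp), le_E_of_graph hn le_rfl (Psi_snd hn hp),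
    E_le_of_graph hn (by omega) (Psi_snd hn hp), ?_, ?_, ?_, ?_, ?_, ?_,
    (finrank_lquot_Psi_fst hn hp).trans_le h1, (finrank_lquot_Psi_snd hn hp).trans_le h2⟩
  · refine finrank_lquot_of_surj (sndCoeff K a b 0 - p.1.mulVecLin ∘ₗ fstCoeff K a b 1)
      (fun v hv => ?_) fun w => ⟨monomialVec 0 0 0 w, ?_, ?_⟩
    · rw [mem_Psi_fst hn hp]
      rw [mem_E_second hn 0 (by ring)] at hv
      change sndCoeff K a b 0 v - p.1.mulVec (fstCoeff K a b 1 v) = 0 ↔ _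
      rw [sub_eq_zero]
      exact ⟨fun h => ⟨hv.1, hv.2, h⟩, fun h => h.2.2⟩
    · refine (mem_E_second hn 0 (by ring)).2 ⟨fun q hq => ?_, fun q hq => ?_⟩
      · rw [fstCoeff_monomialVec, ite_self]
      · rw [sndCoeff_monomialVec, if_neg (by omega)]
    · change sndCoeff K a b 0 _ - p.1.mulVec (fstCoeff K a b 1 _) = w
      rw [fstCoeff_monomialVec, sndCoeff_monomialVec, if_pos rfl, if_neg (by omega),
        Matrix.mulVec_zero, sub_zero]
  · refine finrank_lquot_of_surj (fstCoeff K a b 1)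
      (fun v hv => ?_) fun w => ⟨monomialVec 1 w 0 (p.1.mulVec w), ?_, ?_⟩
    · rw [mem_E_second hn 1 (by push_cast; ring)]
      rw [mem_Psi_fst hn hp] at hv
      refine ⟨fun h => ⟨fun q hq => ?_, fun q hq => ?_⟩, fun h => h.1 1 le_rfl⟩
      · rcases eq_or_lt_of_le hq with rfl | h'
        · exact h
        · exact hv.1 q (by omega)
      · rcases eq_or_lt_of_le (show q ≤ 0 by omega) with rfl | h'
        · rw [hv.2.2, h, Matrix.mulVec_zero]
        · exact hv.2.1 q h'
    · refine (mem_Psi_fst hn hp).2 ⟨fun q hq => ?_, fun q hq => ?_, ?_⟩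
      · rw [fstCoeff_monomialVec, if_neg (by omega)]
      · rw [sndCoeff_monomialVec, if_neg (by omega)]
      · rw [fstCoeff_monomialVec, sndCoeff_monomialVec, if_pos rfl, if_pos rfl]
    · rw [fstCoeff_monomialVec, if_pos rfl]
  · refine finrank_lquot_of_surj (fstCoeff K a b 1 - p.2.mulVecLin ∘ₗ sndCoeff K a b 1)
      (fun v hv => ?_) fun w => ⟨monomialVec 1 w 0 0, ?_, ?_⟩
    · rw [mem_Psi_snd hn hp]
      rw [mem_E_first hn 1 (by push_cast; ring)] at hv
      change fstCoeff K a b 1 v - p.2.mulVec (sndCoeff K a b 1 v) = 0 ↔ _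
      rw [sub_eq_zero]
      exact ⟨fun h => ⟨fun q hq => hv.1 q (by omega), fun q hq => hv.2 q (by omega), h⟩,
        fun h => h.2.2⟩
    · refine (mem_E_first hn 1 (by push_cast; ring)).2 ⟨fun q hq => ?_, fun q hq => ?_⟩
      · rw [fstCoeff_monomialVec, if_neg (by omega)]
      · rw [sndCoeff_monomialVec, ite_self]
    · change fstCoeff K a b 1 _ - p.2.mulVec (sndCoeff K a b 1 _) = w
      rw [fstCoeff_monomialVec, sndCoeff_monomialVec, if_pos rfl, if_neg (by omega),
        Matrix.mulVec_zero, sub_zero]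
  · refine finrank_lquot_of_surj (sndCoeff K a b 1)
      (fun v hv => ?_) fun w => ⟨monomialVec 1 (p.2.mulVec w) 1 w, ?_, ?_⟩
    · rw [mem_E_first hn 2 (by push_cast; ring)]
      rw [mem_Psi_snd hn hp] at hv
      refine ⟨fun h => ⟨fun q hq => ?_, fun q hq => ?_⟩, fun h => h.2 1 (by omega)⟩
      · rcases eq_or_lt_of_le (show q ≤ 1 by omega) with rfl | h'
        · rw [hv.2.2, h, Matrix.mulVec_zero]
        · exact hv.1 q (by omega)
      · rcases eq_or_lt_of_le (show q ≤ 1 by omega) with rfl | h'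
        · exact h
        · exact hv.2.1 q (by omega)
    · refine (mem_Psi_snd hn hp).2 ⟨fun q hq => ?_, fun q hq => ?_, ?_⟩
      · rw [fstCoeff_monomialVec, if_neg (by omega)]
      · rw [sndCoeff_monomialVec, if_neg (by omega)]
      · rw [fstCoeff_monomialVec, sndCoeff_monomialVec, if_pos rfl, if_pos rfl]
    · rw [sndCoeff_monomialVec, if_pos rfl]
  · rw [show (a : ℤ) + b + 1 = a + 1 + b by ring]
    exact inf_E'_eq_bot_of_graph hn (Psi_fst hn hp)
  · rw [show 2 * (a : ℤ) + b + 1 = a + b + 1 + a by ring]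
    exact inf_E'_eq_bot_of_graph hn (Psi_snd hn hp)

/-- The flags that satisfy the incidence conditions up to ranks lie in the image of `Ψ`. -/
theorem exists_Psi_eq_of_cod (hn : 0 < a + b) {Λ : LPair K (a + b)} (h1 : Λ.2 ≤ Λ.1)
    (h2 : tMul Λ.1 ≤ Λ.2)
    (h3 : E K (a + b) (2 * a + b + 1) ≤ Λ.1) (h4 : E K (a + b) (2 * a + 2 * b + 1) ≤ Λ.2)
    (h5 : Cod ((E K (a + b) (a + 1)).restrictScalars K) (Λ.1.restrictScalars K) b)
    (h6 : Cod ((E K (a + b) (a + b + 1)).restrictScalars K) (Λ.2.restrictScalars K) a)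
    (h7 : Λ.1.restrictScalars K ⊓ E' K (a + b) (a + b + 1) = ⊥)
    (h8 : Λ.2.restrictScalars K ⊓ E' K (a + b) (2 * a + b + 1) = ⊥) :
    ∃ p ∈ circ K a b, Psi p = Λ := by
  rw [inf_E'_eq_bot_iff hn] at h7 h8
  obtain ⟨X, hX⟩ := CoordSystem.exists_eq_graph_of_cod (C := loopCoords K hn) (s := b) (r := a)
    (j := a + 1) (fun _ _ _ => trivial) (L := Λ.1.restrictScalars K)
    (by
      rw [loopCoords_above, show (a : ℤ) + 1 + b + a = 2 * a + b + 1 by ring]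
      exact h3)
    (by rwa [loopCoords_above])
    (by
      rw [show (a : ℤ) + 1 + b = a + b + 1 by ring]
      exact h7)
  obtain ⟨Y, hY⟩ := CoordSystem.exists_eq_graph_of_cod (C := loopCoords K hn) (s := a) (r := b)
    (j := a + b + 1) (fun _ _ _ => trivial) (L := Λ.2.restrictScalars K)
    (by
      rw [loopCoords_above, show (a : ℤ) + b + 1 + a + b = 2 * a + 2 * b + 1 by ring]
      exact h4)
    (by rwa [loopCoords_above])
    (by
      rw [show (a : ℤ) + b + 1 + a = 2 * a + b + 1 by ring]
      exact h8)
  exact ⟨_, eq_Psi_of_graph hn hX hY h1 h2⟩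

theorem exists_Psi_eq_of_mem_latticeLocus (ha : 0 < a) (hb : 0 < b) {c : ℕ} {Λ : LPair K (a + b)}
    (h : Λ ∈ latticeLocus K a b c) :
    ∃ p ∈ circ K a b, (p.1.rank ≤ c ∧ p.2.rank ≤ a - c) ∧ Psi p = Λ := by
  have hn : 0 < a + b := by omega
  obtain ⟨⟨-, -, h1, h2, -⟩, -, h3, -, h4, h5, -, h6, -, h7, h8, h9, h10⟩ := h
  obtain ⟨p, hp, rfl⟩ := exists_Psi_eq_of_cod hn h1 h2 h3 h4 (cod_of_finrank_lquot hb h5)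
    (cod_of_finrank_lquot ha h6) h7 h8
  rw [finrank_lquot_Psi_fst hn hp] at h9
  rw [finrank_lquot_Psi_snd hn hp] at h10
  exact ⟨p, hp, ⟨h9, h10⟩, rfl⟩

theorem image_component_eq_latticeLocus {k : Type u} [Field k] [Algebra k K] (ha : 0 < a)
    (hab : a ≤ b) {c : ℕ} (hc : c ≤ a) :
    Psi '' component k a b c K = latticeLocus K a b c := by
  ext Λ
  constructor
  · rintro ⟨p, hp, rfl⟩
    rw [mem_component_iff hab hc] at hp
    exact Psi_mem_latticeLocus (by omega) hp.1 hp.2.1 hp.2.2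
  · intro h
    obtain ⟨p, hp, hr, rfl⟩ := exists_Psi_eq_of_mem_latticeLocus ha (by omega) h
    exact ⟨p, (mem_component_iff hab hc p).2 ⟨hp, hr⟩, rfl⟩

end LatticeLocus

/-! ### The block permutation, its degree and the indices it misses -/

section BlockPerm

variable (a b c : ℕ)

/-- The shift of the block permutation on the residue class of `r + 1`, for `0 ≤ r < a + b`. -/
def blockShift (r : ℤ) : ℤ :=
  if r < c then a else if r < a then a + 2 * b else if r < 2 * a - c then b else
    if r < a + b - c then b + 2 * c else 2 * a + b

/-- The shift of the inverse of the block permutation on the residue class of `r + 1`. -/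
def blockUnshift (r : ℤ) : ℤ :=
  if r < a - c then b else if r < a then 2 * a + b else if r < a + c then a else
    if r < b + c then b + 2 * c else a + 2 * b

variable {a b c}

/-- The five blocks of residues are permuted by translations, so the target residue knows the shift
that led to it; this makes the two residue-wise shifts inverse to each other. -/
theorem exists_blockShift (hab : a ≤ b) (hc : c ≤ a) {r : ℤ} (h0 : 0 ≤ r) (h1 : r < (a + b : ℕ)) :
    ∃ k r' : ℤ, 0 ≤ r' ∧ r' < (a + b : ℕ) ∧ r + blockShift a b c r = r' + (a + b : ℕ) * k ∧
      blockUnshift a b c r' = blockShift a b c r := by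
  simp only [blockShift, blockUnshift]
  push_cast at h1 ⊢
  split_ifs with h2 h3 h4 h5
  · exact ⟨0, r + a, by omega, by omega, by ring, by
      rw [if_neg (by omega), if_neg (by omega), if_pos (by omega)]⟩
  · exact ⟨1, r + b, by omega, by omega, by ring, by
      rw [if_neg (by omega), if_neg (by omega), if_neg (by omega), if_neg (by omega)]⟩
  · exact ⟨1, r - a, by omega, by omega, by ring, by rw [if_pos (by omega)]⟩
  · exact ⟨1, r + 2 * c - a, by omega, by omega, by ring, by
      rw [if_neg (by omega), if_neg (by omega), if_neg (by omega), if_pos (by omega)]⟩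
  · exact ⟨2, r - b, by omega, by omega, by ring, by
      rw [if_neg (by omega), if_pos (by omega)]⟩

theorem exists_blockUnshift (hab : a ≤ b) (hc : c ≤ a) {r : ℤ} (h0 : 0 ≤ r)
    (h1 : r < (a + b : ℕ)) :
    ∃ k r' : ℤ, 0 ≤ r' ∧ r' < (a + b : ℕ) ∧ r - blockUnshift a b c r = r' + (a + b : ℕ) * k ∧
      blockShift a b c r' = blockUnshift a b c r := by
  simp only [blockShift, blockUnshift]
  push_cast at h1 ⊢
  split_ifs with h2 h3 h4 h5
  · exact ⟨-1, r + a, by omega, by omega, by ring, by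
      rw [if_neg (by omega), if_neg (by omega), if_pos (by omega)]⟩
  · exact ⟨-2, r + b, by omega, by omega, by ring, by
      rw [if_neg (by omega), if_neg (by omega), if_neg (by omega), if_neg (by omega)]⟩
  · exact ⟨0, r - a, by omega, by omega, by ring, by rw [if_pos (by omega)]⟩
  · exact ⟨-1, r + a - 2 * c, by omega, by omega, by ring, by
      rw [if_neg (by omega), if_neg (by omega), if_neg (by omega), if_pos (by omega)]⟩
  · exact ⟨-1, r - b, by omega, by omega, by ring, by
      rw [if_neg (by omega), if_pos (by omega)]⟩

theorem blockUnshift_le (hab : a ≤ b) (hc : c ≤ a) {r : ℤ} :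
    blockUnshift a b c r ≤ a + 2 * b := by
  rw [blockUnshift]
  split_ifs <;> omega

/-- The permutation of the integers given by the block formula. -/
def blockEquiv (hn : 0 < a + b) (hab : a ≤ b) (hc : c ≤ a) : Equiv.Perm ℤ where
  toFun i := i + blockShift a b c ((i - 1) % (a + b : ℕ))
  invFun i := i - blockUnshift a b c ((i - 1) % (a + b : ℕ))
  left_inv i := by
    have hpos : (0 : ℤ) < (a + b : ℕ) := by exact_mod_cast hn
    obtain ⟨k, r', h1, h2, h3, h4⟩ := exists_blockShift hab hc
      (Int.emod_nonneg (i - 1) hpos.ne') (Int.emod_lt_of_pos (i - 1) hpos)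
    have h5 := Int.mul_ediv_add_emod (i - 1) (a + b : ℕ)
    have h6 : i + blockShift a b c ((i - 1) % (a + b : ℕ)) - 1 =
        r' + (a + b : ℕ) * (k + (i - 1) / (a + b : ℕ)) := by
      rw [mul_add]
      linarith
    simp only
    rw [h6, Int.add_mul_emod_self_left, Int.emod_eq_of_lt h1 h2, h4]
    ring
  right_inv i := by
    have hpos : (0 : ℤ) < (a + b : ℕ) := by exact_mod_cast hn
    obtain ⟨k, r', h1, h2, h3, h4⟩ := exists_blockUnshift hab hc
      (Int.emod_nonneg (i - 1) hpos.ne') (Int.emod_lt_of_pos (i - 1) hpos)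
    have h5 := Int.mul_ediv_add_emod (i - 1) (a + b : ℕ)
    have h6 : i - blockUnshift a b c ((i - 1) % (a + b : ℕ)) - 1 =
        r' + (a + b : ℕ) * (k + (i - 1) / (a + b : ℕ)) := by
      rw [mul_add]
      linarith
    simp only
    rw [h6, Int.add_mul_emod_self_left, Int.emod_eq_of_lt h1 h2, h4]
    ring

/-- The element of the affine Weyl group given by the block formula. -/
def blockPerm (hn : 0 < a + b) (hab : a ≤ b) (hc : c ≤ a) : affineWeyl (a + b) :=
  ⟨blockEquiv hn hab hc, by
    rw [affineWeyl, Subgroup.mem_centralizer_iff]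
    rintro _ rfl
    ext i
    change i + blockShift a b c ((i - 1) % (a + b : ℕ)) + (a + b : ℕ) =
      i + (a + b : ℕ) + blockShift a b c ((i + (a + b : ℕ) - 1) % (a + b : ℕ))
    rw [show i + ((a + b : ℕ) : ℤ) - 1 = i - 1 + (a + b : ℕ) by ring, Int.add_emod_right]
    ring⟩

variable (hn : 0 < a + b) (hab : a ≤ b) (hc : c ≤ a)

theorem blockPerm_apply (i : ℤ) :
    (blockPerm hn hab hc).1 i = i + blockShift a b c ((i - 1) % (a + b : ℕ)) := rfl

theorem blockPerm_symm_apply (i : ℤ) :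
    (blockPerm hn hab hc).1.symm i = i - blockUnshift a b c ((i - 1) % (a + b : ℕ)) := rfl

theorem blockPerm_apply_of_mem {i : ℤ} (h1 : 1 ≤ i) (h2 : i ≤ (a + b : ℕ)) :
    (blockPerm hn hab hc).1 i = i + blockShift a b c (i - 1) := by
  rw [blockPerm_apply, Int.emod_eq_of_lt (by omega) (by omega)]

theorem isBlockPerm_blockPerm : IsBlockPerm a b c (blockPerm hn hab hc) := by
  intro i
  refine ⟨fun h1 h2 => ?_, fun h1 h2 => ?_, fun h1 h2 => ?_, fun h1 h2 => ?_, fun h1 h2 => ?_⟩ <;>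
    rw [blockPerm_apply_of_mem hn hab hc (by omega) (by push_cast; omega), blockShift]
  · rw [if_pos (by omega)]; ring
  · rw [if_neg (by omega), if_pos (by omega)]; ring
  · rw [if_neg (by omega), if_neg (by omega), if_pos (by omega)]; ring
  · rw [if_neg (by omega), if_neg (by omega), if_neg (by omega), if_pos (by omega)]; ring
  · rw [if_neg (by omega), if_neg (by omega), if_neg (by omega), if_neg (by omega)]; ring

theorem sum_Icc_ite_le {n m x : ℤ} (h0 : 0 ≤ m) (hm : m ≤ n) :
    ∑ i ∈ Finset.Icc 1 n, (if m ≤ i - 1 then x else 0) = (n - m) * x := by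
  rw [← Finset.sum_filter]
  have : (Finset.Icc 1 n).filter (fun i => m ≤ i - 1) = Finset.Icc (m + 1) n := by
    ext i
    simp only [Finset.mem_filter, Finset.mem_Icc]
    omega
  rw [this, Finset.sum_const, Int.card_Icc, nsmul_eq_mul, Int.toNat_of_nonneg (by omega)]
  ring

/-- The shifts over one period add up to `n²`, so the degree is `n = a + b`. The complements in the
definition of the opposite cell are therefore `E'_{a+b+1} = E'_(3)` and `E'_{2a+b+1} = E'_(4)`. -/
theorem degree_blockPerm : degree (blockPerm hn hab hc) = (a + b : ℕ) := by
  -- The shift is constant on five blocks; it is written as the sum of its jumps at the block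
  -- boundaries.
  have h : ∀ i ∈ Finset.Icc (1 : ℤ) (a + b : ℕ), (blockPerm hn hab hc).1 i - i =
      (if (0 : ℤ) ≤ i - 1 then (a : ℤ) else 0) + (if (c : ℤ) ≤ i - 1 then (2 * b : ℤ) else 0) +
      (if (a : ℤ) ≤ i - 1 then (-a - b : ℤ) else 0) +
      (if (2 * a - c : ℤ) ≤ i - 1 then (2 * c : ℤ) else 0) +
      (if (a + b - c : ℤ) ≤ i - 1 then (2 * a - 2 * c : ℤ) else 0) := by
    intro i hi
    rw [Finset.mem_Icc] at hi
    rw [blockPerm_apply_of_mem hn hab hc hi.1 hi.2, blockShift]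
    split_ifs <;> omega
  rw [degree, Finset.sum_congr rfl h]
  simp only [Finset.sum_add_distrib]
  rw [sum_Icc_ite_le le_rfl (by omega), sum_Icc_ite_le (by omega) (by push_cast; omega),
    sum_Icc_ite_le (by omega) (by push_cast; omega), sum_Icc_ite_le (by omega) (by push_cast; omega),
    sum_Icc_ite_le (by omega) (by push_cast; omega)]
  rw [Int.ediv_eq_iff_eq_mul_left (by omega)]
  · push_cast
    ring
  · refine ⟨(a + b : ℕ), ?_⟩
    push_cast
    ring

theorem le_blockPerm_symm_of_lt {m : ℤ} (h1 : (a + b : ℕ) < m) (h2 : m ≤ 2 * (a + b : ℕ)) :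
    (blockPerm hn hab hc).1.symm m = m - blockUnshift a b c (m - 1 - (a + b : ℕ)) := by
  rw [blockPerm_symm_apply, ← Int.sub_emod_right, Int.emod_eq_of_lt (by omega) (by omega)]

theorem blockPerm_symm_of_le {m : ℤ} (h1 : 1 ≤ m) (h2 : m ≤ (a + b : ℕ)) :
    (blockPerm hn hab hc).1.symm m = m - blockUnshift a b c (m - 1) := by
  rw [blockPerm_symm_apply, Int.emod_eq_of_lt (by omega) (by omega)]

/-- The indices from `a + 1` on that the block permutation does not reach from `[1, ∞)`. -/
theorem one_le_blockPerm_symm {m : ℤ} (h : a + 1 ≤ m) :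
    1 ≤ (blockPerm hn hab hc).1.symm m ∨ m ∈ Finset.Ioc (a + c : ℤ) (a + b) ∨
      m ∈ Finset.Ioc (2 * a + b - c : ℤ) (2 * a + b) := by
  simp only [Finset.mem_Ioc]
  rcases le_or_gt m (a + b : ℕ) with h1 | h1
  · rw [blockPerm_symm_of_le hn hab hc (by omega) h1, blockUnshift]
    split_ifs <;> omega
  rcases le_or_gt m (2 * (a + b : ℕ)) with h2 | h2
  · rw [le_blockPerm_symm_of_lt hn hab hc h1 h2, blockUnshift]
    push_cast at h1 h2 ⊢
    split_ifs <;> omega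
  · left
    rw [blockPerm_symm_apply]
    have := blockUnshift_le hab hc (r := (m - 1) % (a + b : ℕ))
    push_cast at this h2 ⊢
    omega

/-- The indices from `a + b + 1` on that the block permutation does not reach from `[a + 1, ∞)`. -/
theorem succ_le_blockPerm_symm {m : ℤ} (h : a + b + 1 ≤ m) :
    a + 1 ≤ (blockPerm hn hab hc).1.symm m ∨ m ∈ Finset.Ioc (2 * a + b - c : ℤ) (2 * a + b) ∨
      m ∈ Finset.Ioc (a + 2 * b + c : ℤ) (2 * a + 2 * b) := by
  simp only [Finset.mem_Ioc]
  rcases le_or_gt m (2 * (a + b : ℕ)) with h2 | h2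
  · rw [le_blockPerm_symm_of_lt hn hab hc (by push_cast; omega) h2, blockUnshift]
    push_cast at h2 ⊢
    split_ifs <;> omega
  · left
    rw [blockPerm_symm_apply]
    have := blockUnshift_le hab hc (r := (m - 1) % (a + b : ℕ))
    push_cast at this h2 ⊢
    omega

end BlockPerm

/-! ### Coordinate lattices of affine permutations -/

section PermE

variable {R : Type u} [CommRing R] {n : ℕ}

theorem affineWeyl_apply_add (π : affineWeyl n) (i : ℤ) : π.1 (i + n) = π.1 i + n := by
  have := Subgroup.mem_centralizer_iff.1 π.2 (Equiv.addRight (n : ℤ)) rfl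
  exact (Equiv.congr_fun this i).symm

theorem affineWeyl_apply_add_mul (π : affineWeyl n) (i : ℤ) (k : ℕ) :
    π.1 (i + n * k) = π.1 i + n * k := by
  induction k with
  | zero => simp
  | succ k ih =>
    rw [Nat.cast_succ, mul_add, mul_one, ← add_assoc, affineWeyl_apply_add, ih, add_assoc]

theorem e_mem_permE (hn : 0 < n) (π : affineWeyl n) {i j : ℤ} (h : j ≤ i) :
    e R n (π.1 i) ∈ permE R π j := by
  have hpos : (0 : ℤ) < n := by exact_mod_cast hn
  have h1 := Int.emod_nonneg (i - j) hpos.ne'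
  have h2 := Int.emod_lt_of_pos (i - j) hpos
  have h3 := Int.mul_ediv_add_emod (i - j) n
  have h4 : 0 ≤ (i - j) / n := Int.ediv_nonneg (by omega) hpos.le
  obtain ⟨k, hk⟩ := Int.eq_ofNat_of_zero_le h4
  rw [show i = j + (i - j) % n + n * k by rw [← hk]; omega, affineWeyl_apply_add_mul,
    ← X_pow_smul_e hn]
  exact Submodule.smul_mem _ _ (Submodule.subset_span ⟨_, ⟨by omega, by omega⟩, rfl⟩)

theorem permE_antitone (hn : 0 < n) (π : affineWeyl n) {i j : ℤ} (h : i ≤ j) :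
    permE R π j ≤ permE R π i := by
  refine Submodule.span_le.2 ?_
  rintro _ ⟨m, hm, rfl⟩
  exact e_mem_permE hn π (h.trans hm.1)

theorem tMul_permE_le (hn : 0 < n) (π : affineWeyl n) {i j : ℤ} (h : i ≤ j + n) :
    tMul (permE R π j) ≤ permE R π i := by
  rw [tMul, permE, Submodule.map_span, Submodule.span_le]
  rintro _ ⟨_, ⟨m, hm, rfl⟩, rfl⟩
  change (PowerSeries.X : R⟦X⟧) • e R n (π.1 m) ∈ permE R π i
  rw [X_smul_e hn, ← affineWeyl_apply_add]
  exact e_mem_permE hn π (by have := hm.1; omega)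

/-- The vectors `e_m` with `m ≥ j` that are not in the coordinate lattice have `m ∈ S`, and they
span `E_j` modulo it. The bound `M` on `S` puts the whole tail `E_M` inside the lattice, so only
finite sums are involved. -/
theorem cod_permE {K : Type u} [Field K] (hn : 0 < n) (π : affineWeyl n) {i j M : ℤ} {d : ℕ}
    (S : Finset ℤ) (hS : S.card ≤ d) (h1 : ∀ m, j ≤ m → i ≤ π.1.symm m ∨ m ∈ S)
    (h2 : ∀ m ∈ S, m < M) (h3 : j ≤ M) :
    Cod ((E K n j).restrictScalars K) ((permE K π i).restrictScalars K) d := by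
  classical
  have hmem : ∀ m, i ≤ π.1.symm m → e K n m ∈ permE K π i := by
    intro m hm
    have := e_mem_permE (R := K) hn π hm
    rwa [Equiv.apply_symm_apply] at this
  have hM : E K n M ≤ permE K π i := by
    refine Submodule.span_le.2 ?_
    rintro _ ⟨m, hm, rfl⟩
    refine hmem m ((h1 m (h3.trans hm.1)).resolve_right fun h => ?_)
    exact absurd (h2 m h) (not_lt.2 hm.1)
  refine cod_of_span (S.image (e K n)) (Finset.card_image_le.trans hS) fun v hv => ?_
  have h4 : v - segment j M v ∈ E K n M := (mem_E hn).2 fun m hm => by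
    rw [coordAt_sub, coordAt_segment hn]
    split_ifs with h
    · exact sub_self _
    · rw [sub_zero]
      exact (mem_E hn).1 hv m (by omega)
  rw [← sub_add_cancel v (segment j M v)]
  refine Submodule.add_mem _ (Submodule.mem_sup_left (hM h4)) ?_
  refine Submodule.sum_mem _ fun m hm => Submodule.smul_mem _ _ ?_
  rcases h1 m (Finset.mem_Ico.1 hm).1 with h | h
  · exact Submodule.mem_sup_left (hmem m h)
  · exact Submodule.mem_sup_right (Submodule.subset_span (Finset.mem_coe.2
      (Finset.mem_image_of_mem _ h)))

end PermE

/-! ### The Iwahori group and the standard lattices -/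

section Iwahori

variable {K : Type u} [Field K] {n : ℕ}

/-- The constant terms form an invertible lower triangular matrix, whose inverse is again lower
triangular. -/
theorem inv_mem_iwahori {g : GL (Fin n) K⟦X⟧} (hg : g ∈ iwahori K n) : g⁻¹ ∈ iwahori K n := by
  let g₀ : Matrix (Fin n) (Fin n) K := g.1.map PowerSeries.constantCoeff
  let h₀ : Matrix (Fin n) (Fin n) K := (g⁻¹).1.map PowerSeries.constantCoeff
  have h1 : g₀ * h₀ = 1 := by
    rw [← Matrix.map_mul, ← Units.val_mul, mul_inv_cancel, Units.val_one,
      Matrix.map_one _ (map_zero _) (map_one _)]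
  let _ : Invertible g₀ := invertibleOfRightInverse _ _ h1
  have h2 : g₀⁻¹ = h₀ := Matrix.inv_eq_right_inv h1
  have h3 : g₀.BlockTriangular OrderDual.toDual := fun i j hij => hg i j hij
  have h4 := Matrix.blockTriangular_inv_of_blockTriangular h3
  rw [h2] at h4
  exact fun i j hij => h4 (show OrderDual.toDual j < OrderDual.toDual i from hij)

/-- Multiplication by such a matrix takes `e_m` to a vector without coordinates before `m`. -/
theorem translate_E_le (hn : 0 < n) {H : Matrix (Fin n) (Fin n) K⟦X⟧}
    (hH : ∀ i j, i < j → PowerSeries.constantCoeff (H i j) = 0) (j : ℤ) :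
    translate (H.map (algebraMap K⟦X⟧ K⸨X⸩)) (E K n j) ≤ E K n j := by
  rw [translate, E, Submodule.map_span, Submodule.span_le]
  rintro _ ⟨_, ⟨m, hm, rfl⟩, rfl⟩
  change (H.map (algebraMap K⟦X⟧ K⸨X⸩)).mulVec (e K n m) ∈ E K n j
  refine E_antitone hn hm.1 ((mem_E hn).2 fun m' hm' => ?_)
  obtain ⟨q, i, rfl⟩ := exists_index hn m
  obtain ⟨q', l, rfl⟩ := exists_index hn m'
  have h1 := e_index_smul (R := K) q i 1
  rw [one_smul, (HahnSeries.ofPowerSeries ℤ K).map_one, mul_one] at h1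
  rw [coordAt_index, h1, Matrix.mulVec_single]
  change (HahnSeries.ofPowerSeries ℤ K (H l i) * HahnSeries.single q 1).coeff q' = 0
  rw [mul_comm, HahnSeries.coeff_single_mul, one_mul, PowerSeries.coeff_coe]
  split_ifs with h2
  · rfl
  have h3 : q' = q := by
    by_contra h4
    have h5 : q + 1 ≤ q' := by omega
    have h6 : (n : ℤ) * (q + 1) ≤ n * q' := mul_le_mul_of_nonneg_left h5 (by omega)
    rw [mul_add] at h6
    omega
  subst h3
  have h4 : l < i := by rw [Fin.lt_def]; omega
  rw [sub_self, Int.natAbs_zero, PowerSeries.coeff_zero_eq_constantCoeff_apply]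
  exact hH l i h4

theorem mulVec_inv_cancel (g : GL (Fin n) K⟦X⟧) (v : LoopSpace K n) :
    (g.1.map (algebraMap K⟦X⟧ K⸨X⸩)).mulVec (((g⁻¹).1.map (algebraMap K⟦X⟧ K⸨X⸩)).mulVec v) = v := by
  rw [Matrix.mulVec_mulVec, ← Matrix.map_mul, ← Units.val_mul, mul_inv_cancel]
  simp

/-- Since `g⁻¹` preserves `E_j`, positions relative to `E_j` are constant on Iwahori orbits; it is
enough to compute them at coordinate flags. -/
theorem cod_translate (hn : 0 < n) {g : GL (Fin n) K⟦X⟧} (hg : g ∈ iwahori K n) {j : ℤ} {d : ℕ}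
    {Λ : Submodule K⟦X⟧ (LoopSpace K n)}
    (h : Cod ((E K n j).restrictScalars K) (Λ.restrictScalars K) d) :
    Cod ((E K n j).restrictScalars K)
      ((translate (g.1.map (algebraMap K⟦X⟧ K⸨X⸩)) Λ).restrictScalars K) d := by
  obtain ⟨U, hU, hr, hJ⟩ := h.map
    (((Matrix.mulVecLin (g.1.map (algebraMap K⟦X⟧ K⸨X⸩))).restrictScalars K⟦X⟧).restrictScalars K)
  refine ⟨U, hU, hr, le_trans (fun v hv => ?_) hJ⟩
  exact ⟨_, translate_E_le hn (inv_mem_iwahori hg) j ⟨v, hv, rfl⟩, mulVec_inv_cancel g v⟩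

end Iwahori

/-! ### Incidence conditions on affine Schubert varieties -/

section Closed

variable {k : Type u} [Field k]

/-- Below the window nothing happens and beyond it everything lies in `Λ`, so the codimension can be
computed in the finite-dimensional window and lifted back by a linear section. -/
theorem cod_window_iff {K : Type u} [Field K] {n : ℕ} (hn : 0 < n) {m₀ j : ℤ} {l d : ℕ}
    (hj : m₀ ≤ j) {Λ : Submodule K⟦X⟧ (LoopSpace K n)} (h' : Λ ≤ E K n m₀)
    (h : E K n (m₀ + l) ≤ Λ) :
    Cod ((E K n j).restrictScalars K) (Λ.restrictScalars K) d ↔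
      Cod ((finCoords K m₀ l).above j) ((Λ.restrictScalars K).map (window K n m₀ l)) d := by
  let s : (Fin l → K) →ₗ[K] LoopSpace K n :=
    Fintype.linearCombination K (fun i : Fin l => e K n (m₀ + (i : ℕ)))
  have hs : ∀ u m, coordAt m (s u) = (finCoords K m₀ l).coord m u := by
    intro u m
    simp only [s, Fintype.linearCombination_apply, coordAt_sum, coordAt_smul, coordAt_e hn]
    by_cases hm : m₀ ≤ m ∧ m < m₀ + l
    · obtain ⟨i, rfl⟩ := CoordSystem.ge_cases hm.1 hm.2
      rw [finCoords_coord_of_mem, Finset.sum_eq_single i]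
      · simp
      · intro i' _ hi'
        rw [if_neg fun h => hi' (Fin.ext (by omega)), mul_zero]
      · simp
    · rw [finCoords_coord_of_notMem hm, Finset.sum_eq_zero]
      intro i _
      rw [if_neg (by omega), mul_zero]
  have hws : ∀ u, window K n m₀ l (s u) = u := fun u => funext fun i => by
    rw [window_apply, hs, finCoords_coord_of_mem]
  have hmap : ((E K n j).restrictScalars K).map (window K n m₀ l) = (finCoords K m₀ l).above j := by
    apply le_antisymm
    · rintro _ ⟨v, hv, rfl⟩ m hm
      rw [finCoords_coord_window]
      split_ifs
      · exact (mem_E hn).1 hv m hm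
      · rfl
    · exact fun u hu => ⟨s u, (mem_E hn).2 fun m hm => (hs u m).trans (hu m hm), hws u⟩
  constructor
  · intro h
    rw [← hmap]
    exact h.map _
  · rintro ⟨U, hU, hr, hJ⟩
    refine ⟨U.map s, inferInstance, (Submodule.finrank_map_le _ _).trans hr, fun v hv => ?_⟩
    have h1 : window K n m₀ l v ∈ (finCoords K m₀ l).above j := by
      rw [← hmap]
      exact ⟨v, hv, rfl⟩
    obtain ⟨_, ⟨x, hx, rfl⟩, u, hu, hxu⟩ := Submodule.mem_sup.1 (hJ h1)
    have h2 : window K n m₀ l (v - x - s u) = 0 := by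
      rw [map_sub, map_sub, hws, ← hxu]
      abel
    have h3 : v - x - s u ∈ E K n m₀ := Submodule.sub_mem _
      (Submodule.sub_mem _ (E_antitone hn hj hv) (h' hx)) ((mem_E hn).2 fun m hm => by
        rw [hs, finCoords_coord_of_notMem (by omega)])
    have h4 := Submodule.add_mem _ (h (mem_E_of_window_eq_zero hn h3 h2)) hx
    rw [show v = v - x - s u + x + s u by abel]
    exact Submodule.add_mem_sup h4 ⟨u, hu, rfl⟩

/-- The relative position of a lattice to a standard lattice is a closed condition. -/
theorem exists_ideal_cod_lattice {R : Type u} [CommRing R] [Algebra k R] {n : ℕ} (hn : 0 < n)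
    {Λ : Submodule R⟦X⟧ (LoopSpace R n)} (hΛ : IsLattice R n Λ) {j : ℤ} (hj : 1 ≤ j) (d : ℕ) :
    ∃ I : Ideal R, ∀ (K : Type u) [Field K] [Algebra k K] (φ : R →ₐ[k] K),
      Cod ((E K n j).restrictScalars K) ((pullLattice φ.toRingHom Λ).restrictScalars K) d ↔
        ∀ f ∈ I, φ f = 0 := by
  obtain ⟨N, h1, h2, h3⟩ := hΛ
  have h4 : 1 + (n : ℤ) * N = 1 - n * N + (2 * (n * N) : ℕ) := by push_cast; ring
  have h5 : 1 - (n : ℤ) * N ≤ j := by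
    have : 0 ≤ (n : ℤ) * N := by positivity
    omega
  rw [h4] at h1
  obtain ⟨I, hI⟩ := exists_ideal_cod (k := k) _ (projective_window hn h2 h1 h3)
    {i | j ≤ 1 - (n : ℤ) * N + (i : ℕ)} d
  refine ⟨I, fun K _ _ φ => ?_⟩
  rw [← hI K φ, cod_window_iff hn h5 (pullLattice_le_E hn _ h2) (E_le_pullLattice hn _ h1),
    window_pullLattice hn, finCoords_above_eq_coordSpan]
  rfl

theorem exists_ideal_and {R : Type u} [CommRing R] [Algebra k R]
    {P Q : ∀ (K : Type u) [Field K] [Algebra k K], (R →ₐ[k] K) → Prop}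
    (hP : ∃ I : Ideal R, ∀ (K : Type u) [Field K] [Algebra k K] (φ : R →ₐ[k] K),
      P K φ ↔ ∀ f ∈ I, φ f = 0)
    (hQ : ∃ I : Ideal R, ∀ (K : Type u) [Field K] [Algebra k K] (φ : R →ₐ[k] K),
      Q K φ ↔ ∀ f ∈ I, φ f = 0) :
    ∃ I : Ideal R, ∀ (K : Type u) [Field K] [Algebra k K] (φ : R →ₐ[k] K),
      (P K φ ∧ Q K φ) ↔ ∀ f ∈ I, φ f = 0 := by
  obtain ⟨I, hI⟩ := hP
  obtain ⟨J, hJ⟩ := hQ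
  refine ⟨I ⊔ J, fun K _ _ φ => ?_⟩
  rw [hI, hJ]
  change (I ≤ RingHom.ker φ ∧ J ≤ RingHom.ker φ) ↔ I ⊔ J ≤ RingHom.ker φ
  exact sup_le_iff.symm

/-- The incidence conditions that bound an affine Schubert variety of a block permutation. -/
def schubertLocus (k : Type u) [Field k] (a b c : ℕ) : Locus (affFlag k a b) :=
  fun K _ _ => {Λ : LPair K (a + b) |
    (Cod ((E K (a + b) (a + 1)).restrictScalars K) (Λ.1.restrictScalars K) b ∧
      Cod ((E K (a + b) (a + b + 1)).restrictScalars K) (Λ.1.restrictScalars K) c ∧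
      Cod ((E K (a + b) (2 * a + b + 1)).restrictScalars K) (Λ.1.restrictScalars K) 0) ∧
    Cod ((E K (a + b) (a + b + 1)).restrictScalars K) (Λ.2.restrictScalars K) a ∧
      Cod ((E K (a + b) (2 * a + b + 1)).restrictScalars K) (Λ.2.restrictScalars K) (a - c) ∧
      Cod ((E K (a + b) (2 * a + 2 * b + 1)).restrictScalars K) (Λ.2.restrictScalars K) 0}

theorem isClosed_schubertLocus {a b : ℕ} (hn : 0 < a + b) (c : ℕ) :
    (schubertLocus k a b c).IsClosed := by
  intro R _ _ Λ hΛ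
  have h1 : IsLattice R (a + b) Λ.1 := hΛ.1
  have h2 : IsLattice R (a + b) Λ.2 := hΛ.2.1
  exact exists_ideal_and (exists_ideal_and (exists_ideal_cod_lattice hn h1 (by omega) _)
      (exists_ideal_and (exists_ideal_cod_lattice hn h1 (by omega) _)
        (exists_ideal_cod_lattice hn h1 (by omega) _)))
    (exists_ideal_and (exists_ideal_cod_lattice hn h2 (by omega) _)
      (exists_ideal_and (exists_ideal_cod_lattice hn h2 (by omega) _)
        (exists_ideal_cod_lattice hn h2 (by omega) _)))

/-- By invariance under the Iwahori group the bounds are the numbers of missed indices. For `Λ₁`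
there are `b - c` of them in `(a+c, a+b]` and `c` in `(2a+b-c, 2a+b]`; for `Λ₂` there are the same
`c` and `a - c` more in `(a+2b+c, 2a+2b]`. -/
theorem affCell_subset_schubertLocus {a b c : ℕ} (hn : 0 < a + b) (hab : a ≤ b) (hc : c ≤ a)
    (K : Type u) [Field K] [Algebra k K] :
    affCell k a b (blockPerm hn hab hc) K ⊆ schubertLocus k a b c K := by
  rintro _ ⟨g, hg, rfl⟩
  have h1 := fun m => one_le_blockPerm_symm hn hab hc (m := m)
  have h2 := fun m => succ_le_blockPerm_symm hn hab hc (m := m)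
  simp only [Finset.mem_Ioc] at h1 h2
  refine ⟨⟨cod_translate hn hg (cod_permE hn _ (M := 2 * a + b + 1)
        (Finset.Ioc (a + c : ℤ) (a + b) ∪ Finset.Ioc (2 * a + b - c : ℤ) (2 * a + b)) ?_ ?_ ?_ ?_),
      cod_translate hn hg (cod_permE hn _ (M := 2 * a + b + 1)
        (Finset.Ioc (2 * a + b - c : ℤ) (2 * a + b)) ?_ ?_ ?_ ?_),
      cod_translate hn hg (cod_permE hn _ (M := 2 * a + b + 1) ∅ ?_ ?_ ?_ ?_)⟩,
    cod_translate hn hg (cod_permE hn _ (M := 2 * a + 2 * b + 1)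
      (Finset.Ioc (2 * a + b - c : ℤ) (2 * a + b) ∪
        Finset.Ioc (a + 2 * b + c : ℤ) (2 * a + 2 * b)) ?_ ?_ ?_ ?_),
    cod_translate hn hg (cod_permE hn _ (M := 2 * a + 2 * b + 1)
      (Finset.Ioc (a + 2 * b + c : ℤ) (2 * a + 2 * b)) ?_ ?_ ?_ ?_),
    cod_translate hn hg (cod_permE hn _ (M := 2 * a + 2 * b + 1) ∅ ?_ ?_ ?_ ?_)⟩
  · refine (Finset.card_union_le _ _).trans ?_
    rw [Int.card_Ioc, Int.card_Ioc]
    omega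
  · intro m hm
    rw [Finset.mem_union, Finset.mem_Ioc, Finset.mem_Ioc]
    exact h1 m hm
  · intro m hm
    rw [Finset.mem_union, Finset.mem_Ioc, Finset.mem_Ioc] at hm
    omega
  · omega
  · rw [Int.card_Ioc]
    omega
  · intro m hm
    rw [Finset.mem_Ioc]
    have := h1 m (by omega)
    omega
  · intro m hm
    rw [Finset.mem_Ioc] at hm
    omega
  · omega
  · simp
  · intro m hm
    have := h1 m (by omega)
    omega
  · simp
  · omega
  · refine (Finset.card_union_le _ _).trans ?_
    rw [Int.card_Ioc, Int.card_Ioc]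
    omega
  · intro m hm
    rw [Finset.mem_union, Finset.mem_Ioc, Finset.mem_Ioc]
    exact h2 m hm
  · intro m hm
    rw [Finset.mem_union, Finset.mem_Ioc, Finset.mem_Ioc] at hm
    omega
  · omega
  · rw [Int.card_Ioc]
    omega
  · intro m hm
    rw [Finset.mem_Ioc]
    have := h2 m (by omega)
    omega
  · intro m hm
    rw [Finset.mem_Ioc] at hm
    omega
  · omega
  · simp
  · intro m hm
    have := h2 m (by omega)
    omega
  · simp
  · omega

/-- A flag that satisfies the incidence conditions and lies in the opposite big cell belongs to the
image of `Ψ`. -/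
theorem exists_Psi_eq_of_mem_schubertLocus {K : Type u} [Field K] [Algebra k K] {a b c : ℕ}
    (hn : 0 < a + b) {Λ : LPair K (a + b)} (h : Λ ∈ schubertLocus k a b c K) (h1 : Λ.2 ≤ Λ.1)
    (h2 : tMul Λ.1 ≤ Λ.2)
    (h3 : Λ.1.restrictScalars K ⊓ E' K (a + b) (a + b + 1) = ⊥)
    (h4 : Λ.2.restrictScalars K ⊓ E' K (a + b) (2 * a + b + 1) = ⊥) :
    ∃ p ∈ circ K a b, (p.1.rank ≤ c ∧ p.2.rank ≤ a - c) ∧ Psi p = Λ := by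
  obtain ⟨⟨c1, c2, c3⟩, c4, c5, c6⟩ := h
  rw [cod_zero_iff] at c3 c6
  obtain ⟨p, hp, rfl⟩ := exists_Psi_eq_of_cod hn h1 h2 c3 c6 c1 c4 h3 h4
  refine ⟨p, hp, ⟨?_, ?_⟩, rfl⟩
  · refine CoordSystem.rank_le_of_cod (C := loopCoords K hn) (j := a + 1) (fun _ _ _ => trivial) ?_
    rw [loopCoords_above, ← Psi_fst hn hp, show (a : ℤ) + 1 + b = a + b + 1 by ring]
    exact c2
  · refine CoordSystem.rank_le_of_cod (C := loopCoords K hn) (j := a + b + 1)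
      (fun _ _ _ => trivial) ?_
    rw [loopCoords_above, ← Psi_snd hn hp, show (a : ℤ) + b + 1 + a = 2 * a + b + 1 by ring]
    exact c5

/-- The incidence conditions hold on the cell and are closed, so they hold on the Schubert variety;
transversality to the complements then puts the flag in the image of `Ψ` with the rank bounds. -/
theorem affOpp_subset {a b c : ℕ} (hn : 0 < a + b) (hab : a ≤ b) (hc : c ≤ a)
    (K : Type u) [Field K] [Algebra k K] :
    affOpp k a b (blockPerm hn hab hc) K ⊆ Psi '' component k a b c K := by
  rintro Λ ⟨⟨⟨-, -, h1, h2, -⟩, h3⟩, h4, h5⟩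
  rw [degree_blockPerm, show (1 : ℤ) + (a + b : ℕ) = a + b + 1 by push_cast; ring] at h4
  rw [degree_blockPerm, show (a : ℤ) + 1 + (a + b : ℕ) = 2 * a + b + 1 by push_cast; ring] at h5
  have h6 := h3 _ (isClosed_schubertLocus hn c) fun L _ _ =>
    affCell_subset_schubertLocus hn hab hc L
  obtain ⟨p, hp, hr, rfl⟩ := exists_Psi_eq_of_mem_schubertLocus hn h6 h1 h2 h4 h5
  exact ⟨p, (mem_component_iff hab hc p).2 ⟨hp, hr⟩, rfl⟩

end Closed

/-! ### Echelon vectors of complexes with invertible corners -/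

section Echelon

variable {K : Type u} [Field K]

/-- Vectors supported on the last `d` entries see only the corner in the first `d` rows, and the
corner is invertible. -/
theorem exists_mulVec_eq_of_corner {m n d : ℕ} {hm : d ≤ m} {hn : d ≤ n}
    {A : Matrix (Fin m) (Fin n) K} (h : (corner d hm hn A).det ≠ 0) (z : Fin m → K) :
    ∃ w : Fin n → K, (∀ l : Fin n, (l : ℕ) < n - d → w l = 0) ∧
      ∀ i : Fin m, (i : ℕ) < d → A.mulVec w i = z i := by
  have hu : IsUnit (corner d hm hn A) :=
    (Matrix.isUnit_iff_isUnit_det _).2 (isUnit_iff_ne_zero.2 h)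
  obtain ⟨w, hw⟩ := Matrix.mulVec_surjective_iff_isUnit.2 hu fun i => z (Fin.castLE hm i)
  let f : Fin d → Fin n := fun j => ⟨n - d + j, by omega⟩
  have hf : Function.Injective f := fun i j hij => by
    have := congrArg Fin.val hij
    simp only [f] at this
    exact Fin.ext (by omega)
  have hr : ∀ l : Fin n, (l : ℕ) < n - d → l ∉ Set.range f := by
    rintro _ hl ⟨j, rfl⟩
    simp only [f] at hl
    omega
  refine ⟨Function.extend f w 0, fun l hl => ?_, fun i hi => ?_⟩
  · exact Function.extend_apply' _ _ _ (hr l hl)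
  · have h1 := congrFun hw ⟨i, hi⟩
    refine Eq.trans ?_ h1
    refine (Fintype.sum_of_injective f hf _ _ (fun l hl => ?_) fun j => ?_).symm
    · rw [Function.extend_apply' _ _ _ hl]
      exact mul_zero _
    · rw [hf.extend_apply]
      rfl

/-- Since the rank is `d`, vectors of the range are determined by their first `d` entries. The image
of a unit vector can thus be cancelled by a vector supported on the last `d` entries. -/
theorem exists_ker_eq_of_corner {m n d : ℕ} {hm : d ≤ m} {hn : d ≤ n}
    {A : Matrix (Fin m) (Fin n) K} (h : (corner d hm hn A).det ≠ 0) (hr : A.rank ≤ d)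
    (j : Fin n) :
    ∃ y : Fin n → K, A.mulVec y = 0 ∧ ∀ l : Fin n, (l : ℕ) < n - d → y l = if l = j then 1 else 0 := by
  obtain ⟨w, hw, hw'⟩ := exists_mulVec_eq_of_corner h (A.mulVec (Pi.single j 1))
  let f : LinearMap.range A.mulVecLin →ₗ[K] (Fin d → K) :=
    LinearMap.funLeft K K (Fin.castLE hm) ∘ₗ Submodule.subtype _
  have hsurj : Function.Surjective f := by
    intro z
    obtain ⟨x, -, hx⟩ := exists_mulVec_eq_of_corner h (Function.extend (Fin.castLE hm) z 0)
    refine ⟨⟨_, x, rfl⟩, funext fun i => ?_⟩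
    refine (hx (Fin.castLE hm i) i.2).trans ?_
    exact (Fin.castLE_injective hm).extend_apply _ _ _
  have hfr : Module.finrank K (LinearMap.range A.mulVecLin) = Module.finrank K (Fin d → K) := by
    refine le_antisymm ?_ (LinearMap.finrank_le_finrank_of_surjective hsurj)
    rw [Module.finrank_fin_fun]
    exact hr
  have hinj := (LinearMap.injective_iff_surjective_of_finrank_eq_finrank hfr).2 hsurj
  refine ⟨Pi.single j 1 - w, ?_, fun l hl => ?_⟩
  · have : (⟨_, Pi.single j 1 - w, rfl⟩ : LinearMap.range A.mulVecLin) = 0 := by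
      apply hinj
      rw [map_zero]
      funext i
      change A.mulVec (Pi.single j 1 - w) (Fin.castLE hm i) = 0
      rw [Matrix.mulVec_sub, Pi.sub_apply, hw' _ i.2, sub_self]
    exact congrArg Subtype.val this
  · rw [Pi.sub_apply, hw l hl, sub_zero, Pi.single_apply]

theorem isUnit_of_lowerTriangular {n : ℕ} {H : Matrix (Fin n) (Fin n) K}
    (h1 : ∀ i j, i < j → H i j = 0) (h2 : ∀ i, H i i = 1) : IsUnit H := by
  rw [Matrix.isUnit_iff_isUnit_det, Matrix.det_of_isLowerTriangular H fun i j hij => h1 i j hij,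
    Finset.prod_eq_one fun i _ => h2 i]
  exact isUnit_one

theorem isUnit_of_constantCoeff {n : ℕ} {H : Matrix (Fin n) (Fin n) K⟦X⟧}
    (h : IsUnit (H.map PowerSeries.constantCoeff)) : IsUnit H := by
  rw [Matrix.isUnit_iff_isUnit_det] at h ⊢
  rw [PowerSeries.isUnit_iff_constantCoeff, RingHom.map_det]
  exact h

variable {a b c : ℕ} {p : MatPair K a b}

/-- The pairs are the data of vectors `(t x, y)` with leading entry at `j` in the last block: values
of `X` for the first `c` positions, kernel vectors of `Y` in the middle, and plain unit vectors for
the last `a - c` positions. -/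
theorem exists_echelon_snd (hab : a ≤ b) (hc : c ≤ a) (hr : p.2.rank ≤ a - c)
    (h1 : (corner c (hc.trans hab) hc p.1).det ≠ 0)
    (h2 : (corner (a - c) (Nat.sub_le a c) ((Nat.sub_le a c).trans hab) p.2).det ≠ 0) (j : Fin b) :
    ∃ (x : Fin a → K) (y : Fin b → K), (∀ i < j, y i = 0) ∧ y j = 1 ∧
      ((j : ℕ) < c → p.1.mulVec x = y) ∧ (c ≤ (j : ℕ) → x = 0) ∧
      (c ≤ (j : ℕ) → (j : ℕ) < b - (a - c) → p.2.mulVec y = 0) := by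
  rcases lt_or_ge (j : ℕ) c with h | h
  · obtain ⟨x, -, hx⟩ := exists_mulVec_eq_of_corner h1 (Pi.single j 1)
    refine ⟨x, _, fun i hi => ?_, ?_, fun _ => rfl, fun h' => absurd h (by omega),
      fun h' => absurd h (by omega)⟩
    · rw [hx i (by have := Fin.lt_def.1 hi; omega), Pi.single_eq_of_ne hi.ne]
    · rw [hx j h, Pi.single_eq_same]
  rcases lt_or_ge (j : ℕ) (b - (a - c)) with h' | h'
  · obtain ⟨y, hy, hy'⟩ := exists_ker_eq_of_corner h2 hr j
    refine ⟨0, y, fun i hi => ?_, ?_, fun h'' => absurd h'' (by omega), fun _ => rfl, fun _ _ => hy⟩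
    · rw [hy' i (by have := Fin.lt_def.1 hi; omega), if_neg hi.ne]
    · rw [hy' j h', if_pos rfl]
  · exact ⟨0, Pi.single j 1, fun i hi => Pi.single_eq_of_ne hi.ne _, Pi.single_eq_same _ _,
      fun h'' => absurd h'' (by omega), fun _ => rfl, fun _ h'' => absurd h'' (by omega)⟩

/-- The analogue for leading entries in the first block: values of `Y` for the first `a - c`
positions, unit vectors for the remaining `c`. -/
theorem exists_echelon_fst (hab : a ≤ b)
    (h2 : (corner (a - c) (Nat.sub_le a c) ((Nat.sub_le a c).trans hab) p.2).det ≠ 0) (i : Fin a) :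
    ∃ (x : Fin a → K) (y : Fin b → K), (∀ i' < i, x i' = 0) ∧ x i = 1 ∧
      ((i : ℕ) < a - c → p.2.mulVec y = x) := by
  rcases lt_or_ge (i : ℕ) (a - c) with h | h
  · obtain ⟨y, -, hy⟩ := exists_mulVec_eq_of_corner h2 (Pi.single i 1)
    refine ⟨_, y, fun i' hi => ?_, ?_, fun _ => rfl⟩
    · rw [hy i' (by have := Fin.lt_def.1 hi; omega), Pi.single_eq_of_ne hi.ne]
    · rw [hy i h, Pi.single_eq_same]
  · exact ⟨Pi.single i 1, 0, fun i' hi => Pi.single_eq_of_ne hi.ne _, Pi.single_eq_same _ _,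
      fun h' => absurd h' (by omega)⟩

end Echelon

/-! ### Generic flags lie in the Schubert cell -/

section Cell

variable {K : Type u} [Field K] {a b c : ℕ}

/-- The matrix `[[A, t ξ], [η, B]]` of power series. -/
noncomputable def echelonMat (A : Matrix (Fin a) (Fin a) K) (ξ : Matrix (Fin a) (Fin b) K)
    (η : Matrix (Fin b) (Fin a) K) (B : Matrix (Fin b) (Fin b) K) :
    Matrix (Fin (a + b)) (Fin (a + b)) K⟦X⟧ :=
  blockMat (A.map PowerSeries.C) ((PowerSeries.X : K⟦X⟧) • ξ.map PowerSeries.C) (η.map PowerSeries.C)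
    (B.map PowerSeries.C)

variable (A : Matrix (Fin a) (Fin a) K) (ξ : Matrix (Fin a) (Fin b) K)
  (η : Matrix (Fin b) (Fin a) K) (B : Matrix (Fin b) (Fin b) K)

theorem echelonMat_map : (echelonMat A ξ η B).map (algebraMap K⟦X⟧ K⸨X⸩) =
    blockMat (A.map HahnSeries.C) (t K • ξ.map HahnSeries.C) (η.map HahnSeries.C)
      (B.map HahnSeries.C) := by
  ext i j : 1
  refine Fin.addCases (fun i => ?_) (fun i => ?_) i <;>
    refine Fin.addCases (fun j => ?_) (fun j => ?_) j <;>
    simp [echelonMat, blockMat, LaurentSeries.coe_algebraMap, HahnSeries.ofPowerSeries_C,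
      HahnSeries.ofPowerSeries_X, t]

theorem fstCoeff_echelonMat (v : LoopSpace K (a + b)) (q : ℤ) :
    fstCoeff K a b q (((echelonMat A ξ η B).map (algebraMap K⟦X⟧ K⸨X⸩)).mulVec v) =
      A.mulVec (fstCoeff K a b q v) + ξ.mulVec (sndCoeff K a b (q - 1) v) := by
  funext i
  rw [echelonMat_map, fstCoeff_apply, blockMat_mulVec_castAdd, HahnSeries.coeff_add]
  simp [Matrix.mulVec, dotProduct, fstCoeff_apply, sndCoeff_apply, HahnSeries.coeff_sum, mul_assoc,
    coeff_t_mul]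

theorem sndCoeff_echelonMat (v : LoopSpace K (a + b)) (q : ℤ) :
    sndCoeff K a b q (((echelonMat A ξ η B).map (algebraMap K⟦X⟧ K⸨X⸩)).mulVec v) =
      η.mulVec (fstCoeff K a b q v) + B.mulVec (sndCoeff K a b q v) := by
  funext i
  rw [echelonMat_map, sndCoeff_apply, blockMat_mulVec_natAdd, HahnSeries.coeff_add]
  simp [Matrix.mulVec, dotProduct, fstCoeff_apply, sndCoeff_apply, HahnSeries.coeff_sum]

theorem constantCoeff_echelonMat (hA : ∀ i j, i < j → A i j = 0) (hB : ∀ i j, i < j → B i j = 0)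
    {i j : Fin (a + b)} (hij : i < j) :
    PowerSeries.constantCoeff (echelonMat A ξ η B i j) = 0 := by
  revert hij
  refine Fin.addCases (fun i => ?_) (fun i => ?_) i <;>
    refine Fin.addCases (fun j => ?_) (fun j => ?_) j <;> intro hij <;>
    simp only [Fin.lt_def, Fin.val_castAdd, Fin.val_natAdd] at hij
  · simp [echelonMat, blockMat, hA i j (Fin.lt_def.2 hij)]
  · simp [echelonMat, blockMat]
  · omega
  · simp [echelonMat, blockMat, hB i j (Fin.lt_def.2 (by omega))]

theorem constantCoeff_echelonMat_diag (hA : ∀ i, A i i = 1) (hB : ∀ i, B i i = 1)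
    (i : Fin (a + b)) : PowerSeries.constantCoeff (echelonMat A ξ η B i i) = 1 := by
  refine Fin.addCases (fun i => ?_) (fun i => ?_) i <;> simp [echelonMat, blockMat, hA, hB]

theorem e_index_eq {n : ℕ} (q : ℤ) (i : Fin n) :
    e K n (n * q + i + 1) = Pi.single i (HahnSeries.single q 1) := by
  have h1 := e_index_smul (R := K) q i 1
  rwa [one_smul, (HahnSeries.ofPowerSeries ℤ K).map_one, mul_one] at h1

theorem e_fst_eq (q : ℤ) (i : Fin a) : e K (a + b) (((a + b : ℕ) : ℤ) * q + (i : ℕ) + 1) =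
    monomialVec q (Pi.single i 1) 0 0 := by
  have h := e_index_eq (K := K) q (Fin.castAdd b i)
  rw [Fin.val_castAdd] at h
  rw [h]
  refine ext_coeff (fun q' => ?_) (fun q' => ?_) <;> funext j
  · rw [fstCoeff_monomialVec, fstCoeff_apply]
    by_cases hj : j = i
    · subst hj
      rw [Pi.single_eq_same, HahnSeries.coeff_single]
      split_ifs <;> simp
    · rw [Pi.single_eq_of_ne (by simpa using hj)]
      split_ifs <;> simp [hj]
  · rw [sndCoeff_monomialVec, ite_self, sndCoeff_apply, Pi.single_eq_of_ne]
    · rfl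
    · intro h
      have := congrArg Fin.val h
      simp at this
      omega

theorem e_snd_eq (q : ℤ) (i : Fin b) : e K (a + b) (((a + b : ℕ) : ℤ) * q + a + (i : ℕ) + 1) =
    monomialVec 0 0 q (Pi.single i 1) := by
  have h := e_index_eq (K := K) q (Fin.natAdd a i)
  rw [Fin.val_natAdd] at h
  rw [show ((a + b : ℕ) : ℤ) * q + a + (i : ℕ) + 1 = ((a + b : ℕ) : ℤ) * q + (a + i : ℕ) + 1 by
    push_cast; ring, h]
  refine ext_coeff (fun q' => ?_) (fun q' => ?_) <;> funext j
  · rw [fstCoeff_monomialVec, ite_self, fstCoeff_apply, Pi.single_eq_of_ne]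
    · rfl
    · intro h
      have := congrArg Fin.val h
      simp at this
      omega
  · rw [sndCoeff_monomialVec, sndCoeff_apply]
    by_cases hj : j = i
    · subst hj
      rw [Pi.single_eq_same, HahnSeries.coeff_single]
      split_ifs <;> simp
    · rw [Pi.single_eq_of_ne (by simpa using hj)]
      split_ifs <;> simp [hj]

/-- The flag of a complex with invertible corners lies in the Schubert cell. -/
theorem exists_iwahori_mem_Psi {p : MatPair K a b} (hn : 0 < a + b) (hab : a ≤ b) (hc : c ≤ a)
    (hp : p ∈ circ K a b) (hr : p.2.rank ≤ a - c)
    (h1 : (corner c (hc.trans hab) hc p.1).det ≠ 0)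
    (h2 : (corner (a - c) (Nat.sub_le a c) ((Nat.sub_le a c).trans hab) p.2).det ≠ 0) :
    ∃ g ∈ iwahori K (a + b), ∀ i : ℤ, 1 ≤ i → i ≤ (a + b : ℕ) →
      (g.1.map (algebraMap K⟦X⟧ K⸨X⸩)).mulVec (e K (a + b) ((blockPerm hn hab hc).1 i)) ∈ (Psi p).1 ∧
      (a + 1 ≤ i → (g.1.map (algebraMap K⟦X⟧ K⸨X⸩)).mulVec
        (e K (a + b) ((blockPerm hn hab hc).1 i)) ∈ (Psi p).2) := by
  choose x y hy0 hy1 hxy hx0 hker using exists_echelon_snd hab hc hr h1 h2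
  choose x' y' hx0' hx1' hxy' using exists_echelon_fst (c := c) hab h2
  -- The columns of the Iwahori matrix are the echelon vectors `(x', y')` and `(t x, y)`; the
  -- leading ones make its constant term unipotent lower triangular.
  let A : Matrix (Fin a) (Fin a) K := Matrix.of fun i j => x' j i
  let ξ : Matrix (Fin a) (Fin b) K := Matrix.of fun i j => x j i
  let η : Matrix (Fin b) (Fin a) K := Matrix.of fun i j => y' j i
  let B : Matrix (Fin b) (Fin b) K := Matrix.of fun i j => y j i
  have hA : ∀ j, A.mulVec (Pi.single j 1) = x' j := fun j => by
    rw [Matrix.mulVec_single_one]; rfl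
  have hξ : ∀ j, ξ.mulVec (Pi.single j 1) = x j := fun j => by
    rw [Matrix.mulVec_single_one]; rfl
  have hη : ∀ j, η.mulVec (Pi.single j 1) = y' j := fun j => by
    rw [Matrix.mulVec_single_one]; rfl
  have hB : ∀ j, B.mulVec (Pi.single j 1) = y j := fun j => by
    rw [Matrix.mulVec_single_one]; rfl
  have hlow : ∀ i j, i < j → PowerSeries.constantCoeff (echelonMat A ξ η B i j) = 0 := fun i j =>
    constantCoeff_echelonMat A ξ η B (fun i j hij => hx0' j i hij) fun i j hij => hy0 j i hij
  have hu : IsUnit (echelonMat A ξ η B) := isUnit_of_constantCoeff (isUnit_of_lowerTriangular hlow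
    fun i => constantCoeff_echelonMat_diag A ξ η B hx1' hy1 i)
  refine ⟨hu.unit, hlow, fun i hi1 hi2 => ?_⟩
  rw [IsUnit.unit_spec]
  let G := (echelonMat A ξ η B).map (algebraMap K⟦X⟧ K⸨X⸩)
  have gfst : ∀ (q : ℤ) (j : Fin a) (q' : ℤ), fstCoeff K a b q' (G.mulVec
      (monomialVec q (Pi.single j 1) 0 0)) = if q' = q then x' j else 0 := fun q j q' => by
    rw [fstCoeff_echelonMat, fstCoeff_monomialVec, sndCoeff_monomialVec, ite_self,
      Matrix.mulVec_zero, add_zero]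
    split_ifs
    · exact hA j
    · exact Matrix.mulVec_zero _
  have gsnd : ∀ (q : ℤ) (j : Fin a) (q' : ℤ), sndCoeff K a b q' (G.mulVec
      (monomialVec q (Pi.single j 1) 0 0)) = if q' = q then y' j else 0 := fun q j q' => by
    rw [sndCoeff_echelonMat, fstCoeff_monomialVec, sndCoeff_monomialVec, ite_self,
      Matrix.mulVec_zero, add_zero]
    split_ifs
    · exact hη j
    · exact Matrix.mulVec_zero _
  have gfst' : ∀ (q : ℤ) (j : Fin b) (q' : ℤ), fstCoeff K a b q' (G.mulVec
      (monomialVec 0 0 q (Pi.single j 1))) = if q' - 1 = q then x j else 0 := fun q j q' => by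
    rw [fstCoeff_echelonMat, fstCoeff_monomialVec, sndCoeff_monomialVec, ite_self,
      Matrix.mulVec_zero, zero_add]
    split_ifs
    · exact hξ j
    · exact Matrix.mulVec_zero _
  have gsnd' : ∀ (q : ℤ) (j : Fin b) (q' : ℤ), sndCoeff K a b q' (G.mulVec
      (monomialVec 0 0 q (Pi.single j 1))) = if q' = q then y j else 0 := fun q j q' => by
    rw [sndCoeff_echelonMat, fstCoeff_monomialVec, sndCoeff_monomialVec, ite_self,
      Matrix.mulVec_zero, zero_add]
    split_ifs
    · exact hB j
    · exact Matrix.mulVec_zero _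
  change G.mulVec _ ∈ _ ∧ (_ → G.mulVec _ ∈ _)
  have hle := Psi_snd_le_fst hn hp
  rw [blockPerm_apply_of_mem hn hab hc hi1 hi2, blockShift]
  push_cast at hi2
  -- One case for each block of `π_c`. In order: `y = X x` gives a vector of `Λ₁`; a vector `e_m`
  -- with `m > 2a+b` is moved within `E_(4) ⊆ Λ₁`; `x' = Y y'` gives a vector of `Λ₂`; so does a
  -- kernel vector of `Y`; and the last block is moved within `E_(5) ⊆ Λ₂`.
  split_ifs with s1 s2 s3 s4
  · obtain ⟨j, hj⟩ := CoordSystem.ge_cases (j := 1) (s := c) hi1 (by omega)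
    have hjc := j.2
    refine ⟨?_, fun h => by omega⟩
    rw [show i + a = ((a + b : ℕ) : ℤ) * 0 + a + ((⟨j, by omega⟩ : Fin b) : ℕ) + 1 by
      simp only; omega, e_snd_eq]
    refine (mem_Psi_fst hn hp).2 ⟨fun q hq => ?_, fun q hq => ?_, ?_⟩
    · rw [gfst', if_neg (by omega)]
    · rw [gsnd', if_neg (by omega)]
    · rw [gfst', gsnd', if_pos rfl, if_pos (by ring)]
      exact (hxy _ hjc).symm
  · obtain ⟨j, hj⟩ := CoordSystem.ge_cases (j := c + 1) (m := i) (s := a - c) (by omega) (by omega)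
    have hjc := j.2
    refine ⟨?_, fun h => by omega⟩
    rw [show i + (a + 2 * b) = ((a + b : ℕ) : ℤ) * 1 + a +
      ((⟨b - (a - c) + j, by omega⟩ : Fin b) : ℕ) + 1 by push_cast; omega, e_snd_eq]
    refine (mem_Psi_fst hn hp).2 ⟨fun q hq => ?_, fun q hq => ?_, ?_⟩
    · rw [gfst', if_neg (by omega)]
    · rw [gsnd', if_neg (by omega)]
    · rw [gfst', gsnd', if_neg (by omega), if_neg (by omega), Matrix.mulVec_zero]
  · obtain ⟨j, hj⟩ := CoordSystem.ge_cases (j := a + 1) (m := i) (s := a - c) (by omega) (by omega)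
    have hjc := j.2
    have key : G.mulVec (e K (a + b) (i + b)) ∈ (Psi p).2 := by
      rw [show i + b = ((a + b : ℕ) : ℤ) * 1 + ((⟨j, by omega⟩ : Fin a) : ℕ) + 1 by
        push_cast; omega, e_fst_eq]
      refine (mem_Psi_snd hn hp).2 ⟨fun q hq => ?_, fun q hq => ?_, ?_⟩
      · rw [gfst, if_neg (by omega)]
      · rw [gsnd, if_neg (by omega)]
      · rw [gfst, gsnd, if_pos rfl, if_pos rfl]
        exact (hxy' _ hjc).symm
    exact ⟨hle key, fun _ => key⟩
  · obtain ⟨j, hj⟩ := CoordSystem.ge_cases (j := 2 * a - c + 1) (m := i) (s := b - a) (by omega)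
      (by omega)
    have hjc := j.2
    have key : G.mulVec (e K (a + b) (i + (b + 2 * c))) ∈ (Psi p).2 := by
      rw [show i + (b + 2 * c) = ((a + b : ℕ) : ℤ) * 1 + a +
        ((⟨c + j, by omega⟩ : Fin b) : ℕ) + 1 by push_cast; omega, e_snd_eq]
      refine (mem_Psi_snd hn hp).2 ⟨fun q hq => ?_, fun q hq => ?_, ?_⟩
      · rw [gfst', if_neg (by omega)]
      · rw [gsnd', if_neg (by omega)]
      · rw [gfst', gsnd', if_neg (by omega), if_pos rfl]
        exact (hker _ (by simp) (by simp only; omega)).symm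
    exact ⟨hle key, fun _ => key⟩
  · obtain ⟨j, hj⟩ := CoordSystem.ge_cases (j := a + b - c + 1) (m := i) (s := c) (by omega)
      (by omega)
    have hjc := j.2
    have key : G.mulVec (e K (a + b) (i + (2 * a + b))) ∈ (Psi p).2 := by
      rw [show i + (2 * a + b) = ((a + b : ℕ) : ℤ) * 2 +
        ((⟨a - c + j, by omega⟩ : Fin a) : ℕ) + 1 by push_cast; omega, e_fst_eq]
      refine (mem_Psi_snd hn hp).2 ⟨fun q hq => ?_, fun q hq => ?_, ?_⟩
      · rw [gfst, if_neg (by omega)]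
      · rw [gsnd, if_neg (by omega)]
      · rw [gfst, gsnd, if_neg (by omega), if_neg (by omega), Matrix.mulVec_zero]
    exact ⟨hle key, fun _ => key⟩

/-- The Iwahori matrix of echelon vectors moves the coordinate flag into `Ψ(p)`. The moved flag lies
in the cell, hence satisfies the incidence conditions, and it inherits transversality from `Ψ(p)`.
It is therefore some `Ψ(p')`, and inclusion of graphs forces `p' = p`. -/
theorem Psi_mem_affCell {k : Type u} [Field k] [Algebra k K] {p : MatPair K a b} (hn : 0 < a + b)
    (hab : a ≤ b) (hc : c ≤ a) (hp : p ∈ circ K a b) (hr : p.2.rank ≤ a - c)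
    (h1 : (corner c (hc.trans hab) hc p.1).det ≠ 0)
    (h2 : (corner (a - c) (Nat.sub_le a c) ((Nat.sub_le a c).trans hab) p.2).det ≠ 0) :
    Psi p ∈ affCell k a b (blockPerm hn hab hc) K := by
  obtain ⟨g, hg, hgp⟩ := exists_iwahori_mem_Psi hn hab hc hp hr h1 h2
  let π := blockPerm hn hab hc
  let G := g.1.map (algebraMap K⟦X⟧ K⸨X⸩)
  let f : LoopSpace K (a + b) →ₗ[K⟦X⟧] LoopSpace K (a + b) :=
    (Matrix.mulVecLin G).restrictScalars K⟦X⟧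
  let Λ : LPair K (a + b) := translateFlag G (permE K π 1, permE K π (a + 1))
  have hΛ : Λ ∈ affCell k a b π K := ⟨g, hg, rfl⟩
  have le1 : Λ.1 ≤ (Psi p).1 := by
    change Submodule.map f (permE K π 1) ≤ _
    rw [permE, Submodule.map_span_le]
    rintro _ ⟨i, hi, rfl⟩
    exact (hgp i hi.1 (by have := hi.2; omega)).1
  have le2 : Λ.2 ≤ (Psi p).2 := by
    change Submodule.map f (permE K π (a + 1)) ≤ _
    rw [permE, Submodule.map_span_le]
    rintro _ ⟨i, hi, rfl⟩
    rcases le_or_gt i (a + b : ℕ) with h | h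
    · exact (hgp i (by have := hi.1; omega) h).2 hi.1
    -- Indices beyond the period are obtained from the first ones by multiplication with `t`, and
    -- `tΛ₁ ⊆ Λ₂`.
    · have h3 := (hgp (i - (a + b : ℕ)) (by omega)
        (by have := hi.2; push_cast at this ⊢; omega)).1
      have h4 : f (e K (a + b) (π.1 i)) =
          (PowerSeries.X : K⟦X⟧) • f (e K (a + b) (π.1 (i - (a + b : ℕ)))) := by
        rw [← map_smul, X_smul_e hn, ← affineWeyl_apply_add, sub_add_cancel]
      change f _ ∈ _
      rw [h4]
      exact tMul_Psi_fst_le_snd hn hp ⟨_, h3, rfl⟩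
  have h3 : Λ.2 ≤ Λ.1 := Submodule.map_mono (permE_antitone hn π (by omega))
  have h4 : tMul Λ.1 ≤ Λ.2 := by
    rintro _ ⟨_, ⟨w, hw, rfl⟩, rfl⟩
    exact ⟨(PowerSeries.X : K⟦X⟧) • w,
      tMul_permE_le hn π (i := a + 1) (by push_cast; omega) ⟨w, hw, rfl⟩, map_smul f _ _⟩
  have h5 : Λ.1.restrictScalars K ⊓ E' K (a + b) (a + b + 1) = ⊥ := by
    rw [eq_bot_iff, ← inf_E'_eq_bot_of_graph hn (Psi_fst hn hp),
      show (a : ℤ) + 1 + b = a + b + 1 by ring]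
    exact inf_le_inf_right _ le1
  have h6 : Λ.2.restrictScalars K ⊓ E' K (a + b) (2 * a + b + 1) = ⊥ := by
    rw [eq_bot_iff, ← inf_E'_eq_bot_of_graph hn (Psi_snd hn hp),
      show (a : ℤ) + b + 1 + a = 2 * a + b + 1 by ring]
    exact inf_le_inf_right _ le2
  obtain ⟨p', hp', -, h7⟩ := exists_Psi_eq_of_mem_schubertLocus hn
    (affCell_subset_schubertLocus (k := k) hn hab hc K hΛ) h3 h4 h5 h6
  have h8 : p' = p := by
    refine Prod.ext (CoordSystem.graph_injective (C := loopCoords K hn) (j := a + 1)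
      (fun _ _ _ => trivial) ?_) (CoordSystem.graph_injective (C := loopCoords K hn)
      (j := a + b + 1) (fun _ _ _ => trivial) ?_)
    · rw [← Psi_fst hn hp, ← Psi_fst hn hp', h7]
      exact le1
    · rw [← Psi_snd hn hp, ← Psi_snd hn hp', h7]
      exact le2
  rw [← h8, h7]
  exact hΛ

/-- The inclusion of `Ψ(𝓛_c)` in the closure of the cell is tested on closed loci along the generic
family; the reverse inclusion is `affOpp_subset`. -/
theorem image_component_eq_affOpp {k : Type u} [Field k] [Algebra k K] (hn : 0 < a + b)
    (hab : a ≤ b) (hc : c ≤ a) :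
    Psi '' component k a b c K = affOpp k a b (blockPerm hn hab hc) K := by
  refine subset_antisymm ?_ (affOpp_subset hn hab hc K)
  rintro _ ⟨p, hp, rfl⟩
  rw [mem_component_iff hab hc] at hp
  obtain ⟨hp, hr1, hr2⟩ := hp
  refine ⟨⟨isAffFlag_Psi hn hp, fun Z hZ hcell => ?_⟩, ?_, ?_⟩
  · obtain ⟨D, _, _, _, P, L, _, _, ψ, hψ, hP, r1, r2, c1, c2, hs⟩ :=
      exists_generic_circ_field k hab hc
    obtain ⟨I, hI⟩ := hZ D (Psi P) (isAffFlag_Psi hn hP)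
    have hpull : ∀ (K' : Type u) [Field K'] [Algebra k K'] (φ : D →ₐ[k] K'),
        (affFlag k a b).pull φ (Psi P) = Psi (mapPair φ P) :=
      fun K' _ _ φ => pullLattice_Psi hn φ.toRingHom hP
    -- The generic point of the family lies in the cell, so `I` is killed by the injective `ψ`;
    -- hence `I = 0` and every specialization belongs to `Z`.
    have h1 := (hI L ψ).1 (by
      rw [hpull]
      exact hcell L (Psi_mem_affCell hn hab hc (map_mem_circ (ψ : D →+* L) hP) r2 c1 c2))
    obtain ⟨φ, rfl⟩ := hs K p hp hr1 hr2
    have h2 := (hI K φ).2 fun f hf => by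
      have h3 : f = 0 := hψ (by rw [h1 f hf, map_zero])
      rw [h3, map_zero]
    rwa [hpull] at h2
  · rw [degree_blockPerm, show (1 : ℤ) + (a + b : ℕ) = a + 1 + b by push_cast; ring]
    exact inf_E'_eq_bot_of_graph hn (Psi_fst hn hp)
  · rw [degree_blockPerm, show (a : ℤ) + 1 + (a + b : ℕ) = a + b + 1 + a by push_cast; ring]
    exact inf_E'_eq_bot_of_graph hn (Psi_snd hn hp)

end Cell

/-! ### Graphs in the ordinary flag variety -/

section OrdCoords

variable {R : Type u} [CommRing R] {a b : ℕ}

/-- The coordinates of `R^{a+2b}` with the indices of the basis vectors `ē_i`. -/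
abbrev ordCoords (R : Type u) [CommRing R] (a b : ℕ) : CoordSystem R (FinSpace R a b) :=
  finCoords R (a + 1) (a + 2 * b)

theorem ordCoords_supp {m : ℤ} (h1 : a + 1 ≤ m) (h2 : m < 2 * a + 2 * b + 1) :
    m ∈ (ordCoords R a b).supp := ⟨h1, by push_cast; omega⟩

theorem Ebar_eq_above (j : ℕ) : Ebar R a b j = (ordCoords R a b).above j := by
  rw [finCoords_above_eq_coordSpan, Ebar, coordSpan]
  congr 1
  ext v
  constructor
  · rintro ⟨i, hi, rfl⟩
    exact ⟨⟨i, show (j : ℤ) ≤ a + 1 + (i : ℕ) by omega⟩, rfl⟩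
  · rintro ⟨⟨i, hi⟩, rfl⟩
    have hi' : (j : ℤ) ≤ a + 1 + (i : ℕ) := hi
    exact ⟨i, by omega, rfl⟩

theorem mem_Ebar' {j : ℕ} {v : FinSpace R a b} :
    v ∈ Ebar' R a b j ↔ ∀ m ≥ (j : ℤ), (ordCoords R a b).coord m v = 0 := by
  have h : Ebar' R a b j = coordSpan R {i : Fin (a + 2 * b) | a + 1 + (i : ℕ) < j} := by
    rw [Ebar', coordSpan]
    congr 1
    ext v
    constructor
    · rintro ⟨i, hi, rfl⟩
      exact ⟨⟨i, hi⟩, rfl⟩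
    · rintro ⟨⟨i, hi⟩, rfl⟩
      exact ⟨i, hi, rfl⟩
  rw [h, mem_coordSpan]
  constructor
  · intro h m hm
    by_cases hm' : (a + 1 : ℤ) ≤ m ∧ m < a + 1 + (a + 2 * b : ℕ)
    · obtain ⟨i, rfl⟩ := CoordSystem.ge_cases hm'.1 hm'.2
      rw [finCoords_coord_of_mem]
      refine h i fun hi => ?_
      have hi' : a + 1 + (i : ℕ) < j := hi
      omega
    · exact finCoords_coord_of_notMem hm' v
  · intro h i hi
    have hi' : ¬ a + 1 + (i : ℕ) < j := hi
    rw [← finCoords_coord_of_mem (m₀ := a + 1) i v]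
    exact h _ (by omega)

theorem inf_Ebar'_eq_bot_iff {j : ℕ} {U : Submodule R (FinSpace R a b)} :
    U ⊓ Ebar' R a b j = ⊥ ↔
      ∀ v ∈ U, (∀ m ≥ (j : ℤ), (ordCoords R a b).coord m v = 0) → v = 0 := by
  rw [eq_bot_iff]
  constructor
  · exact fun h v hv h' => h ⟨hv, mem_Ebar'.2 h'⟩
  · exact fun h v hv => h v hv.1 (mem_Ebar'.1 hv.2)

/-- The quotient of `R^l` by a graph is free. -/
theorem exists_quotient_graph_equiv {m₀ : ℤ} {l s r d : ℕ} (h : d + s + r ≤ l)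
    (Θ : Matrix (Fin s) (Fin r) R) :
    Nonempty (((Fin l → R) ⧸ (finCoords R m₀ l).graph (m₀ + d) Θ) ≃ₗ[R]
      (Fin d → R) × (Fin s → R)) := by
  let C := finCoords R m₀ l
  let f : (Fin l → R) →ₗ[R] (Fin d → R) × (Fin s → R) :=
    (LinearMap.pi fun i : Fin d => C.coord (m₀ + (i : ℕ))).prod
      (LinearMap.pi fun i : Fin s => C.coord (m₀ + d + (i : ℕ)) -
        ∑ l, Θ i l • C.coord (m₀ + d + s + (l : ℕ)))
  have h1 : ∀ v i, (f v).1 i = C.coord (m₀ + (i : ℕ)) v := fun _ _ => rfl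
  have h2 : ∀ v i, (f v).2 i = C.coord (m₀ + d + (i : ℕ)) v -
      ∑ l, Θ i l * C.coord (m₀ + d + s + (l : ℕ)) v := fun v i => by
    simp [f, LinearMap.sum_apply]
  have hker : C.graph (m₀ + d) Θ = LinearMap.ker f := by
    ext v
    rw [CoordSystem.mem_graph, LinearMap.mem_ker, Prod.ext_iff]
    refine and_congr ⟨fun h0 => funext fun i => ?_, fun h0 m hm => ?_⟩
      ⟨fun h0 => funext fun i => ?_, fun h0 i => ?_⟩
    · exact h0 _ (by omega)
    · rcases lt_or_ge m m₀ with h3 | h3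
      · exact finCoords_coord_of_notMem (by omega) v
      · obtain ⟨i, rfl⟩ := CoordSystem.ge_cases h3 hm
        exact congrFun h0 i
    · rw [h2, h0 i, sub_self]
      rfl
    · have := congrFun h0 i
      rw [h2] at this
      exact sub_eq_zero.1 this
  have hs : ∀ m, m₀ ≤ m → m < m₀ + d + s → m ∈ C.supp := fun m _ _ => ⟨by omega, by omega⟩
  have hsurj : Function.Surjective f := by
    intro w
    refine ⟨C.blockVec m₀ w.1 w.2, Prod.ext (funext fun i => ?_) (funext fun i => ?_)⟩
    · rw [h1, C.coord_blockVec_fst hs]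
    · rw [h2, C.coord_blockVec_snd hs, Finset.sum_eq_zero, sub_zero]
      intro l _
      rw [C.coord_blockVec_of_ge hs _ _ (by omega), mul_zero]
  exact ⟨Submodule.quotEquivOfEq _ _ hker ≪≫ₗ f.quotKerEquivOfSurjective hsurj⟩

/-- The graph of a matrix as a point of a Grassmannian. -/
theorem exists_grassmannian_graph {m₀ : ℤ} {l s r d k : ℕ} (h : d + s + r ≤ l) (hk : d + s = k)
    {j : ℤ} (hj : j = m₀ + d) (Θ : Matrix (Fin s) (Fin r) R) :
    ∃ W : Module.Grassmannian R (Fin l → R) k, W.toSubmodule = (finCoords R m₀ l).graph j Θ := by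
  subst hj
  obtain ⟨φ⟩ := exists_quotient_graph_equiv (m₀ := m₀) h Θ
  refine ⟨⟨_, Module.Finite.equiv φ.symm, Module.Projective.of_equiv φ.symm, fun p => ?_⟩, rfl⟩
  have := p.nontrivial
  rw [Module.rankAtStalk_eq_of_equiv φ, Module.rankAtStalk_eq_finrank_of_free]
  simp [hk]

theorem finrank_quotient_grassmannian {K V : Type*} [Field K] [AddCommGroup V] [Module K V] {d : ℕ}
    (W : Module.Grassmannian K V d) : Module.finrank K (V ⧸ W.toSubmodule) = d := by
  have h := W.rankAtStalk_eq ⊥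
  rw [Module.rankAtStalk_eq_finrank_of_free] at h
  exact h

/-- The flag in `R^{a+2b}` given by the graphs of `X` and `Y`. -/
def graphFlag (p : MatPair R a b) : UPair R a b :=
  ((ordCoords R a b).graph (a + 1) p.1, (ordCoords R a b).graph (a + b + 1) p.2)

theorem graphFlag_injective : Function.Injective (graphFlag (R := R) (a := a) (b := b)) := by
  intro p p' h
  refine Prod.ext
    (CoordSystem.graph_injective (C := ordCoords R a b) (j := a + 1)
      (fun m h1 h2 => ordCoords_supp h1 (by omega)) (le_of_eq (congrArg Prod.fst h)))
    (CoordSystem.graph_injective (C := ordCoords R a b) (j := a + b + 1)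
      (fun m h1 h2 => ordCoords_supp (by omega) (by omega)) (le_of_eq (congrArg Prod.snd h)))

/-- A vector of the second graph vanishes at the lower coordinates of the first one, and its middle
coordinates there are in the image of `Y`; the equation of the first graph becomes `0 = X Y x`. -/
theorem graphFlag_snd_le_fst_iff {p : MatPair R a b} :
    (graphFlag p).2 ≤ (graphFlag p).1 ↔ p.1 * p.2 = 0 := by
  let C := ordCoords R a b
  have h1 : ∀ v ∈ (graphFlag p).2, (fun l : Fin a => C.coord (a + 1 + b + (l : ℕ)) v) =
      p.2.mulVec fun l : Fin b => C.coord (a + b + 1 + a + (l : ℕ)) v := by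
    intro v hv
    funext l
    rw [show (a : ℤ) + 1 + b = a + b + 1 by ring]
    exact hv.2 l
  constructor
  · intro h
    refine Matrix.ext_of_mulVec_single fun l => ?_
    have hs : ∀ m : ℤ, a + b + 1 ≤ m → m < a + b + 1 + a + b → m ∈ C.supp :=
      fun m h1 h2 => ordCoords_supp (by omega) (by omega)
    have hv := C.blockVec_mem_graph hs (Pi.single l 1) p.2
    rw [← Matrix.mulVec_mulVec, Matrix.zero_mulVec]
    funext i
    have h3 : C.coord (a + 1 + (i : ℕ)) _ =
      p.1.mulVec (fun l : Fin a => C.coord (a + 1 + b + (l : ℕ)) _) i := (h hv).2 i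
    have h4 : (fun l' : Fin b => C.coord (a + b + 1 + a + (l' : ℕ))
        (C.blockVec (a + b + 1) (p.2.mulVec (Pi.single l 1)) (Pi.single l 1))) = Pi.single l 1 :=
      funext fun l' => C.coord_blockVec_snd hs _ _ l'
    rw [C.coord_blockVec_of_lt hs _ _ (by omega), h1 _ hv, h4] at h3
    exact h3.symm
  · intro h v hv
    refine ⟨fun m hm => hv.1 m (by omega), fun i => ?_⟩
    rw [hv.1 _ (by omega)]
    have h3 := congrArg (fun w => p.1.mulVec w i) (h1 v hv)
    simp only [Matrix.mulVec_mulVec, h, Matrix.zero_mulVec] at h3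
    exact h3.symm

theorem isOrdFlag_graphFlag {p : MatPair R a b} (hp : p.1 * p.2 = 0) :
    IsOrdFlag R a b (graphFlag p) :=
  ⟨graphFlag_snd_le_fst_iff.2 hp,
    exists_grassmannian_graph (d := 0) (by omega) (by omega) (by push_cast; ring) p.1,
    exists_grassmannian_graph (d := b) (by omega) rfl (by ring) p.2⟩

theorem pullSub_graphFlag {S : Type u} [CommRing S] (φ : R →+* S) (p : MatPair R a b) :
    (pullSub φ (graphFlag p).1, pullSub φ (graphFlag p).2) = graphFlag (mapPair φ p) :=
  Prod.ext (spanMap_graph φ le_rfl (by push_cast; omega) p.1)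
    (spanMap_graph φ (by omega) (by push_cast; omega) p.2)

theorem truncFlag_Psi (hn : 0 < a + b) {p : MatPair R a b} (hp : p ∈ circ R a b) :
    truncFlag (Psi p) = graphFlag p := by
  refine Prod.ext ?_ ?_
  · change ((Psi p).1.restrictScalars R).map (trunc R a b) = _
    rw [Psi_fst hn hp, trunc_eq_window, window_map_graph hn le_rfl (by push_cast; omega)]
    rfl
  · change ((Psi p).2.restrictScalars R).map (trunc R a b) = _
    rw [Psi_snd hn hp, trunc_eq_window, window_map_graph hn (by omega) (by push_cast; omega)]
    rfl

theorem tBar_apply (u : FinSpace R a b) (i : Fin (a + 2 * b)) : tBar R a b u i =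
    if h : a + b ≤ (i : ℕ) then u ⟨i - (a + b), by omega⟩ else 0 := by
  change ∑ j : Fin (a + 2 * b), (if (i : ℕ) = (j : ℕ) + (a + b) then (1 : R) else 0) * u j = _
  split_ifs with h
  · rw [Finset.sum_eq_single (⟨i - (a + b), by omega⟩ : Fin (a + 2 * b))]
    · rw [if_pos (by simp only; omega), one_mul]
    · intro j _ hj
      rw [if_neg fun h' => hj (Fin.ext (by simp only; omega)), zero_mul]
    · simp
  · refine Finset.sum_eq_zero fun j _ => ?_
    rw [if_neg (by omega), zero_mul]

theorem coord_tBar (u : FinSpace R a b) (m : ℤ) : (ordCoords R a b).coord m (tBar R a b u) =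
    if m < 2 * a + 2 * b + 1 then (ordCoords R a b).coord (m - (a + b)) u else 0 := by
  by_cases hm' : (a + 1 : ℤ) ≤ m ∧ m < a + 1 + (a + 2 * b : ℕ)
  · obtain ⟨i, rfl⟩ := CoordSystem.ge_cases hm'.1 hm'.2
    rw [finCoords_coord_of_mem, tBar_apply, if_pos (by have := i.2; push_cast at *; omega)]
    split_ifs with h
    · rw [← finCoords_coord_of_mem (m₀ := a + 1) _ u]
      congr 2
      push_cast [h]
      ring
    · rw [finCoords_coord_of_notMem (by omega)]
  · rw [finCoords_coord_of_notMem hm']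
    split_ifs with h
    · rw [finCoords_coord_of_notMem (by push_cast at *; omega)]
    · rfl

/-- The operator shifts by `a + b`, so the lower coordinates `X x` of a vector of `U₁` become the
last `b` coordinates, and everything before them is zero. The equation of the second graph reads `0
= Y X x`. -/
theorem map_tBar_graphFlag_le_iff {p : MatPair R a b} :
    (graphFlag p).1.map (tBar R a b) ≤ (graphFlag p).2 ↔ p.2 * p.1 = 0 := by
  let C := ordCoords R a b
  have h1 : ∀ u ∈ (graphFlag p).1, ∀ i : Fin b, C.coord (a + b + 1 + a + (i : ℕ)) (tBar R a b u) =
      p.1.mulVec (fun l : Fin a => C.coord (a + 1 + b + (l : ℕ)) u) i := by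
    intro u hu i
    rw [coord_tBar, if_pos (by omega),
      show (a : ℤ) + b + 1 + a + (i : ℕ) - (a + b) = a + 1 + (i : ℕ) by ring]
    exact hu.2 i
  have h2 : ∀ u ∈ (graphFlag p).1, ∀ m : ℤ, m < 2 * a + b + 1 → C.coord m (tBar R a b u) = 0 := by
    intro u hu m hm
    rw [coord_tBar, if_pos (by omega)]
    exact hu.1 _ (by omega)
  constructor
  · intro h
    refine Matrix.ext_of_mulVec_single fun l => ?_
    have hs : ∀ m : ℤ, a + 1 ≤ m → m < a + 1 + b + a → m ∈ C.supp :=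
      fun m h1 h2 => ordCoords_supp (by omega) (by omega)
    have hu := C.blockVec_mem_graph hs (Pi.single l 1) p.1
    rw [← Matrix.mulVec_mulVec, Matrix.zero_mulVec]
    funext i
    have h3 : C.coord (a + b + 1 + (i : ℕ)) _ =
      p.2.mulVec (fun l : Fin b => C.coord (a + b + 1 + a + (l : ℕ)) _) i := (h ⟨_, hu, rfl⟩).2 i
    have h4 : (fun l' : Fin a => C.coord (a + 1 + b + (l' : ℕ))
        (C.blockVec (a + 1) (p.1.mulVec (Pi.single l 1)) (Pi.single l 1))) = Pi.single l 1 :=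
      funext fun l' => C.coord_blockVec_snd hs _ _ l'
    rw [h2 _ hu _ (by omega), funext (h1 _ hu), h4] at h3
    exact h3.symm
  · rintro h _ ⟨u, hu, rfl⟩
    refine ⟨fun m hm => h2 u hu m (by omega), fun i => ?_⟩
    change C.coord _ _ = p.2.mulVec (fun l : Fin b => C.coord (a + b + 1 + a + (l : ℕ)) _) i
    rw [h2 u hu _ (by omega), funext (h1 u hu)]
    rw [Matrix.mulVec_mulVec, h, Matrix.zero_mulVec]
    rfl

end OrdCoords

/-! ### The conditions on ordinary flags as rank conditions -/

section OrdField

variable {K : Type u} [Field K] {a b c : ℕ}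

theorem exists_graphFlag_eq {U : UPair K a b} (h : (U.2 ≤ U.1))
    (h1 : ∃ X : Matrix (Fin b) (Fin a) K, U.1 = (ordCoords K a b).graph (a + 1) X)
    (h2 : ∃ Y : Matrix (Fin a) (Fin b) K, U.2 = (ordCoords K a b).graph (a + b + 1) Y) :
    ∃ p : MatPair K a b, p.1 * p.2 = 0 ∧ graphFlag p = U := by
  obtain ⟨X, hX⟩ := h1
  obtain ⟨Y, hY⟩ := h2
  have : graphFlag (X, Y) = U := Prod.ext hX.symm hY.symm
  exact ⟨(X, Y), graphFlag_snd_le_fst_iff.1 (by rw [this]; exact h), this⟩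

theorem exists_eq_graph_fst (hb : 0 < b) {U : UPair K a b} (hU : IsOrdFlag K a b U)
    (h1 : Ebar K a b (2 * a + b + 1) ≤ U.1) (h2 : U.1 ⊓ Ebar' K a b (a + b + 1) = ⊥) :
    ∃ X : Matrix (Fin b) (Fin a) K, U.1 = (ordCoords K a b).graph (a + 1) X := by
  obtain ⟨-, ⟨W, hW⟩, -⟩ := hU
  have hfr := finrank_quotient_grassmannian W
  rw [hW] at hfr
  refine CoordSystem.exists_eq_graph_of_cod (C := ordCoords K a b) (j := a + 1)
    (fun m h1 h2 => ordCoords_supp h1 (by omega)) ?_ (cod_of_finrank_map_mkQ hb ?_) ?_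
  · rw [Ebar_eq_above] at h1
    convert h1 using 2
    push_cast
    ring
  · have : (ordCoords K a b).above (a + 1) = ⊤ :=
      eq_top_iff.2 fun v _ m hm => finCoords_coord_of_notMem (by omega) v
    rw [this, Submodule.map_top, Submodule.range_mkQ, finrank_top, hfr]
  · rw [inf_Ebar'_eq_bot_iff] at h2
    intro v hv hv'
    refine h2 v hv fun m hm => hv' m ?_
    push_cast at hm
    omega

/-- Rank-nullity for the projection of the graph to its lower coordinates, whose image is the column
space of `Θ`. -/
theorem finrank_inf_above_add_rank {M : Type*} [AddCommGroup M] [Module K M]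
    [FiniteDimensional K M] {C : CoordSystem K M} {s r : ℕ} {j : ℤ}
    (hs : ∀ m, j ≤ m → m < j + s + r → m ∈ C.supp) (Θ : Matrix (Fin s) (Fin r) K) :
    Module.finrank K ↥(C.graph j Θ ⊓ C.above (j + s)) + Θ.rank =
      Module.finrank K (C.graph j Θ) := by
  let f : M →ₗ[K] (Fin s → K) := LinearMap.pi fun i => C.coord (j + (i : ℕ))
  have h1 := LinearMap.finrank_range_add_finrank_ker (f.domRestrict (C.graph j Θ))
  have h2 : LinearMap.range (f.domRestrict (C.graph j Θ)) = LinearMap.range Θ.mulVecLin := by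
    ext w
    constructor
    · rintro ⟨v, rfl⟩
      exact ⟨fun l => C.coord (j + s + (l : ℕ)) v.1, funext fun i => (v.2.2 i).symm⟩
    · rintro ⟨x, rfl⟩
      exact ⟨⟨_, C.blockVec_mem_graph hs x Θ⟩, funext fun i => C.coord_blockVec_fst hs _ _ i⟩
  have h3 : (LinearMap.ker (f.domRestrict (C.graph j Θ))).map (C.graph j Θ).subtype =
      C.graph j Θ ⊓ C.above (j + s) := by
    ext v
    constructor
    · rintro ⟨v, hv, rfl⟩
      refine ⟨v.2, fun m hm => ?_⟩
      rcases lt_or_ge m j with h | h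
      · exact v.2.1 m h
      · obtain ⟨i, rfl⟩ := CoordSystem.ge_cases h hm
        exact congrFun hv i
    · rintro ⟨hv, hv'⟩
      exact ⟨⟨v, hv⟩, funext fun i => hv' _ (by omega), rfl⟩
  rw [h2] at h1
  rw [← h3, Submodule.finrank_map_subtype_eq, ← h1, add_comm]
  rfl

theorem finrank_graphFlag (p : MatPair K a b) : Module.finrank K (graphFlag p).1 = a + b ∧
    Module.finrank K (graphFlag p).2 = b := by
  obtain ⟨W, hW⟩ := exists_grassmannian_graph (m₀ := a + 1) (l := a + 2 * b) (d := 0) (k := b)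
    (by omega) (by omega) (j := a + 1) (by push_cast; ring) p.1
  obtain ⟨W', hW'⟩ := exists_grassmannian_graph (m₀ := a + 1) (l := a + 2 * b) (d := b) (k := b + a)
    (by omega) rfl (j := a + b + 1) (by ring) p.2
  have h1 := finrank_quotient_grassmannian W
  have h2 := finrank_quotient_grassmannian W'
  have h3 := Submodule.finrank_quotient_add_finrank W.toSubmodule
  have h4 := Submodule.finrank_quotient_add_finrank W'.toSubmodule
  rw [Module.finrank_fin_fun] at h3 h4
  rw [hW] at h1 h3
  rw [hW'] at h2 h4
  change Module.finrank K ((finCoords K (a + 1) (a + 2 * b)).graph _ _) = _ ∧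
    Module.finrank K ((finCoords K (a + 1) (a + 2 * b)).graph _ _) = _
  omega

/-- The flags are pairs of graphs, and the dimensions of the intersections are `a + b - rank X` and
`b - rank Y`. The inclusion `U₂ ⊆ U₁` contributes only `XY = 0`. -/
theorem mem_ordConditions_iff (ha : 0 < a) (hab : a ≤ b) (hc : c ≤ a) {U : UPair K a b} :
    U ∈ ordConditions K a b c ↔
      ∃ p : MatPair K a b, p.1 * p.2 = 0 ∧ p.1.rank ≤ c ∧ p.2.rank ≤ a - c ∧ graphFlag p = U := by
  have hdim : ∀ p : MatPair K a b,
      Module.finrank K ↥((graphFlag p).1 ⊓ Ebar K a b (a + b + 1)) + p.1.rank = a + b ∧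
      Module.finrank K ↥((graphFlag p).2 ⊓ Ebar K a b (2 * a + b + 1)) + p.2.rank = b := by
    intro p
    rw [Ebar_eq_above, Ebar_eq_above, show ((a + b + 1 : ℕ) : ℤ) = a + 1 + b by push_cast; ring,
      show ((2 * a + b + 1 : ℕ) : ℤ) = a + b + 1 + a by push_cast; ring]
    have h1 := finrank_graphFlag p
    exact ⟨(finrank_inf_above_add_rank (fun m h1 h2 => ordCoords_supp h1 (by omega)) p.1).trans h1.1,
      (finrank_inf_above_add_rank (fun m h1 h2 => ordCoords_supp (by omega) (by omega)) p.2).trans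
        h1.2⟩
  constructor
  · rintro ⟨hU, h1, h2, h3, h4, h5, h6⟩
    have hX := exists_eq_graph_fst (by omega) hU h1 h5
    obtain ⟨hle, -, ⟨W, hW⟩⟩ := hU
    have hfr := finrank_quotient_grassmannian W
    have hfr' := Submodule.finrank_quotient_add_finrank W.toSubmodule
    rw [hfr, hW, Module.finrank_fin_fun] at hfr'
    have hfr2 : Module.finrank K U.2 = b := by omega
    rw [inf_Ebar'_eq_bot_iff] at h6
    rw [Ebar_eq_above] at h2
    -- Transversality makes the projection of `U₂` to the last `b` coordinates injective; both sides
    -- have dimension `b`, so it is bijective and `U₂` is a graph.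
    let f : U.2 →ₗ[K] (Fin b → K) :=
      LinearMap.pi fun i => (ordCoords K a b).coord (a + b + 1 + a + (i : ℕ)) ∘ₗ U.2.subtype
    have hinj : Function.Injective f := by
      rw [injective_iff_map_eq_zero]
      intro v hv
      refine Subtype.ext (h6 v.1 v.2 fun m hm => ?_)
      by_cases hm' : m < 2 * a + 2 * b + 1
      · obtain ⟨i, rfl⟩ := CoordSystem.ge_cases (j := a + b + 1 + a) (s := b) (m := m)
          (by push_cast at hm; omega) (by omega)
        exact congrFun hv i
      · exact finCoords_coord_of_notMem (by push_cast; omega) _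
    have hsurj := (LinearMap.injective_iff_surjective_of_finrank_eq_finrank
      (by rw [hfr2, Module.finrank_fin_fun])).1 hinj
    obtain ⟨p, hp, rfl⟩ := exists_graphFlag_eq hle hX
      (CoordSystem.exists_eq_graph (C := ordCoords K a b) (j := a + b + 1) (by exact_mod_cast h2)
        (fun v hv => by
          have : v = 0 := (ordCoords K a b).ext_zero v fun m => by
            by_cases hm : m < a + b + 1 + a + b
            · exact hv m hm
            · exact finCoords_coord_of_notMem (by push_cast; omega) _
          rw [this]
          exact Submodule.zero_mem _)
        (fun v hv hv' => h6 v hv fun m hm => hv' m (by push_cast at hm; omega))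
        (fun l => by
          obtain ⟨v, hv⟩ := hsurj (Pi.single l 1)
          refine ⟨v.1, v.2, fun l' => ?_⟩
          have := congrFun hv l'
          rw [Pi.single_apply] at this
          exact this))
    have := hdim p
    exact ⟨p, hp, by omega, by omega, rfl⟩
  · rintro ⟨p, hp, h1, h2, rfl⟩
    have := hdim p
    refine ⟨isOrdFlag_graphFlag hp, ?_, ?_, by omega, by omega, ?_, ?_⟩
    · rw [Ebar_eq_above, show ((2 * a + b + 1 : ℕ) : ℤ) = a + 1 + b + a by push_cast; ring]
      exact CoordSystem.above_le_graph _
    · rw [Ebar_eq_above, show ((a + b + 1 : ℕ) : ℤ) = a + b + 1 by push_cast; ring]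
      exact CoordSystem.graph_le_above _
    · rw [inf_Ebar'_eq_bot_iff]
      intro v hv hv'
      exact CoordSystem.graph_lower_eq_zero hv fun m hm => hv' m (by push_cast; omega)
    · rw [inf_Ebar'_eq_bot_iff]
      intro v hv hv'
      exact CoordSystem.graph_lower_eq_zero hv fun m hm => hv' m (by push_cast; omega)

end OrdField

/-! ### Permutations and Borel orbits in the ordinary flag variety -/

section OrdPerm

variable {a b c : ℕ}

/-- The permutations that define the Schubert variety of `Fl(b, a, b; k^{a+2b})` given by rank
conditions on the blocks `X` and `Y`. -/
def IsOrdPerm (c : ℕ) (w : Equiv.Perm (Fin (a + 2 * b))) : Prop :=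
  ∀ x : Fin (a + 2 * b),
    (b ≤ (w.symm x : ℕ) ↔ (x : ℕ) < c ∨ b ≤ (x : ℕ) ∧ (x : ℕ) < b + a - c ∨ a + b ≤ (x : ℕ)) ∧
    (a + b ≤ (w.symm x : ℕ) ↔
      b ≤ (x : ℕ) ∧ (x : ℕ) < b + a - c ∨ a + b ≤ (x : ℕ) ∧ (x : ℕ) < 2 * b + c)

/-- The two conditions prescribe nested sets of `b` and `a + b` positions of leading entries. The
permutation lists the complement of the larger set, then the difference, then the smaller set, each
in increasing order. -/
theorem exists_isOrdPerm (hab : a ≤ b) (hc : c ≤ a) :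
    ∃ w : Equiv.Perm (Fin (a + 2 * b)), IsOrdPerm c w := by
  let f : ℕ → ℕ := fun i => if i < b - c then c + i else if i < b then a + i else
    if i < b + c then i - b else if i < a + b then i + b else
    if i < 2 * a + b - c then i - a else i - (a - c)
  let g : ℕ → ℕ := fun x => if x < c then x + b else if x < b then x - c else
    if x < b + a - c then x + a else if x < a + b then x - a else
    if x < 2 * b + c then x + (a - c) else x - b
  have hf : ∀ i < a + 2 * b, f i < a + 2 * b := fun i hi => by
    simp only [f]
    split_ifs <;> omega
  have hg : ∀ i < a + 2 * b, g i < a + 2 * b := fun i hi => by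
    simp only [g]
    split_ifs <;> omega
  have hfg : ∀ i < a + 2 * b, f (g i) = i := fun i hi => by
    simp only [g]
    split_ifs <;> simp only [f] <;> split_ifs <;> omega
  have hgf : ∀ i < a + 2 * b, g (f i) = i := fun i hi => by
    simp only [f]
    split_ifs <;> simp only [g] <;> split_ifs <;> omega
  refine ⟨⟨fun i => ⟨f i, hf i i.2⟩, fun i => ⟨g i, hg i i.2⟩, fun i => Fin.ext (hgf i i.2),
    fun i => Fin.ext (hfg i i.2)⟩, fun x => ?_⟩
  have hx := x.2
  change (b ≤ g x ↔ _) ∧ (a + b ≤ g x ↔ _)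
  simp only [g]
  constructor <;> split_ifs <;> omega

variable {K : Type u} [Field K]

theorem cod_permEbar (w : Equiv.Perm (Fin (a + 2 * b))) {i j d : ℕ}
    (S : Finset (Fin (a + 2 * b))) (hS : S.card ≤ d)
    (h : ∀ x : Fin (a + 2 * b), j ≤ a + 1 + x → i ≤ a + 1 + w.symm x ∨ x ∈ S) :
    Cod (Ebar K a b j) (permEbar K a b w i) d := by
  classical
  refine cod_of_span (S.image fun x => (Pi.single x 1 : FinSpace K a b))
    (Finset.card_image_le.trans hS) (Submodule.span_le.2 ?_)
  rintro _ ⟨x, hx, rfl⟩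
  rcases h x hx with h | h
  · exact Submodule.mem_sup_left (Submodule.subset_span ⟨w.symm x, h, by simp⟩)
  · exact Submodule.mem_sup_right (Submodule.subset_span
      (Finset.mem_coe.2 (Finset.mem_image_of_mem _ h)))

theorem map_borel_Ebar {g : GL (Fin (a + 2 * b)) K} (hg : g ∈ borel K (a + 2 * b)) (j : ℕ) :
    (Ebar K a b j).map (Matrix.mulVecLin g.1) = Ebar K a b j := by
  have hle : (Ebar K a b j).map (Matrix.mulVecLin g.1) ≤ Ebar K a b j := by
    rw [Ebar, Submodule.map_span_le]
    rintro _ ⟨i, hi, rfl⟩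
    rw [← Ebar, Ebar_eq_above, finCoords_above_eq_coordSpan, mem_coordSpan]
    intro x hx
    have hx' : ¬ (j : ℤ) ≤ a + 1 + (x : ℕ) := hx
    rw [Matrix.mulVecLin_apply, Matrix.mulVec_single_one]
    exact hg x i (Fin.lt_def.2 (by omega))
  have hinj : Function.Injective (Matrix.mulVecLin g.1) :=
    Matrix.mulVec_injective_of_isUnit g.isUnit
  exact Submodule.eq_of_le_of_finrank_eq hle
    (Submodule.equivMapOfInjective _ hinj _).finrank_eq.symm

theorem cod_map_borel {g : GL (Fin (a + 2 * b)) K} (hg : g ∈ borel K (a + 2 * b)) {j d : ℕ}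
    {U : Submodule K (FinSpace K a b)} (h : Cod (Ebar K a b j) U d) :
    Cod (Ebar K a b j) (U.map (Matrix.mulVecLin g.1)) d := by
  have := h.map (Matrix.mulVecLin g.1)
  rwa [map_borel_Ebar hg] at this

end OrdPerm

/-! ### Incidence conditions on the ordinary Schubert variety -/

section OrdLocus

variable {k : Type u} [Field k] {a b c : ℕ}

/-- The incidence conditions that bound the Schubert variety. -/
def ordLocus (k : Type u) [Field k] (a b c : ℕ) : Locus (ordFlag k a b) :=
  fun K _ _ => {U : UPair K a b |
    (Cod (Ebar K a b (a + 1)) U.1 b ∧ Cod (Ebar K a b (a + b + 1)) U.1 c ∧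
      Cod (Ebar K a b (2 * a + b + 1)) U.1 0) ∧
    Cod (Ebar K a b (a + b + 1)) U.2 a ∧ Cod (Ebar K a b (2 * a + b + 1)) U.2 (a - c)}

theorem exists_ideal_cod_grassmannian {R : Type u} [CommRing R] [Algebra k R] {m : ℕ}
    {U : Submodule R (FinSpace R a b)}
    (hU : ∃ W : Module.Grassmannian R (FinSpace R a b) m, W.toSubmodule = U) (j d : ℕ) :
    ∃ I : Ideal R, ∀ (K : Type u) [Field K] [Algebra k K] (φ : R →ₐ[k] K),
      Cod (Ebar K a b j) (pullSub φ.toRingHom U) d ↔ ∀ f ∈ I, φ f = 0 := by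
  obtain ⟨W, rfl⟩ := hU
  obtain ⟨I, hI⟩ := exists_ideal_cod (k := k) W.toSubmodule W.projective_quotient
    {i | (j : ℤ) ≤ a + 1 + (i : ℕ)} d
  refine ⟨I, fun K _ _ φ => ?_⟩
  rw [← hI K φ, Ebar_eq_above, finCoords_above_eq_coordSpan]
  rfl

theorem isClosed_ordLocus : (ordLocus k a b c).IsClosed := by
  intro R _ _ U hU
  obtain ⟨-, h1, h2⟩ := hU
  exact exists_ideal_and (exists_ideal_and (exists_ideal_cod_grassmannian h1 _ _)
      (exists_ideal_and (exists_ideal_cod_grassmannian h1 _ _)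
        (exists_ideal_cod_grassmannian h1 _ _)))
    (exists_ideal_and (exists_ideal_cod_grassmannian h2 _ _)
      (exists_ideal_cod_grassmannian h2 _ _))

theorem card_filter_fin_le {n l r : ℕ} :
    (Finset.univ.filter fun x : Fin n => l ≤ (x : ℕ) ∧ (x : ℕ) < r).card ≤ r - l := by
  rw [← Nat.card_Ico, ← Finset.card_map Fin.valEmbedding]
  refine Finset.card_le_card fun x hx => ?_
  obtain ⟨y, hy, rfl⟩ := Finset.mem_map.1 hx
  exact Finset.mem_Ico.2 (Finset.mem_filter.1 hy).2

/-- As in the affine case, the Borel group preserves the spaces `Ē_j`, and the bounds count the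
basis vectors missing from the coordinate flag. -/
theorem ordCell_subset_ordLocus {w : Equiv.Perm (Fin (a + 2 * b))} (hw : IsOrdPerm c w)
    (hab : a ≤ b) (hc : c ≤ a) (K : Type u) [Field K] [Algebra k K] :
    ordCell k a b w K ⊆ ordLocus k a b c K := by
  rintro _ ⟨g, hg, rfl⟩
  let S : ℕ → ℕ → Finset (Fin (a + 2 * b)) := fun l r =>
    Finset.univ.filter fun x => l ≤ (x : ℕ) ∧ (x : ℕ) < r
  have hS : ∀ l r, (S l r).card ≤ r - l := fun l r => card_filter_fin_le
  have hmem : ∀ l r x, x ∈ S l r ↔ l ≤ (x : ℕ) ∧ (x : ℕ) < r := fun l r x => by simp [S]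
  have hS' : ∀ l r l' r', (S l r ∪ S l' r').card ≤ (r - l) + (r' - l') := fun l r l' r' =>
    (Finset.card_union_le _ _).trans (add_le_add (hS l r) (hS l' r'))
  refine ⟨⟨cod_map_borel hg (cod_permEbar w (S c b ∪ S (b + a - c) (b + a))
      ((hS' _ _ _ _).trans (by omega)) fun x _ => ?_),
    cod_map_borel hg (cod_permEbar w (S (b + a - c) (b + a))
      ((hS _ _).trans (by omega)) fun x _ => ?_),
    cod_map_borel hg (cod_permEbar w ∅ le_rfl fun x _ => ?_)⟩,
    cod_map_borel hg (cod_permEbar w (S (b + a - c) (b + a) ∪ S (2 * b + c) (a + 2 * b))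
      ((hS' _ _ _ _).trans (by omega)) fun x _ => ?_),
    cod_map_borel hg (cod_permEbar w (S (2 * b + c) (a + 2 * b))
      ((hS _ _).trans (by omega)) fun x _ => ?_)⟩ <;>
  · have := hw x
    have := x.2
    simp only [Finset.mem_union, hmem, Finset.notMem_empty]
    omega

theorem exists_graphFlag_of_mem_ordLocus {K : Type u} [Field K] [Algebra k K] {U : UPair K a b}
    (h : U ∈ ordLocus k a b c K) (hle : U.2 ≤ U.1) (h1 : U.1 ⊓ Ebar' K a b (a + b + 1) = ⊥)
    (h2 : U.2 ⊓ Ebar' K a b (2 * a + b + 1) = ⊥) :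
    ∃ p : MatPair K a b, p.1 * p.2 = 0 ∧ p.1.rank ≤ c ∧ p.2.rank ≤ a - c ∧ graphFlag p = U := by
  obtain ⟨⟨c1, c2, c3⟩, c4, c5⟩ := h
  rw [cod_zero_iff] at c3
  rw [Ebar_eq_above] at c1 c2 c3 c4 c5
  push_cast at c1 c2 c3 c4 c5
  rw [inf_Ebar'_eq_bot_iff] at h1 h2
  push_cast at h1 h2
  have e1 : (a : ℤ) + 1 + b = a + b + 1 := by ring
  have e2 : (a : ℤ) + 1 + b + a = 2 * a + b + 1 := by ring
  have e3 : (a : ℤ) + b + 1 + a = 2 * a + b + 1 := by ring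
  have s1 : ∀ m : ℤ, a + 1 ≤ m → m < a + 1 + b + a → m ∈ (ordCoords K a b).supp :=
    fun m h1 h2 => ordCoords_supp h1 (by omega)
  have s2 : ∀ m : ℤ, a + b + 1 ≤ m → m < a + b + 1 + a + b → m ∈ (ordCoords K a b).supp :=
    fun m h1 h2 => ordCoords_supp (by omega) (by omega)
  obtain ⟨p, hp, rfl⟩ := exists_graphFlag_eq hle
    (CoordSystem.exists_eq_graph_of_cod s1 (by rwa [e2]) c1 (by rwa [e1]))
    (CoordSystem.exists_eq_graph_of_cod s2 (fun v hv => by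
      have : v = 0 := (ordCoords K a b).ext_zero v fun m => by
        by_cases hm : m < a + b + 1 + a + b
        · exact hv m hm
        · exact finCoords_coord_of_notMem (by push_cast; omega) _
      rw [this]
      exact Submodule.zero_mem _) c4 (by rwa [e3]))
  exact ⟨p, hp, CoordSystem.rank_le_of_cod s1 (by rw [e1]; exact c2),
    CoordSystem.rank_le_of_cod s2 (by rw [e3]; exact c5), rfl⟩

end OrdLocus

/-! ### The opposite cell of the ordinary Schubert variety -/

section OrdCell

variable {K : Type u} [Field K] {a b c : ℕ}

/-- Echelon vectors for all positions: values of `X`, values of `Y` and kernel vectors of `Y` are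
leading entries of the flag. The vectors at the last positions lie in `U₁`, and at the positions
outside the flag plain unit vectors fill up the matrix. -/
theorem exists_echelon_graphFlag (hab : a ≤ b) (hc : c ≤ a) {p : MatPair K a b}
    (hp : p.1 * p.2 = 0) (hr : p.2.rank ≤ a - c)
    (h1 : (corner c (hc.trans hab) hc p.1).det ≠ 0)
    (h2 : (corner (a - c) (Nat.sub_le a c) ((Nat.sub_le a c).trans hab) p.2).det ≠ 0)
    (x : Fin (a + 2 * b)) :
    ∃ v : FinSpace K a b, (∀ y < x, v y = 0) ∧ v x = 1 ∧
      ((x : ℕ) < c ∨ b ≤ (x : ℕ) ∧ (x : ℕ) < b + a - c ∨ a + b ≤ (x : ℕ) → v ∈ (graphFlag p).1) ∧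
      (b ≤ (x : ℕ) ∧ (x : ℕ) < b + a - c ∨ a + b ≤ (x : ℕ) ∧ (x : ℕ) < 2 * b + c →
        v ∈ (graphFlag p).2) := by
  let C := ordCoords K a b
  have hle := graphFlag_snd_le_fst_iff.2 hp
  have hv : ∀ (v : FinSpace K a b) (y : Fin (a + 2 * b)), v y = C.coord (a + 1 + (y : ℕ)) v :=
    fun v y => (finCoords_coord_of_mem y v).symm
  have s1 : ∀ m : ℤ, a + 1 ≤ m → m < a + 1 + b + a → m ∈ C.supp :=
    fun m h1 h2 => ordCoords_supp h1 (by omega)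
  have s2 : ∀ m : ℤ, a + b + 1 ≤ m → m < a + b + 1 + a + b → m ∈ C.supp :=
    fun m h1 h2 => ordCoords_supp (by omega) (by omega)
  have hsingle : ∀ y < x, (Pi.single x 1 : FinSpace K a b) y = 0 :=
    fun y hy => Pi.single_eq_of_ne hy.ne _
  by_cases c1 : (x : ℕ) < c
  · obtain ⟨ξ, -, hξ⟩ := exists_mulVec_eq_of_corner h1 (Pi.single ⟨x, by omega⟩ 1)
    have key : ∀ (y : Fin (a + 2 * b)) (hy : (y : ℕ) ≤ x),
        C.blockVec (a + 1) (p.1.mulVec ξ) ξ y = if y = x then 1 else 0 := by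
      intro y hy
      have h3 := C.coord_blockVec_fst s1 (p.1.mulVec ξ) ξ ⟨y, by omega⟩
      rw [hξ _ (by simp only; omega), Pi.single_apply] at h3
      refine (hv _ y).trans (h3.trans ?_)
      simp only [Fin.ext_iff]
    refine ⟨_, fun y hy => (key y (Fin.lt_def.1 hy).le).trans (if_neg hy.ne),
      (key x le_rfl).trans (if_pos rfl), fun _ => C.blockVec_mem_graph s1 ξ p.1,
      fun h => absurd h (by omega)⟩
  by_cases c2 : (x : ℕ) < b
  · exact ⟨Pi.single x 1, hsingle, Pi.single_eq_same _ _, fun h => absurd h (by omega),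
      fun h => absurd h (by omega)⟩
  by_cases c3 : (x : ℕ) < b + a - c
  · obtain ⟨η, -, hη⟩ := exists_mulVec_eq_of_corner h2 (Pi.single ⟨x - b, by omega⟩ 1)
    have key : ∀ (y : Fin (a + 2 * b)) (hy : (y : ℕ) ≤ x),
        C.blockVec (a + b + 1) (p.2.mulVec η) η y = if y = x then 1 else 0 := by
      intro y hy
      refine (hv _ y).trans ?_
      rcases lt_or_ge (y : ℕ) b with h | h
      · rw [C.coord_blockVec_of_lt s2 _ _ (by omega), if_neg fun h' => by subst h'; omega]
      · have h3 := C.coord_blockVec_fst s2 (p.2.mulVec η) η ⟨y - b, by omega⟩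
        rw [hη _ (by simp only; omega), Pi.single_apply] at h3
        rw [show (a : ℤ) + 1 + (y : ℕ) = a + b + 1 + ((y - b : ℕ) : ℤ) by omega]
        refine h3.trans ?_
        simp only [Fin.ext_iff]
        exact if_congr (by omega) rfl rfl
    exact ⟨_, fun y hy => (key y (Fin.lt_def.1 hy).le).trans (if_neg hy.ne),
      (key x le_rfl).trans (if_pos rfl), fun _ => hle (C.blockVec_mem_graph s2 η p.2),
      fun _ => C.blockVec_mem_graph s2 η p.2⟩
  by_cases c4 : (x : ℕ) < a + b
  · exact ⟨Pi.single x 1, hsingle, Pi.single_eq_same _ _, fun h => absurd h (by omega),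
      fun h => absurd h (by omega)⟩
  by_cases c5 : (x : ℕ) < 2 * b + c
  · obtain ⟨η, hη0, hη⟩ := exists_ker_eq_of_corner h2 hr ⟨x - (a + b), by omega⟩
    have key : ∀ (y : Fin (a + 2 * b)) (hy : (y : ℕ) ≤ x),
        C.blockVec (a + b + 1) (p.2.mulVec η) η y = if y = x then 1 else 0 := by
      intro y hy
      rw [hη0]
      refine (hv _ y).trans ?_
      rcases lt_or_ge (y : ℕ) b with h | h
      · rw [C.coord_blockVec_of_lt s2 _ _ (by omega), if_neg fun h' => by subst h'; omega]
      rcases lt_or_ge (y : ℕ) (a + b) with h' | h'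
      · rw [show (a : ℤ) + 1 + (y : ℕ) = a + b + 1 + ((y - b : ℕ) : ℤ) by omega,
          if_neg fun h' => by subst h'; omega]
        exact C.coord_blockVec_fst s2 (0 : Fin a → K) η ⟨y - b, by omega⟩
      · have h3 := C.coord_blockVec_snd s2 (0 : Fin a → K) η ⟨y - (a + b), by omega⟩
        rw [hη _ (by simp only; omega)] at h3
        rw [show (a : ℤ) + 1 + (y : ℕ) = a + b + 1 + a + ((y - (a + b) : ℕ) : ℤ) by omega]
        refine h3.trans ?_
        simp only [Fin.ext_iff]
        exact if_congr (by omega) rfl rfl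
    exact ⟨_, fun y hy => (key y (Fin.lt_def.1 hy).le).trans (if_neg hy.ne),
      (key x le_rfl).trans (if_pos rfl), fun _ => hle (C.blockVec_mem_graph s2 η p.2),
      fun _ => C.blockVec_mem_graph s2 η p.2⟩
  · refine ⟨Pi.single x 1, hsingle, Pi.single_eq_same _ _, fun _ => ?_,
      fun h => absurd h (by omega)⟩
    refine C.above_le_graph p.1 fun m hm => ?_
    by_cases hm' : (a + 1 : ℤ) ≤ m ∧ m < a + 1 + (a + 2 * b : ℕ)
    · obtain ⟨y, rfl⟩ := CoordSystem.ge_cases hm'.1 hm'.2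
      rw [← hv]
      exact hsingle y (Fin.lt_def.2 (by omega))
    · exact finCoords_coord_of_notMem hm' _

/-- A lower unitriangular matrix of echelon vectors moves the coordinate flag into `graphFlag p`;
rigidity of graphs turns the inclusion into equality. -/
theorem graphFlag_mem_ordCell {k : Type u} [Field k] [Algebra k K] {p : MatPair K a b}
    {w : Equiv.Perm (Fin (a + 2 * b))} (hw : IsOrdPerm c w) (hab : a ≤ b) (hc : c ≤ a)
    (hp : p.1 * p.2 = 0) (hr : p.2.rank ≤ a - c)
    (h1 : (corner c (hc.trans hab) hc p.1).det ≠ 0)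
    (h2 : (corner (a - c) (Nat.sub_le a c) ((Nat.sub_le a c).trans hab) p.2).det ≠ 0) :
    graphFlag p ∈ ordCell k a b w K := by
  choose v hv0 hv1 hv2 hv3 using exists_echelon_graphFlag hab hc hp hr h1 h2
  let H : Matrix (Fin (a + 2 * b)) (Fin (a + 2 * b)) K := Matrix.of fun i j => v j i
  have hH : ∀ x, H.mulVec (Pi.single x 1) = v x := fun x => by
    rw [Matrix.mulVec_single_one]
    rfl
  have hlow : ∀ i j, i < j → H i j = 0 := fun i j hij => hv0 j i hij
  have hu : IsUnit H := isUnit_of_lowerTriangular hlow hv1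
  let U : UPair K a b := ((permEbar K a b w (a + b + 1)).map H.mulVecLin,
    (permEbar K a b w (2 * a + b + 1)).map H.mulVecLin)
  have hU : U ∈ ordCell k a b w K := ⟨hu.unit, hlow, rfl⟩
  have le1 : U.1 ≤ (graphFlag p).1 := by
    change Submodule.map _ _ ≤ _
    rw [permEbar, Submodule.map_span_le]
    rintro _ ⟨i, hi, rfl⟩
    rw [Matrix.mulVecLin_apply, hH]
    have := (hw (w i)).1
    rw [Equiv.symm_apply_apply] at this
    exact hv2 _ (this.1 (by omega))
  have le2 : U.2 ≤ (graphFlag p).2 := by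
    change Submodule.map _ _ ≤ _
    rw [permEbar, Submodule.map_span_le]
    rintro _ ⟨i, hi, rfl⟩
    rw [Matrix.mulVecLin_apply, hH]
    have := (hw (w i)).2
    rw [Equiv.symm_apply_apply] at this
    exact hv3 _ (this.1 (by omega))
  have le3 : U.2 ≤ U.1 := Submodule.map_mono (Submodule.span_mono fun _ ⟨i, hi, h⟩ =>
    ⟨i, by omega, h⟩)
  have bot1 : U.1 ⊓ Ebar' K a b (a + b + 1) = ⊥ := inf_Ebar'_eq_bot_iff.2 fun v hv hv' =>
    CoordSystem.graph_lower_eq_zero (le1 hv) fun m hm => hv' m (by push_cast; omega)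
  have bot2 : U.2 ⊓ Ebar' K a b (2 * a + b + 1) = ⊥ := inf_Ebar'_eq_bot_iff.2 fun v hv hv' =>
    CoordSystem.graph_lower_eq_zero (le2 hv) fun m hm => hv' m (by push_cast; omega)
  obtain ⟨p', -, -, -, h⟩ := exists_graphFlag_of_mem_ordLocus
    (ordCell_subset_ordLocus (k := k) hw hab hc K hU) le3 bot1 bot2
  rw [← h] at le1 le2
  have h3 : p' = p := Prod.ext
    (CoordSystem.graph_injective (C := ordCoords K a b)
      (fun m h1 h2 => ordCoords_supp h1 (by omega)) le1)
    (CoordSystem.graph_injective (C := ordCoords K a b)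
      (fun m h1 h2 => ordCoords_supp (by omega) (by omega)) le2)
  rw [← h3, h]
  exact hU

/-- Both sides are the pairs of graphs with `XY = 0` and the rank bounds. As `YX = 0` is not
available, density of the cell is tested along the family of `exists_generic_complex_field`. -/
theorem ordOpp_eq_ordConditions {k : Type u} [Field k] [Algebra k K]
    {w : Equiv.Perm (Fin (a + 2 * b))} (hw : IsOrdPerm c w) (ha : 0 < a) (hab : a ≤ b)
    (hc : c ≤ a) : ordOpp k a b w K = ordConditions K a b c := by
  refine Set.ext fun (U : UPair K a b) => Iff.trans ?_ (mem_ordConditions_iff ha hab hc).symm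
  constructor
  · rintro ⟨⟨hU, h⟩, h1, h2⟩
    exact exists_graphFlag_of_mem_ordLocus
      (h _ isClosed_ordLocus fun L _ _ => ordCell_subset_ordLocus hw hab hc L) hU.1 h1 h2
  · rintro ⟨p, hp, hr1, hr2, rfl⟩
    have hmem := (mem_ordConditions_iff ha hab hc).2 ⟨p, hp, hr1, hr2, rfl⟩
    refine ⟨⟨isOrdFlag_graphFlag hp, fun Z hZ hcell => ?_⟩, hmem.2.2.2.2.2⟩
    obtain ⟨D, _, _, _, P, L, _, _, ψ, hψ, hP, r1, r2, c1, c2, hs⟩ :=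
      exists_generic_complex_field k hab hc
    obtain ⟨I, hI⟩ := hZ D (graphFlag P) (isOrdFlag_graphFlag hP)
    have hpull : ∀ (K' : Type u) [Field K'] [Algebra k K'] (φ : D →ₐ[k] K'),
        (ordFlag k a b).pull φ (graphFlag P) = graphFlag (mapPair φ P) :=
      fun K' _ _ φ => pullSub_graphFlag φ.toRingHom P
    have hP' : (mapPair ψ P).1 * (mapPair ψ P).2 = 0 :=
      graphFlag_snd_le_fst_iff.1 (by
        rw [← hpull]
        exact Submodule.span_mono (Set.image_mono (graphFlag_snd_le_fst_iff.2 hP)))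
    have h1 := (hI L ψ).1 (by
      rw [hpull]
      exact hcell L (graphFlag_mem_ordCell hw hab hc hP' r2 c1 c2))
    obtain ⟨φ, rfl⟩ := hs K p hp hr1 hr2
    have h2 := (hI K φ).2 fun f hf => by
      have h3 : f = 0 := hψ (by rw [h1 f hf, map_zero])
      rw [h3, map_zero]
    rwa [hpull] at h2

end OrdCell

/-! ### Bijections on points over reduced rings -/

section Points

variable {k : Type u} [Field k] {a b c : ℕ}

theorem mem_circ_iff_exists_component {K : Type u} [Field K] [Algebra k K] (hab : a ≤ b)
    (p : MatPair K a b) : p ∈ circ K a b ↔ ∃ c ≤ a, p ∈ component k a b c K := by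
  constructor
  · intro hp
    have h := Matrix.rank_add_rank_le_card_of_mul_eq_zero hp.1
    rw [Fintype.card_fin] at h
    exact ⟨p.1.rank, by omega, (mem_component_iff hab (by omega) p).2 ⟨hp, le_rfl, by omega⟩⟩
  · rintro ⟨c, -, hp⟩
    exact (component_subset hp).1

variable {R : Type u} [CommRing R] [Algebra k R] [IsReduced R]

/-- Equality of images over all fields lifts to reduced rings: a family whose fibers lie in the
image of `Ψ` comes from a family of complexes, and injectivity of `Ψ` over fields identifies its
fibers. -/
theorem bijOn_Psi_points (hn : 0 < a + b) {D : Locus (affFlag k a b)}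
    {T : ∀ (K : Type u) [Field K] [Algebra k K], Set (MatPair K a b)}
    (hT : ∀ (K : Type u) [Field K] [Algebra k K], T K ⊆ circ K a b)
    (hD : ∀ (K : Type u) [Field K] [Algebra k K], Psi '' T K = D K) {S : Set (MatPair R a b)}
    (hS : ∀ p, p ∈ S ↔ ∀ (K : Type u) [Field K] [Algebra k K] (φ : R →ₐ[k] K), mapPair φ p ∈ T K) :
    Set.BijOn Psi S (D.points R) := by
  have hcirc : S ⊆ circ R a b := fun p hp =>
    (mem_circ_iff_forall_field (k := k) p).2 fun K _ _ φ => hT K ((hS p).1 hp K φ)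
  have hpull : ∀ p ∈ circ R a b, ∀ (K : Type u) [Field K] [Algebra k K] (φ : R →ₐ[k] K),
      (affFlag k a b).pull φ (Psi p) = Psi (mapPair φ p) :=
    fun p hp K _ _ φ => pullLattice_Psi hn φ.toRingHom hp
  refine ⟨fun p hp => ⟨isAffFlag_Psi hn (hcirc hp), fun K _ _ φ => ?_⟩,
    (Psi_injOn hn).mono hcirc, ?_⟩
  · rw [hpull p (hcirc hp), ← hD]
    exact ⟨_, (hS p).1 hp K φ, rfl⟩
  · rintro Λ ⟨hΛ, h⟩
    obtain ⟨p, hp, rfl⟩ := exists_Psi_eq_of_forall_field (k := k) hn hΛ fun K _ _ φ => by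
      have h1 := h K φ
      rw [← hD] at h1
      obtain ⟨p, hp, h2⟩ := h1
      exact ⟨p, hT K hp, h2⟩
    refine ⟨p, (hS p).2 fun K _ _ φ => ?_, rfl⟩
    have h1 := h K φ
    rw [hpull p hp, ← hD] at h1
    obtain ⟨p', hp', h2⟩ := h1
    have h3 : p' = mapPair φ p := Psi_injOn hn (hT K hp') (map_mem_circ (φ : R →+* K) hp) h2
    rwa [← h3]

/-- Over fields the incidence condition adds `YX = 0` to the description of the opposite cell, which
leaves exactly `𝓛_c`. Over a reduced ring the two submodules are graphs because their fibers are. -/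
theorem bijOn_graphFlag {w : Equiv.Perm (Fin (a + 2 * b))} (hw : IsOrdPerm c w) (ha : 0 < a)
    (hab : a ≤ b) (hc : c ≤ a) :
    Set.BijOn graphFlag (component k a b c R) ((ordIncidence k a b w).points R) := by
  have hpull : ∀ (p : MatPair R a b) (K : Type u) [Field K] [Algebra k K] (φ : R →ₐ[k] K),
      (ordFlag k a b).pull φ (graphFlag p) = graphFlag (mapPair φ p) :=
    fun p K _ _ φ => pullSub_graphFlag φ.toRingHom p
  have hmem : ∀ (K : Type u) [Field K] [Algebra k K] (p : MatPair K a b),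
      graphFlag p ∈ ordIncidence k a b w K ↔ p ∈ component k a b c K := by
    intro K _ _ p
    rw [mem_component_iff hab hc]
    change _ ∈ ordOpp k a b w K ∧ _ ≤ _ ↔ _
    rw [ordOpp_eq_ordConditions hw ha hab hc]
    refine Iff.trans (and_congr (mem_ordConditions_iff ha hab hc) map_tBar_graphFlag_le_iff) ?_
    constructor
    · rintro ⟨⟨p', h1, h2, h3, h4⟩, h5⟩
      obtain rfl := graphFlag_injective h4
      exact ⟨⟨h1, h5⟩, h2, h3⟩
    · rintro ⟨⟨h1, h2⟩, h3, h4⟩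
      exact ⟨⟨p, h1, h3, h4, rfl⟩, h2⟩
  refine ⟨fun p hp => ⟨isOrdFlag_graphFlag ?_, fun K _ _ φ => ?_⟩, graphFlag_injective.injOn, ?_⟩
  · exact ((mem_circ_iff_forall_field (k := k) p).2 fun K _ _ φ =>
      (component_subset ((mem_component_iff_forall_field p).1 hp K φ)).1).1
  · rw [hpull]
    exact (hmem K _).2 ((mem_component_iff_forall_field p).1 hp K φ)
  · rintro U ⟨-, h⟩
    have hK : ∀ (K : Type u) [Field K] [Algebra k K] (φ : R →ₐ[k] K), ∃ p : MatPair K a b,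
        graphFlag p = (ordFlag k a b).pull φ U := by
      intro K _ _ φ
      have h1 := (h K φ).1
      rw [ordOpp_eq_ordConditions hw ha hab hc] at h1
      obtain ⟨p, -, -, -, h2⟩ := (mem_ordConditions_iff ha hab hc).1 h1
      exact ⟨p, h2⟩
    obtain ⟨X, hX⟩ := exists_eq_graph_of_forall_field (k := k) (m₀ := a + 1) (j := a + 1) (s := b)
      (r := a) le_rfl (by push_cast; omega) U.1 fun K _ _ φ => by
        obtain ⟨p, hp⟩ := hK K φ
        exact ⟨p.1, (congrArg Prod.fst hp).symm⟩
    obtain ⟨Y, hY⟩ := exists_eq_graph_of_forall_field (k := k) (m₀ := a + 1) (j := a + b + 1)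
      (s := a) (r := b) (by omega) (by push_cast; omega) U.2 fun K _ _ φ => by
        obtain ⟨p, hp⟩ := hK K φ
        exact ⟨p.2, (congrArg Prod.snd hp).symm⟩
    have hU : graphFlag (X, Y) = U := Prod.ext hX.symm hY.symm
    refine ⟨(X, Y), (mem_component_iff_forall_field _).2 fun K _ _ φ => ?_, hU⟩
    refine (hmem K _).1 ?_
    rw [← hpull, hU]
    exact h K φ

end Points

end CircComplex

/-! ### The main theorem -/

theorem mainTheorem1 {k : Type u} [Field k] (a b : ℕ) (ha : 0 < a) (hab : a ≤ b) :
    -- the `𝓛_c`, `0 ≤ c ≤ a`, are pairwise different and are the irreducible components of `𝓛`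
    ((circIdeal k a b).minimalPrimes = stratumIdeal k a b '' Set.Iic a ∧
      Set.InjOn (stratumIdeal k a b) (Set.Iic a)) ∧
    -- `Ψ` is compatible with base change
    (∀ (R S : Type u) [CommRing R] [Algebra k R] [CommRing S] [Algebra k S] (φ : R →ₐ[k] S),
      ∀ p ∈ circ R a b, (affFlag k a b).pull φ (Psi p) = Psi (mapPair φ p)) ∧
    -- `Ψ` is equivariant
    (∀ (R : Type u) [CommRing R] [Algebra k R] (g : GL (Fin a) R) (h : GL (Fin b) R),
      ∀ p ∈ circ R a b, pairAct g h p ∈ circ R a b ∧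
        Psi (pairAct g h p) = translateFlag (diagMat g h) (Psi p)) ∧
    ∃ π : ℕ → affineWeyl (a + b),
      (∀ c ≤ a, IsBlockPerm a b c (π c)) ∧
      -- `Ψ` is an isomorphism of `𝓛` onto the union of the opposite cells `X'_{π_c}`
      (∀ (R : Type u) [CommRing R] [Algebra k R] [IsReduced R],
        Set.BijOn Psi (circ R a b)
          (Locus.points (F := affFlag k a b) (fun K _ _ => ⋃ c ≤ a, affOpp k a b (π c) K) R)) ∧
      ∀ c ≤ a,
        -- `𝓛_c` is stable under the group action
        (∀ (R : Type u) [CommRing R] [Algebra k R] [IsReduced R] (g : GL (Fin a) R)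
          (h : GL (Fin b) R), ∀ p ∈ component k a b c R, pairAct g h p ∈ component k a b c R) ∧
        -- `Ψ` is an isomorphism of `𝓛_c` onto `X'_{π_c}`
        (∀ (R : Type u) [CommRing R] [Algebra k R] [IsReduced R],
          Set.BijOn Psi (component k a b c R) ((affOpp k a b (π c)).points R)) ∧
        (∀ (K : Type u) [Field K] [Algebra k K],
          Psi '' component k a b c K = affOpp k a b (π c) K ∧
          Psi '' component k a b c K = latticeLocus K a b c) ∧
        -- the description in the ordinary partial flag variety
        ∃ w : Equiv.Perm (Fin (a + 2 * b)),
          (∀ (K : Type u) [Field K] [Algebra k K], ordOpp k a b w K = ordConditions K a b c) ∧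
          (∀ (R : Type u) [CommRing R] [Algebra k R] [IsReduced R],
            Set.BijOn truncFlag ((affOpp k a b (π c)).points R)
              ((ordIncidence k a b w).points R)) ∧
          (∀ (R S : Type u) [CommRing R] [Algebra k R] [IsReduced R] [CommRing S] [Algebra k S]
            (φ : R →ₐ[k] S), ∀ Λ ∈ (affOpp k a b (π c)).points R,
              truncFlag ((affFlag k a b).pull φ Λ) = (ordFlag k a b).pull φ (truncFlag Λ)) := by
  have hn : 0 < a + b := by omega
  refine ⟨⟨minimalPrimes_circIdeal k hab, stratumIdeal_injOn k hab⟩,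
    fun R S _ _ _ _ φ p hp => pullLattice_Psi hn φ.toRingHom hp,
    fun R _ _ g h p hp => ⟨pairAct_mem_circ g h hp, Psi_pairAct hn g h hp⟩,
    -- Only `c ≤ a` matters; the identity is a filler for the other values.
    fun c => if hc : c ≤ a then blockPerm hn hab hc else 1, fun c hc => ?_, fun R _ _ _ => ?_,
    fun c hc => ?_⟩
  · simp only [dif_pos hc]
    exact isBlockPerm_blockPerm hn hab hc
  · refine bijOn_Psi_points (T := fun K _ _ => circ K a b) hn (fun K _ _ => subset_rfl)
      (fun K _ _ => ?_) mem_circ_iff_forall_field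
    have h : circ K a b = ⋃ c ≤ a, component k a b c K := by
      ext p
      simp only [Set.mem_iUnion, exists_prop]
      exact mem_circ_iff_exists_component hab p
    rw [h, Set.image_iUnion₂]
    refine Set.iUnion₂_congr fun c hc => ?_
    simp only [dif_pos hc]
    exact image_component_eq_affOpp hn hab hc
  · simp only [dif_pos hc]
    have hbij : ∀ (R : Type u) [CommRing R] [Algebra k R] [IsReduced R],
        Set.BijOn Psi (component k a b c R) ((affOpp k a b (blockPerm hn hab hc)).points R) :=
      fun R _ _ _ => bijOn_Psi_points (T := fun K _ _ => component k a b c K) hn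
        (fun K _ _ p hp => (component_subset hp).1)
        (fun K _ _ => image_component_eq_affOpp hn hab hc) mem_component_iff_forall_field
    obtain ⟨w, hw⟩ := exists_isOrdPerm hab hc
    refine ⟨fun R _ _ _ g h p hp => pairAct_mem_component hab hc g h hp, hbij,
      fun K _ _ => ⟨image_component_eq_affOpp hn hab hc, image_component_eq_latticeLocus ha hab hc⟩,
      w, fun K _ _ => ordOpp_eq_ordConditions hw ha hab hc, fun R _ _ _ => ?_,
      fun R S _ _ _ _ _ φ Λ hΛ => ?_⟩
    · have hcirc : component k a b c R ⊆ circ R a b := fun p hp =>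
        (mem_circ_iff_forall_field (k := k) p).2 fun K _ _ φ =>
          (component_subset ((mem_component_iff_forall_field (k := k) p).1 hp K φ)).1
      have hg := bijOn_graphFlag (k := k) (R := R) hw ha hab hc
      -- Truncation after `Ψ` is `graphFlag`. Both `Ψ` and `graphFlag` are bijective on the points
      -- of `𝓛_c`, hence so is truncation on the image.
      have hcomp : Set.EqOn graphFlag (truncFlag ∘ Psi) (component k a b c R) :=
        fun p hp => (truncFlag_Psi hn (hcirc hp)).symm
      have hg' := hg.congr hcomp
      rw [← (hbij R).image_eq]
      refine ⟨?_, hg'.injOn.image_of_comp, ?_⟩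
      · rintro _ ⟨p, hp, rfl⟩
        exact hg'.mapsTo hp
      · rintro U hU
        obtain ⟨p, hp, rfl⟩ := hg'.surjOn hU
        exact ⟨Psi p, ⟨p, hp, rfl⟩, rfl⟩
    · refine Prod.ext ?_ ?_
      · change Submodule.map (trunc S a b) _ = spanMap φ.toRingHom (Submodule.map (trunc R a b) _)
        rw [trunc_eq_window, trunc_eq_window]
        exact window_pullLattice hn φ.toRingHom _ _ Λ.1
      · change Submodule.map (trunc S a b) _ = spanMap φ.toRingHom (Submodule.map (trunc R a b) _)
        rw [trunc_eq_window, trunc_eq_window]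
        exact window_pullLattice hn φ.toRingHom _ _ Λ.2
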